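/- **Definitions.** All graphs are finite, simple and undirected. *Weight sets.* A weight set $(W,\preceq,\oplus)$ is a totally ordered set with a maximum element $\mathrm{Error}$ and a commutative, associative operation $\oplus$ with a neutral element, such that $\mathrm{Error}$ is absorbing and $s_1\preceq s_2$ implies $s_1\oplus s_3\preceq s_2\oplus s_3$. *Instances.* Let $d,q$ be positive integers and let $[q]=\{1,\dots,q\}$ be the set of colours. An instance consists of a graph $G$ on $n$ vertices, a weight set $W$, a check function $check\colon V(G)\times[q]\times\mathbb N^q\to\{\text{true},\text{false}\}$, a weight function $\mathrm w\colon V(G)\times[q]\times\mathbb N^q\to W$, a set $\mathcal K$ of $q$-tuples of non-negative integers with sum $n$ (size constraints), and a set $\mathcal C$ of subsets of $[q]$ (connectivity constraints). For a colouring $c\colon V(G)\to[q]$ put $k_j(v)=|\{u\in N_G(v):c(u)=j\}|$. A function $f$ on $V(G)\times[q]\times\mathbb N^q$ is *$d$-stable* if $$f(v,c(v),k_1(v),\dots,k_q(v))=f(v,c(v),\min(d,k_1(v)),\dots,\min(d,k_q(v)))$$ for all vertices $v$ and all colourings $c$. Both $check$ and $\mathrm w$ are required to be $d$-stable. *The problem.*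 A colouring $c$ is *feasible* if $check(v,c(v),k_1(v),\dots,k_q(v))$ is true for every $v$, $(|c^{-1}(1)|,\dots,|c^{-1}(q)|)\in\mathcal K$, and $G[c^{-1}(C)]$ is connected for every $C\in\mathcal C$ (the empty graph counts as connected; non-emptiness can be demanded through $\mathcal K$). Its weight is $\bigoplus_{v\in V(G)}\mathrm w(v,c(v),k_1(v),\dots,k_q(v))$. To solve the instance is to return the minimum weight of a feasible colouring together with a feasible colouring of this weight, or to return $\mathrm{Error}$ and report that there is none if no colouring is feasible. *Mim-width.* A binary decomposition tree of $G$ is a rooted tree $T$ in which every non-leaf node has two children, with a bijection between $V(G)$ and the leaves of $T$. For a node $x$ let $T_x\subseteq V(G)$ be the set of vertices at the leaves below $x$. The mim-width of the tree is the maximum over all nodes $x$ of the maximum number of edges of an induced matching in the bipartite graph $G[T_x,V(G)\setminus T_x]$. *Model of computation.* The input is $G$, a binary decomposition tree of $G$, the tables of the values of $check$ and $\mathrm w$ at the arguments $(v,a,k_1,\dots,k_q)$ with $k_1,\dots,k_q\in\{0,\dots,d\}$, and lists of the elements of $\mathcal K$ and $\mathcal C$ without repetition. Programs work on binary trees (cons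 cells) whose leaves are nil or an element of $W$, and numbers are written in unary. The elementary steps are: producing the argument, nil, the neutral element or $\mathrm{Error}$; forming a cell; taking a component of a cell; composition; testing for nil (branching and loops); and, for elements of $W$, one application of $\oplus$ or one comparison by $\preceq$. Each counts as one step, and elements of $W$ can be accessed in no other way. **Theorem.** For all positive integers $d$ and $q$ there is a single program, not depending on the weight set, such that for every $m\in\mathbb N$ there is a polynomial $P$ (depending only on $d,q,m$) with the following property. On every instance, given with a binary decomposition tree of mim-width at most $m$, the program solves the instance within $P(n)$ steps, where $n=|V(G)|$. -/

import Mathlib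

namespace LocallyCheckable

universe u v

/-! ### Weight sets -/

/-- A weight set: a totally ordered set with a maximum element `⊤` (the error element) and a
commutative associative operation `+` with a neutral element `0`, monotone for the order, for
which `⊤` is absorbing. No cancellation is required. -/
class WeightSet (W : Type u) extends
    AddCommMonoid W, LinearOrder W, IsOrderedAddMonoid W, OrderTop W where
  top_absorbing : ∀ s : W, ⊤ + s = ⊤

/-! ### Binary decomposition trees and mim-width -/

/-- Rooted binary trees (every non-leaf node has two children) with leaves labelled by `V`. -/
inductive BinTree (V : Type u) : Type u
  | leaf (v : V) : BinTree V
  | node (l r : BinTree V) : BinTree V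

/-- The labels of the leaves, from left to right. -/
def BinTree.leaves {V : Type u} : BinTree V → List V
  | .leaf v => [v]
  | .node l r => l.leaves ++ r.leaves

/-- The leaf labelling is a bijection between the leaves and `V`, so that the tree is a binary
decomposition tree of every graph with vertex set `V`. -/
def BinTree.IsDecomposition {V : Type u} (T : BinTree V) : Prop :=
  T.leaves.Nodup ∧ ∀ v : V, v ∈ T.leaves

/-- The maximum number of edges of an induced matching in the bipartite graph `G[S, V ∖ S]`. -/
noncomputable def mim {V : Type u} (G : SimpleGraph V) (S : Set V) : ℕ :=
  sSup {m : ℕ | ∃ M : (G.between S Sᶜ).Subgraph,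
    M.IsInduced ∧ M.IsMatching ∧ M.edgeSet.ncard = m}

/-- The mim-width of a decomposition tree: the maximum over all its nodes `x` of `mim G T_x`,
where `T_x` is the set of labels of the leaves below `x`. -/
noncomputable def mimw {V : Type u} (G : SimpleGraph V) : BinTree V → ℕ
  | .leaf v => mim G {v}
  | .node l r => max (mim G {x | x ∈ (BinTree.node l r).leaves}) (max (mimw G l) (mimw G r))

/-! ### `d`-stable locally checkable problems, with size and connectivity constraints -/

section Problem

variable {V : Type v} [Fintype V] {q : ℕ}

/-- The number of neighbours of `x` which have colour `j` in the colouring `c`. -/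
def nbrCount (G : SimpleGraph V) [DecidableRel G.Adj] (c : V → Fin q) (x : V) (j : Fin q) : ℕ :=
  (Finset.univ.filter fun y => G.Adj x y ∧ c y = j).card

/-- `d`-stability of a colour-counting check or weight function `f (x, a, k₁, …, k_q)`. -/
def IsStable {α : Type u} (d : ℕ) (G : SimpleGraph V) [DecidableRel G.Adj]
    (f : V → Fin q → (Fin q → ℕ) → α) : Prop :=
  ∀ (x : V) (c : V → Fin q),
    f x (c x) (nbrCount G c x) = f x (c x) (fun j => min d (nbrCount G c x j))

/-- `c` is a proper colouring. -/
def IsProper (G : SimpleGraph V) [DecidableRel G.Adj] (check : V → Fin q → (Fin q → ℕ) → Bool)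
    (c : V → Fin q) : Prop :=
  ∀ x : V, check x (c x) (nbrCount G c x) = true

/-- The weight of a colouring. -/
def weight {W : Type u} [WeightSet W] (G : SimpleGraph V) [DecidableRel G.Adj]
    (w : V → Fin q → (Fin q → ℕ) → W) (c : V → Fin q) : W :=
  ∑ x : V, w x (c x) (nbrCount G c x)

/-- `c` is a proper colouring, its tuple of sizes of colour classes belongs to `𝒦`, and each set of
colours `C ∈ 𝒞` induces a connected subgraph (the empty subgraph counts as connected). -/
def IsFeasible (G : SimpleGraph V) [DecidableRel G.Adj] (check : V → Fin q → (Fin q → ℕ) → Bool)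
    (𝒦 : Finset (Fin q → ℕ)) (𝒞 : Finset (Finset (Fin q))) (c : V → Fin q) : Prop :=
  IsProper G check c ∧
  (fun j : Fin q => (Finset.univ.filter fun x => c x = j).card) ∈ 𝒦 ∧
  ∀ C ∈ 𝒞, (G.induce {x | c x ∈ C}).Preconnected

open Classical in
/-- The minimum weight of a feasible colouring, and `⊤` if there is none. -/
noncomputable def optimum {W : Type u} [WeightSet W] (G : SimpleGraph V) [DecidableRel G.Adj]
    (check : V → Fin q → (Fin q → ℕ) → Bool) (w : V → Fin q → (Fin q → ℕ) → W)
    (𝒦 : Finset (Fin q → ℕ)) (𝒞 : Finset (Finset (Fin q))) : W :=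
  (Finset.univ.filter fun c => IsFeasible G check 𝒦 𝒞 c).inf (weight G w)

end Problem

/-! ### The machine model

Programs manipulate binary trees (cons cells), whose leaves are `nil` or an element of the weight
set. Weights are atomic: they can only be copied, added, and compared, each in one step. A step
creates at most one new cell, which refers to existing ones, so that on data without weights
polynomially many steps are the same as polynomial time on a Turing machine. -/

/-- The data of the machine. -/
inductive Data (W : Type u) : Type u
  | nil : Data W
  | wt (a : W) : Data W
  | cons (x y : Data W) : Data W

namespace Data

variable {W : Type u}

/-- First component of a cell. -/
def fst : Data W → Data W
  | cons x _ => x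
  | _ => nil

/-- Second component of a cell. -/
def snd : Data W → Data W
  | cons _ y => y
  | _ => nil

/-- Truth values: `nil` is false, a cell is true. -/
def ofBool : Bool → Data W
  | false => nil
  | true => cons nil nil

/-- The sum of a cell of two weights. -/
def add [WeightSet W] : Data W → Data W
  | cons (wt a) (wt b) => wt (a + b)
  | _ => nil

/-- The comparison of a cell of two weights. -/
def le [WeightSet W] : Data W → Data W
  | cons (wt a) (wt b) => ofBool (decide (a ≤ b))
  | _ => nil

/-- Lists as right-nested cells ending in `nil`. -/
def ofList : List (Data W) → Data W
  | [] => nil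
  | x :: l => cons x (ofList l)

/-- Natural numbers in unary. -/
def ofNat (k : ℕ) : Data W := ofList (List.replicate k nil)

/-- A finite sequence of data. -/
def ofFn {n : ℕ} (f : Fin n → Data W) : Data W := ofList (List.ofFn f)

/-- The table of the values of `f` on `{0, …, d}^q`, as a `q`-dimensional array. -/
def table (d : ℕ) : (q : ℕ) → ((Fin q → ℕ) → Data W) → Data W
  | 0, f => f Fin.elim0
  | q + 1, f => ofFn fun i : Fin (d + 1) => table d q fun k => f (Fin.cons (i : ℕ) k)

/-- A graph is given by its adjacency matrix. -/
def ofGraph {n : ℕ} (G : SimpleGraph (Fin n)) [DecidableRel G.Adj] : Data W :=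
  ofFn fun x => ofFn fun y => ofBool (decide (G.Adj x y))

/-- A decomposition tree, each node being tagged as a leaf or an inner node. -/
def ofTree {n : ℕ} : BinTree (Fin n) → Data W
  | .leaf x => cons (ofBool false) (ofNat x)
  | .node l r => cons (ofBool true) (cons (ofTree l) (ofTree r))

/-- A function of a vertex, a colour, and `q` numbers is given by the table of its values at the
numbers in `{0, …, d}`. -/
def ofFunction {n q : ℕ} (d : ℕ) (f : Fin n → Fin q → (Fin q → ℕ) → Data W) : Data W :=
  ofFn fun x => ofFn fun a => table d q (f x a)

/-- A `q`-tuple of numbers. -/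
def ofTuple {q : ℕ} (K : Fin q → ℕ) : Data W := ofFn fun j => ofNat (K j)

/-- A set of colours is given by its characteristic vector. -/
def ofColors {q : ℕ} (C : Finset (Fin q)) : Data W := ofFn fun j => ofBool (decide (j ∈ C))

/-- A colouring is given by the sequence of the colours of the vertices. -/
def ofColoring {n q : ℕ} (c : Fin n → Fin q) : Data W := ofFn fun x => ofNat (c x)

/-- The input of the algorithm: graph, decomposition tree, check function, weight function, size
constraints and connectivity constraints (the two sets of constraints being listed). -/
def input {n q : ℕ} (d : ℕ) (G : SimpleGraph (Fin n)) [DecidableRel G.Adj] (T : BinTree (Fin n))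
    (check : Fin n → Fin q → (Fin q → ℕ) → Bool) (w : Fin n → Fin q → (Fin q → ℕ) → W)
    (Ks : List (Fin q → ℕ)) (Cs : List (Finset (Fin q))) : Data W :=
  ofList [ofGraph G, ofTree T,
    ofFunction d fun x a k => ofBool (check x a k),
    ofFunction d fun x a k => wt (w x a k),
    ofList (Ks.map ofTuple), ofList (Cs.map ofColors)]

end Data

/-- Programs. They do not depend on the weight set. -/
inductive Prog : Type
  /-- return the argument -/
  | ident : Prog
  /-- the constant `nil` -/
  | nil : Prog
  /-- the neutral element of the weight set -/
  | zero : Prog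
  /-- the maximum element of the weight set -/
  | top : Prog
  /-- components of a cell -/
  | fst : Prog
  | snd : Prog
  /-- sum and comparison of two weights -/
  | add : Prog
  | le : Prog
  /-- a new cell with the results of two programs on the argument -/
  | pair (p r : Prog) : Prog
  /-- run `p`, then run `r` on the result -/
  | seq (p r : Prog) : Prog
  /-- run `p` if the test `b` does not give `nil`, otherwise run `r` -/
  | ite (b p r : Prog) : Prog
  /-- repeat `p` as long as the test `b` does not give `nil` -/
  | loop (b p : Prog) : Prog

/-- `Runs p x y t`: on argument `x` the program `p` halts with result `y` after `t` steps. -/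
inductive Runs {W : Type u} [WeightSet W] : Prog → Data W → Data W → ℕ → Prop
  | ident (x) : Runs .ident x x 1
  | nil (x) : Runs .nil x .nil 1
  | zero (x) : Runs .zero x (.wt 0) 1
  | top (x) : Runs .top x (.wt ⊤) 1
  | fst (x) : Runs .fst x x.fst 1
  | snd (x) : Runs .snd x x.snd 1
  | add (x) : Runs .add x x.add 1
  | le (x) : Runs .le x x.le 1
  | pair {p r x y z s t} : Runs p x y s → Runs r x z t →
      Runs (.pair p r) x (.cons y z) (s + t + 1)
  | seq {p r x y z s t} : Runs p x y s → Runs r y z t → Runs (.seq p r) x z (s + t + 1)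
  | ite_true {b p r x a y s t} : Runs b x a s → a ≠ .nil → Runs p x y t →
      Runs (.ite b p r) x y (s + t + 1)
  | ite_false {b p r x y s t} : Runs b x .nil s → Runs r x y t →
      Runs (.ite b p r) x y (s + t + 1)
  | loop_stop {b p x s} : Runs b x .nil s → Runs (.loop b p) x x (s + 1)
  | loop_step {b p x a y z s t r} : Runs b x a s → a ≠ .nil → Runs p x y t →
      Runs (.loop b p) y z r → Runs (.loop b p) x z (s + t + r + 1)

/-- `out` is a correct answer: the minimum weight of a feasible colouring together with a feasible
colouring of this weight, or the maximum element `⊤` and the mark `nil` if no colouring is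
feasible. -/
def IsSolution {n q : ℕ} {W : Type u} [WeightSet W] (G : SimpleGraph (Fin n)) [DecidableRel G.Adj]
    (check : Fin n → Fin q → (Fin q → ℕ) → Bool) (w : Fin n → Fin q → (Fin q → ℕ) → W)
    (𝒦 : Finset (Fin q → ℕ)) (𝒞 : Finset (Finset (Fin q))) (out : Data W) : Prop :=
  (∃ c : Fin n → Fin q, IsFeasible G check 𝒦 𝒞 c ∧ weight G w c = optimum G check w 𝒦 𝒞 ∧
    out = .cons (.wt (optimum G check w 𝒦 𝒞)) (Data.ofColoring c)) ∨
  ((∀ c : Fin n → Fin q, ¬ IsFeasible G check 𝒦 𝒞 c) ∧ out = .cons (.wt ⊤) .nil)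

end LocallyCheckable

/-!
The problem is solved by dynamic programming along the decomposition tree, with a list of partial
colourings for each subtree.

Let `A` be the set of vertices below a node. A list `L` of partial colourings with domain `A`
*represents* the problem (`Represents`) if each feasible colouring can be changed on `A` to a member
of `L` so that it stays feasible and does not become heavier. This property is inherited by the set
of all unions of members of two such lists for the two children (`Represents.products`), so what has
to be shown is that a list can be replaced by a short one (`Represents.reduce`).

For this, one runs through all *contexts*, which are small pieces `ρ'` of colourings of the
complement of `A`. Each colouring `c` has a context (`exists_isContext`): remove vertices from a
colour class outside of `A` as long as this does not change the numbers, truncated at `d`, of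
neighbours of the vertices of `A`. The sets in which nothing more can be removed are called
irredundant. An irredundant set is a union of `d` sides of induced matchings across the cut, and
thus has at most `d * mim G A` elements (`Irredundant.card_le_mim`). Being irredundant is
hereditary, so the contexts can be enumerated vertex by vertex without knowing the mim-width; their
number is polynomial when the mim-width is bounded.

Given a context, two partial colourings of `A` are *similar* (`Similar`) if they agree in the
truncated neighbour counts of the outer vertices, in the sizes of the colour classes, and in the
following data for each connectivity constraint. Let `S` be the set of vertices of `A` with one of
the prescribed colours, and let `R` be the corresponding part of the context. If the final set is
connected and goes beyond `A`, then each component of `S` has a neighbour in `R`, since `R`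
dominates as much of `A` as all outer vertices with these colours. So for the outer world `S` is
described by the sets of outer vertices attached to the components of the graph on `S ∪ R`, one for
each element of `R` (`ConnectedOn.exchange`). Similar colourings can be exchanged
(`IsContext.exchange`), and by irredundance again there are polynomially many classes
(`Admissible.length_le_classBound`). Hence it suffices to keep one colouring of minimum weight for
each context and each class.

That all this is done by one program within polynomial time is shown for families of values: `Comp`
says that some program computes `g i` from `e i` for all inputs `i`, in a time which is polynomial
as long as the parameter is bounded. This relation is closed under the operations of the machine,
under loops over lists of polynomial length (`Comp.loop`) and under recursion over trees
(`Comp.treeRec`), hence under quantifiers, counting, and sums over vertices. So the definitions of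
the algorithm, written as mathematical formulas, are also its implementation.
-/

namespace LocallyCheckable

universe u v w w'

/-! ### Programs whose running time is polynomial for each value of a parameter -/

/-- The weight set, the size and the parameter of an input. -/
structure Setting : Type (u + 1) where
  /-- the weight set -/
  W : Type u
  [weightSet : WeightSet W]
  /-- the quantity in which the running time has to be polynomial -/
  size : ℕ
  /-- the parameter, on which the polynomial may depend -/
  param : ℕ

attribute [instance] Setting.weightSet

/-- A family of numbers is polynomially bounded in the size as long as the parameter is bounded.
Powers of `size + 2` serve as bounds, since they are closed under sums and products up to a change
of the exponent. -/
def PolyBdd {ι : Type v} (π : ι → Setting.{u}) (f : ι → ℕ) : Prop :=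
  ∀ M, ∃ k, ∀ i, (π i).param ≤ M → f i ≤ ((π i).size + 2) ^ k

namespace PolyBdd

variable {ι : Type v} {ι' : Type w} {π : ι → Setting.{u}} {f g : ι → ℕ}

theorem mono (hg : PolyBdd π g) (h : ∀ i, f i ≤ g i) : PolyBdd π f := fun M => by
  obtain ⟨k, hk⟩ := hg M
  exact ⟨k, fun i hi => (h i).trans (hk i hi)⟩

theorem of_param {b : ℕ → ℕ} (h : ∀ i, f i ≤ b (π i).param) (hb : Monotone b) : PolyBdd π f :=
  fun M => ⟨b M, fun i hi => ((h i).trans (hb hi)).trans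
    ((Nat.lt_pow_self (by omega)).le)⟩

theorem const (c : ℕ) : PolyBdd π fun _ => c :=
  of_param (b := fun _ => c) (fun _ => le_rfl) monotone_const

theorem size : PolyBdd π fun i => (π i).size := fun _ => ⟨1, fun i _ => by simp⟩

theorem add (hf : PolyBdd π f) (hg : PolyBdd π g) : PolyBdd π fun i => f i + g i := fun M => by
  obtain ⟨k, hk⟩ := hf M
  obtain ⟨l, hl⟩ := hg M
  refine ⟨k + l + 1, fun i hi => ?_⟩
  have h1 : ((π i).size + 2) ^ k ≤ ((π i).size + 2) ^ (k + l) :=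
    Nat.pow_le_pow_right (by omega) (by omega)
  have h2 : ((π i).size + 2) ^ l ≤ ((π i).size + 2) ^ (k + l) :=
    Nat.pow_le_pow_right (by omega) (by omega)
  calc f i + g i ≤ ((π i).size + 2) ^ (k + l) * 2 := by linarith [hk i hi, hl i hi]
    _ ≤ ((π i).size + 2) ^ (k + l + 1) := by
      rw [pow_succ]; exact Nat.mul_le_mul_left _ (by omega)

theorem mul (hf : PolyBdd π f) (hg : PolyBdd π g) : PolyBdd π fun i => f i * g i := fun M => by
  obtain ⟨k, hk⟩ := hf M
  obtain ⟨l, hl⟩ := hg M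
  refine ⟨k + l, fun i hi => ?_⟩
  rw [pow_add]
  exact Nat.mul_le_mul (hk i hi) (hl i hi)

/-- The exponent may depend on the parameter. -/
theorem pow (hf : PolyBdd π f) {b : ℕ → ℕ} (hb : Monotone b) :
    PolyBdd π fun i => f i ^ b (π i).param := fun M => by
  obtain ⟨k, hk⟩ := hf M
  refine ⟨k * b M, fun i hi => ?_⟩
  rw [pow_mul]
  exact (Nat.pow_le_pow_left (hk i hi) _).trans
    (Nat.pow_le_pow_right (by positivity) (hb hi))

theorem reindex (hf : PolyBdd π f) (r : ι' → ι) : PolyBdd (fun j => π (r j)) fun j => f (r j) :=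
  fun M => by
    obtain ⟨k, hk⟩ := hf M
    exact ⟨k, fun j => hk (r j)⟩

end PolyBdd

/-- Some program computes `g i` from `e i` for all `i`, in a time which is polynomially bounded.
The family `e` plays the part of the environment in which `g` is evaluated. -/
def Comp {ι : Type v} (π : ι → Setting.{u}) (e g : ∀ i, Data (π i).W) : Prop :=
  ∃ p : Prog, ∀ M, ∃ k, ∀ i, (π i).param ≤ M →
    ∃ t ≤ ((π i).size + 2) ^ k, Runs p (e i) (g i) t

/-- Truth values of propositions. -/
noncomputable def bit {W : Type u} (p : Prop) : Data W :=
  open Classical in if p then .cons .nil .nil else .nil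

theorem bit_pos {W : Type u} {p : Prop} (h : p) : (bit p : Data W) = .cons .nil .nil := if_pos h

theorem bit_neg {W : Type u} {p : Prop} (h : ¬ p) : (bit p : Data W) = .nil := if_neg h

theorem bit_ne_nil {W : Type u} {p : Prop} : (bit p : Data W) ≠ .nil ↔ p := by
  by_cases h : p <;> simp [bit, h]

theorem ofBool_eq_bit {W : Type u} (b : Bool) : (Data.ofBool b : Data W) = bit (b = true) := by
  cases b <;> simp [bit, Data.ofBool]

theorem ofBool_decide {W : Type u} (p : Prop) [Decidable p] :
    (Data.ofBool (decide p) : Data W) = bit p := by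
  rw [ofBool_eq_bit, decide_eq_true_eq]

/-! ### The steps of loops and recursions as inputs of computations -/

/-- The step number `k` of a loop with `N i` steps. -/
structure Step {ι : Type v} (N : ι → ℕ) : Type v where
  /-- the index of the input -/
  i : ι
  /-- the number of the step -/
  k : Fin (N i)

/-- A leaf to be evaluated. -/
structure LeafStep {ι : Type v} (N : ι → ℕ)
    (Inv : ∀ i, BinTree (Fin (N i)) → Prop) : Type v where
  /-- the index of the input -/
  i : ι
  /-- the label of the leaf -/
  x : Fin (N i)
  inv : Inv i (.leaf x)

/-- An inner node to be evaluated. -/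
structure NodeStep {ι : Type v} (N : ι → ℕ)
    (Inv : ∀ i, BinTree (Fin (N i)) → Prop) : Type v where
  /-- the index of the input -/
  i : ι
  /-- the left subtree -/
  l : BinTree (Fin (N i))
  /-- the right subtree -/
  r : BinTree (Fin (N i))
  inv : Inv i (.node l r)

namespace Comp

variable {ι : Type v} {ι' : Type w} {π : ι → Setting.{u}} {e g h : ∀ i, Data (π i).W}

theorem of_bound (p : Prog) {T : ι → ℕ} (hT : PolyBdd π T)
    (h : ∀ i, ∃ t ≤ T i, Runs p (e i) (g i) t) : Comp π e g :=
  ⟨p, fun M => by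
    obtain ⟨k, hk⟩ := hT M
    exact ⟨k, fun i hi => let ⟨t, ht, hr⟩ := h i; ⟨t, ht.trans (hk i hi), hr⟩⟩⟩

theorem of_const (p : Prog) (c : ℕ) (h : ∀ i, Runs p (e i) (g i) c) : Comp π e g :=
  of_bound p (.const c) fun i => ⟨c, le_rfl, h i⟩

/-- The running time of a single program as a function. -/
theorem exists_time (hg : Comp π e g) : ∃ (p : Prog) (T : ι → ℕ), PolyBdd π T ∧
    ∀ i, Runs p (e i) (g i) (T i) := by
  obtain ⟨p, hp⟩ := hg
  have : ∀ i, ∃ t, Runs p (e i) (g i) t ∧ ∀ t', Runs p (e i) (g i) t' → t ≤ t' := fun i => by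
    classical
    obtain ⟨k, hk⟩ := hp (π i).param
    obtain ⟨t, -, ht⟩ := hk i le_rfl
    have hex : ∃ t, Runs p (e i) (g i) t := ⟨t, ht⟩
    exact ⟨Nat.find hex, Nat.find_spec hex, fun t' ht' => Nat.find_min' hex ht'⟩
  choose T hT hmin using this
  refine ⟨p, T, fun M => ?_, hT⟩
  obtain ⟨k, hk⟩ := hp M
  exact ⟨k, fun i hi => let ⟨t, ht, hr⟩ := hk i hi; (hmin i t hr).trans ht⟩

theorem congr (hg : Comp π e g) (hgh : ∀ i, g i = h i) : Comp π e h := by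
  rwa [← funext hgh]

theorem ident : Comp π e e := of_const .ident 1 fun _ => .ident _

theorem nil : Comp π e fun _ => .nil := of_const .nil 1 fun _ => .nil _

theorem zero : Comp π e fun _ => .wt 0 := of_const .zero 1 fun _ => .zero _

theorem top : Comp π e fun _ => .wt ⊤ := of_const .top 1 fun _ => .top _

theorem seq (hg : Comp π e g) (hh : Comp π g h) : Comp π e h := by
  obtain ⟨p, S, hS, hp⟩ := hg.exists_time
  obtain ⟨r, T, hT, hr⟩ := hh.exists_time
  exact of_bound (.seq p r) ((hS.add hT).add (.const 1)) fun i =>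
    ⟨_, le_rfl, .seq (hp i) (hr i)⟩

theorem fst (hg : Comp π e g) : Comp π e fun i => (g i).fst :=
  hg.seq (of_const .fst 1 fun _ => .fst _)

theorem snd (hg : Comp π e g) : Comp π e fun i => (g i).snd :=
  hg.seq (of_const .snd 1 fun _ => .snd _)

theorem pair (hg : Comp π e g) (hh : Comp π e h) : Comp π e fun i => .cons (g i) (h i) := by
  obtain ⟨p, S, hS, hp⟩ := hg.exists_time
  obtain ⟨r, T, hT, hr⟩ := hh.exists_time
  exact of_bound (.pair p r) ((hS.add hT).add (.const 1)) fun i =>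
    ⟨_, le_rfl, .pair (hp i) (hr i)⟩

theorem wt_add {a b : ∀ i, (π i).W} (ha : Comp π e fun i => .wt (a i))
    (hb : Comp π e fun i => .wt (b i)) : Comp π e fun i => .wt (a i + b i) :=
  (ha.pair hb).seq (of_const .add 1 fun _ => .add _)

theorem wt_le {a b : ∀ i, (π i).W} (ha : Comp π e fun i => .wt (a i))
    (hb : Comp π e fun i => .wt (b i)) : Comp π e fun i => bit (a i ≤ b i) :=
  ((ha.pair hb).seq (of_const .le 1 fun _ => .le _)).congr fun _ => ofBool_decide _

/-- Branching on whether a value is `nil`. -/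
theorem ite_data {b : ∀ i, Data (π i).W} {p : ι → Prop} [∀ i, Decidable (p i)]
    (hb : Comp π e b) (hbp : ∀ i, b i ≠ .nil ↔ p i) (hg : Comp π e g) (hh : Comp π e h) :
    Comp π e fun i => if p i then g i else h i := by
  obtain ⟨pb, R, hR, hb⟩ := hb.exists_time
  obtain ⟨pg, S, hS, hg⟩ := hg.exists_time
  obtain ⟨ph, T, hT, hh⟩ := hh.exists_time
  refine of_bound (.ite pb pg ph) (((hR.add hS).add hT).add (.const 1)) fun i => ?_
  by_cases hp : p i
  · refine ⟨R i + S i + 1, by omega, ?_⟩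
    rw [if_pos hp]
    exact .ite_true (hb i) ((hbp i).2 hp) (hg i)
  · have h0 : b i = .nil := by
      by_contra h0
      exact hp ((hbp i).1 h0)
    refine ⟨R i + T i + 1, by omega, ?_⟩
    rw [if_neg hp]
    exact .ite_false (h0 ▸ hb i) (hh i)

theorem ite {p : ι → Prop} [∀ i, Decidable (p i)] (hb : Comp π e fun i => bit (p i))
    (hg : Comp π e g) (hh : Comp π e h) : Comp π e fun i => if p i then g i else h i :=
  ite_data hb (fun _ => bit_ne_nil) hg hh

theorem reindex (hg : Comp π e g) (r : ι' → ι) :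
    Comp (fun j => π (r j)) (fun j => e (r j)) fun j => g (r j) := by
  obtain ⟨p, hp⟩ := hg
  refine ⟨p, fun M => ?_⟩
  obtain ⟨k, hk⟩ := hp M
  exact ⟨k, fun j => hk (r j)⟩

/-- Weakening: what can be computed in an environment can be computed in each extension of it. -/
theorem up (hg : Comp π e g) {r : ι' → ι} {x : ∀ j, Data (π (r j)).W} :
    Comp (fun j => π (r j)) (fun j => .cons (x j) (e (r j))) fun j => g (r j) :=
  (Comp.ident (π := fun j => π (r j)) (e := fun j => .cons (x j) (e (r j)))).snd.seq (hg.reindex r)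

/-- Weakening by two values. -/
theorem up₂ (hg : Comp π e g) {r : ι' → ι} {x y : ∀ j, Data (π (r j)).W} :
    Comp (fun j => π (r j)) (fun j => .cons (x j) (.cons (y j) (e (r j)))) fun j => g (r j) :=
  (Comp.ident (π := fun j => π (r j))
    (e := fun j => .cons (x j) (.cons (y j) (e (r j))))).snd.snd.seq (hg.reindex r)

/-- Weakening by three values. -/
theorem up₃ (hg : Comp π e g) {r : ι' → ι} {x y z : ∀ j, Data (π (r j)).W} :
    Comp (fun j => π (r j)) (fun j => .cons (x j) (.cons (y j) (.cons (z j) (e (r j)))))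
      fun j => g (r j) :=
  (Comp.ident (π := fun j => π (r j))
    (e := fun j => .cons (x j) (.cons (y j) (.cons (z j) (e (r j)))))).snd.snd.snd.seq
      (hg.reindex r)

/-- Weakening by four values. -/
theorem up₄ (hg : Comp π e g) {r : ι' → ι} {x y z z' : ∀ j, Data (π (r j)).W} :
    Comp (fun j => π (r j))
      (fun j => .cons (x j) (.cons (y j) (.cons (z j) (.cons (z' j) (e (r j))))))
      fun j => g (r j) :=
  (Comp.ident (π := fun j => π (r j))
    (e := fun j => .cons (x j) (.cons (y j) (.cons (z j) (.cons (z' j)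
      (e (r j))))))).snd.snd.snd.snd.seq (hg.reindex r)

/-- The most recent value of an environment. -/
theorem var₀ {x y : ∀ i, Data (π i).W} : Comp π (fun i => .cons (x i) (y i)) x :=
  (Comp.ident (π := π) (e := fun i => .cons (x i) (y i))).fst

/-- The second most recent value of an environment. -/
theorem var₁ {x y z : ∀ i, Data (π i).W} :
    Comp π (fun i => .cons (x i) (.cons (y i) (z i))) y :=
  (Comp.ident (π := π) (e := fun i => .cons (x i) (.cons (y i) (z i)))).snd.fst

/-- The third most recent value of an environment. -/
theorem var₂ {x y z z' : ∀ i, Data (π i).W} :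
    Comp π (fun i => .cons (x i) (.cons (y i) (.cons (z i) (z' i)))) z :=
  (Comp.ident (π := π)
    (e := fun i => .cons (x i) (.cons (y i) (.cons (z i) (z' i))))).snd.snd.fst

/-- The fourth most recent value of an environment. -/
theorem var₃ {x y z z' z'' : ∀ i, Data (π i).W} :
    Comp π (fun i => .cons (x i) (.cons (y i) (.cons (z i) (.cons (z' i) (z'' i))))) z' :=
  (Comp.ident (π := π)
    (e := fun i => .cons (x i) (.cons (y i) (.cons (z i) (.cons (z' i) (z'' i)))))).snd.snd.snd.fst

/-! ### Loops over lists -/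

/-- A loop over a list, whose states are `s i 0, s i 1, …`. -/
theorem loop {L : ∀ i, List (Data (π i).W)} {s : ∀ i, ℕ → Data (π i).W}
    (hL : Comp π e fun i => .ofList (L i)) (hb : PolyBdd π fun i => (L i).length)
    (h0 : Comp π e fun i => s i 0)
    (hs : Comp (fun j : Step fun i => (L i).length => π j.i)
      (fun j => .cons (L j.i)[j.k] (.cons (s j.i j.k) (e j.i))) fun j => s j.i (j.k + 1)) :
    Comp π e fun i => s i (L i).length := by
  obtain ⟨pL, TL, hTL, hL⟩ := hL.exists_time
  obtain ⟨p0, T0, hT0, h0⟩ := h0.exists_time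
  obtain ⟨ps, hs⟩ := hs
  -- the state of the loop is a cell of the remaining list, the value, and the environment
  let body : Prog := .pair (.seq .fst .snd)
    (.pair (.seq (.pair (.seq .fst .fst) .snd) ps) (.seq .snd .snd))
  have key : ∀ (i : ι) (B : ℕ),
      (∀ k : Fin (L i).length, ∃ t ≤ B,
        Runs ps (.cons (L i)[k] (.cons (s i k) (e i))) (s i (k + 1)) t) →
      ∀ r k : ℕ, k + r = (L i).length → ∃ t ≤ r * (B + 20) + 2,
        Runs (.loop .fst body) (.cons (.ofList ((L i).drop k)) (.cons (s i k) (e i)))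
          (.cons .nil (.cons (s i (L i).length) (e i))) t := by
    intro i B hB r
    induction r with
    | zero =>
      intro k hk
      obtain rfl : k = (L i).length := by omega
      refine ⟨2, by omega, ?_⟩
      rw [List.drop_length]
      exact Runs.loop_stop (.fst _)
    | succ r ih =>
      intro k hk
      obtain ⟨t, ht, hr⟩ := ih (k + 1) (by omega)
      obtain ⟨t', ht', hr'⟩ := hB ⟨k, by omega⟩
      rw [List.drop_eq_getElem_cons (show k < (L i).length by omega)]
      refine ⟨_, ?_, .loop_step (.fst _) (by simp [Data.ofList, Data.fst])
        (.pair (.seq (.fst _) (.snd _)) (.pair (.seq (.pair (.seq (.fst _) (.fst _)) (.snd _)) hr')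
          (.seq (.snd _) (.snd _)))) hr⟩
      ring_nf at ht ⊢
      omega
  refine ⟨.seq (.pair pL (.pair p0 .ident)) (.seq (.loop .fst body) (.seq .snd .fst)),
    fun M => ?_⟩
  obtain ⟨k, hk⟩ := hs M
  have hB : PolyBdd π fun i => ((π i).size + 2) ^ k := fun _ => ⟨k, fun _ _ => le_rfl⟩
  obtain ⟨k', hk'⟩ := ((hTL.add hT0).add ((hb.mul (hB.add (.const 20))).add (.const 20))) M
  refine ⟨k', fun i hi => ?_⟩
  obtain ⟨t, ht, hr⟩ := key i (((π i).size + 2) ^ k) (fun k => hk ⟨i, k⟩ hi) (L i).length 0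
    (by omega)
  refine ⟨_, ?_, .seq (.pair (hL i) (.pair (h0 i) (.ident _)))
    (.seq hr (.seq (.snd _) (.fst _)))⟩
  have := hk' i hi
  dsimp only at this
  omega

/-! ### Recursion over decomposition trees -/

/-- Recursion over a tree, by a loop with a stack of tasks and a stack of values. A task is
a subtree to be evaluated, or `nil` for combining the two topmost values. -/
theorem treeRec {N : ι → ℕ} {T : ∀ i, BinTree (Fin (N i))}
    {F : ∀ i, BinTree (Fin (N i)) → Data (π i).W} {Inv : ∀ i, BinTree (Fin (N i)) → Prop}
    (hT : Comp π e fun i => .ofTree (T i)) (hb : PolyBdd π fun i => (T i).leaves.length)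
    (hInv : ∀ i, Inv i (T i)) (hsub : ∀ i l r, Inv i (.node l r) → Inv i l ∧ Inv i r)
    (hleaf : Comp (fun j : LeafStep N Inv => π j.i) (fun j => .cons (.ofNat j.x) (e j.i))
      fun j => F j.i (.leaf j.x))
    (hnode : Comp (fun j : NodeStep N Inv => π j.i)
      (fun j => .cons (F j.i j.l) (.cons (F j.i j.r) (e j.i))) fun j => F j.i (.node j.l j.r)) :
    Comp π e fun i => F i (T i) := by
  obtain ⟨pT, TT, hTT, hT⟩ := hT.exists_time
  obtain ⟨pl, hleaf⟩ := hleaf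
  obtain ⟨pn, hnode⟩ := hnode
  -- the state is a cell of the tasks, the values, and the environment
  let task : Prog := .seq .fst .fst
  let rest : Prog := .seq .fst .snd
  let vals : Prog := .seq .snd .fst
  let env : Prog := .seq .snd .snd
  let split : Prog := .pair (.pair (.seq task (.seq .snd .fst))
    (.pair (.seq task (.seq .snd .snd)) (.pair .nil rest))) .snd
  let eval : Prog := .pair rest
    (.pair (.pair (.seq (.pair (.seq task .snd) env) pl) vals) env)
  let combine : Prog := .pair rest
    (.pair (.pair (.seq (.pair (.seq vals (.seq .snd .fst)) (.pair (.seq vals .fst) env)) pn)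
      (.seq vals (.seq .snd .snd))) env)
  let body : Prog := .ite task (.ite (.seq task .fst) split eval) combine
  have key : ∀ (i : ι) (B : ℕ),
      (∀ x, Inv i (.leaf x) → ∃ t ≤ B, Runs pl (.cons (.ofNat x) (e i)) (F i (.leaf x)) t) →
      (∀ l r, Inv i (.node l r) → ∃ t ≤ B,
        Runs pn (.cons (F i l) (.cons (F i r) (e i))) (F i (.node l r)) t) →
      ∀ (S : BinTree (Fin (N i))), Inv i S → ∀ (ws vs z : Data (π i).W) (t : ℕ),
        Runs (.loop .fst body) (.cons ws (.cons (.cons (F i S) vs) (e i))) z t →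
        ∃ t' ≤ t + 3 * S.leaves.length * (B + 100) - 2 * (B + 100),
          Runs (.loop .fst body) (.cons (.cons (.ofTree S) ws) (.cons vs (e i))) z t' := by
    intro i B hl hn S
    induction S with
    | leaf x =>
      intro hS ws vs z t hr
      obtain ⟨t', ht', hr'⟩ := hl x hS
      refine ⟨_, ?_, .loop_step (.fst _) (by simp [Data.fst])
        (.ite_true (.seq (.fst _) (.fst _)) (by simp [Data.fst, Data.ofTree])
          (.ite_false (.seq (.seq (.fst _) (.fst _)) (.fst _))
            (.pair (.seq (.fst _) (.snd _)) (.pair (.pair (.seq (.pair (.seq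
              (.seq (.fst _) (.fst _)) (.snd _)) (.seq (.snd _) (.snd _))) hr')
              (.seq (.snd _) (.fst _))) (.seq (.snd _) (.snd _)))))) hr⟩
      simp only [BinTree.leaves, List.length_singleton]
      omega
    | node l r ihl ihr =>
      intro hS ws vs z t hr
      obtain ⟨t₀, ht₀, hr₀⟩ := hn l r hS
      obtain ⟨t₁, ht₁, hr₁⟩ := ihr (hsub i l r hS).2 (.cons .nil ws) (.cons (F i l) vs) z _
        (.loop_step (.fst _) (by simp [Data.fst])
          (.ite_false (.seq (.fst _) (.fst _))
            (.pair (.seq (.fst _) (.snd _)) (.pair (.pair (.seq (.pair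
              (.seq (.seq (.snd _) (.fst _)) (.seq (.snd _) (.fst _)))
              (.pair (.seq (.seq (.snd _) (.fst _)) (.fst _)) (.seq (.snd _) (.snd _)))) hr₀)
              (.seq (.seq (.snd _) (.fst _)) (.seq (.snd _) (.snd _))))
              (.seq (.snd _) (.snd _))))) hr)
      obtain ⟨t₂, ht₂, hr₂⟩ := ihl (hsub i l r hS).1 (.cons (.ofTree r) (.cons .nil ws)) vs z _ hr₁
      refine ⟨_, ?_, .loop_step (.fst _) (by simp [Data.fst])
        (.ite_true (.seq (.fst _) (.fst _)) (by simp [Data.fst, Data.ofTree])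
          (.ite_true (.seq (.seq (.fst _) (.fst _)) (.fst _))
            (by simp [Data.fst, Data.ofTree, Data.ofBool])
            (.pair (.pair (.seq (.seq (.fst _) (.fst _)) (.seq (.snd _) (.fst _)))
              (.pair (.seq (.seq (.fst _) (.fst _)) (.seq (.snd _) (.snd _)))
                (.pair (.nil _) (.seq (.fst _) (.snd _))))) (.snd _)))) hr₂⟩
      have hpos : ∀ S : BinTree (Fin (N i)), 0 < S.leaves.length := fun S => by
        induction S with
        | leaf x => simp [BinTree.leaves]
        | node l r h _ => simp only [BinTree.leaves, List.length_append]; omega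
      have h1 := hpos l
      have h2 := hpos r
      have h3 : 1 * (B + 100) ≤ l.leaves.length * (B + 100) := Nat.mul_le_mul_right _ h1
      have h4 : 1 * (B + 100) ≤ r.leaves.length * (B + 100) := Nat.mul_le_mul_right _ h2
      simp only [BinTree.leaves, List.length_append, mul_add, add_mul, mul_assoc] at *
      omega
  refine ⟨.seq (.pair (.pair pT .nil) (.pair .nil .ident))
    (.seq (.loop .fst body) (.seq .snd (.seq .fst .fst))), fun M => ?_⟩
  obtain ⟨k, hk⟩ := hleaf M
  obtain ⟨l, hl⟩ := hnode M
  have hB : ∀ k, PolyBdd π fun i => ((π i).size + 2) ^ k := fun k _ => ⟨k, fun _ _ => le_rfl⟩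
  obtain ⟨k', hk'⟩ := (hTT.add ((((PolyBdd.const 3).mul hb).mul
    (((hB k).add (hB l)).add (.const 100))).add (.const 40))) M
  refine ⟨k', fun i hi => ?_⟩
  obtain ⟨t, ht, hr⟩ := key i (((π i).size + 2) ^ k + ((π i).size + 2) ^ l)
    (fun x hx => let ⟨t, ht, hr⟩ := hk ⟨i, x, hx⟩ hi; ⟨t, ht.trans (Nat.le_add_right _ _), hr⟩)
    (fun a b hab => let ⟨t, ht, hr⟩ := hl ⟨i, a, b, hab⟩ hi
      ⟨t, ht.trans (Nat.le_add_left _ _), hr⟩)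
    (T i) (hInv i) .nil .nil _ _ (Runs.loop_stop (.fst _))
  refine ⟨_, ?_, .seq (.pair (.pair (hT i) (.nil _)) (.pair (.nil _) (.ident _)))
    (.seq hr (.seq (.snd _) (.seq (.fst _) (.fst _))))⟩
  have := hk' i hi
  dsimp only at this
  omega

end Comp

/-- A list of encoded values. -/
def encodeList {W : Type u} {α : Type v} (enc : α → Data W)
    (l : List α) : Data W :=
  .ofList (l.map enc)

/-- The step of a loop over a list, with an invariant for the element and the state. -/
structure FoldStep {ι : Type v} {α : ι → Type w} {σ : ι → Type w'}
    (Inv : ∀ i, α i → σ i → Prop) : Type max v w w' where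
  /-- the index of the input -/
  i : ι
  /-- the element of the list -/
  x : α i
  /-- the state -/
  s : σ i
  inv : Inv i x s

/-- An element of a list which depends on the input. -/
structure Elem {ι : Type v} {α : ι → Type w} (l : ∀ i, List (α i)) :
    Type max v w where
  /-- the index of the input -/
  i : ι
  /-- the element -/
  x : α i
  mem : x ∈ l i

namespace Comp

variable {ι : Type v} {ι' : Type w} {π : ι → Setting.{u}} {e g h : ∀ i, Data (π i).W}

/-! ### Logic and arithmetic -/

theorem true : Comp π e fun _ => bit True :=
  (nil.pair nil).congr fun _ => (bit_pos trivial).symm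

theorem and {p q : ι → Prop} (hp : Comp π e fun i => bit (p i)) (hq : Comp π e fun i => bit (q i)) :
    Comp π e fun i => bit (p i ∧ q i) := by
  classical
  exact (hp.ite hq nil).congr fun i => by by_cases h : p i <;> simp [h, bit]

theorem not {p : ι → Prop} (hp : Comp π e fun i => bit (p i)) : Comp π e fun i => bit (¬ p i) := by
  classical
  exact (hp.ite nil true).congr fun i => by by_cases h : p i <;> simp [h, bit]

theorem or {p q : ι → Prop} (hp : Comp π e fun i => bit (p i)) (hq : Comp π e fun i => bit (q i)) :
    Comp π e fun i => bit (p i ∨ q i) := by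
  classical
  exact (hp.ite true hq).congr fun i => by by_cases h : p i <;> simp [h, bit]

theorem imp {p q : ι → Prop} (hp : Comp π e fun i => bit (p i)) (hq : Comp π e fun i => bit (q i)) :
    Comp π e fun i => bit (p i → q i) := by
  classical
  exact (hp.ite hq true).congr fun i => by by_cases h : p i <;> simp [h, bit]

theorem iff {p q : ι → Prop} (hp : Comp π e fun i => bit (p i)) (hq : Comp π e fun i => bit (q i)) :
    Comp π e fun i => bit (p i ↔ q i) :=
  ((hp.imp hq).and (hq.imp hp)).congr fun i => by rw [iff_iff_implies_and_implies]

theorem iff_congr {p q : ι → Prop} (hp : Comp π e fun i => bit (p i)) (h : ∀ i, p i ↔ q i) :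
    Comp π e fun i => bit (q i) :=
  hp.congr fun i => by rw [h i]

/-- A value is a truth value if it has to be tested only for being `nil`. -/
theorem of_ne_nil {p : ι → Prop} (hg : Comp π e g) (h : ∀ i, g i ≠ .nil ↔ p i) :
    Comp π e fun i => bit (p i) := by
  classical
  exact (hg.ite_data h true nil).congr fun i => by by_cases h : p i <;> simp [h, bit]

theorem nat (c : ℕ) : Comp π e fun _ => .ofNat c := by
  induction c with
  | zero => exact nil
  | succ c ih => exact nil.pair ih

theorem succ {a : ι → ℕ} (ha : Comp π e fun i => .ofNat (a i)) :
    Comp π e fun i => .ofNat (a i + 1) :=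
  nil.pair ha

/-- Iteration, the number of the current step being available. -/
theorem iterate {N : ι → ℕ} {s : ∀ i, ℕ → Data (π i).W} (hN : Comp π e fun i => .ofNat (N i))
    (hb : PolyBdd π N) (h0 : Comp π e fun i => s i 0)
    (hs : Comp (fun j : Step N => π j.i)
      (fun j => .cons (.ofNat j.k) (.cons (s j.i j.k) (e j.i))) fun j => s j.i (j.k + 1)) :
    Comp π e fun i => s i (N i) := by
  have hlen : ∀ i, (List.replicate (N i) (Data.nil : Data (π i).W)).length = N i :=
    fun i => List.length_replicate
  have := loop (s := fun i k => .cons (.ofNat k) (s i k)) (L := fun i => List.replicate (N i) .nil)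
    hN (hb.mono fun i => (hlen i).le) (nil.pair h0) ?_
  · exact this.snd.congr fun i => by simp only [Data.snd, hlen]
  · refine Comp.pair var₁.fst.succ ?_
    exact Comp.seq (var₁.fst.pair (var₁.snd.pair Comp.ident.snd.snd))
      (hs.reindex fun j : Step (fun i => (List.replicate (N i) (Data.nil : Data (π i).W)).length) =>
        (⟨j.i, j.k.cast (hlen j.i)⟩ : Step N))

theorem sub {a b : ι → ℕ} (ha : Comp π e fun i => .ofNat (a i))
    (hb : Comp π e fun i => .ofNat (b i)) (hbb : PolyBdd π b) :
    Comp π e fun i => .ofNat (a i - b i) := by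
  refine iterate (s := fun i k => .ofNat (a i - k)) hb hbb ha (var₁.snd.congr fun j => ?_)
  rw [← Nat.sub_sub]
  cases a j.i - j.k <;> rfl

theorem ofNat_ne_nil {W : Type u} {k : ℕ} : (Data.ofNat k : Data W) ≠ .nil ↔ 0 < k := by
  cases k <;> simp [Data.ofNat, Data.ofList, List.replicate_succ]

theorem lt {a b : ι → ℕ} (ha : Comp π e fun i => .ofNat (a i))
    (hb : Comp π e fun i => .ofNat (b i)) (hab : PolyBdd π a) :
    Comp π e fun i => bit (a i < b i) :=
  (hb.sub ha hab).of_ne_nil fun i => by rw [ofNat_ne_nil]; omega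

theorem natEq {a b : ι → ℕ} (ha : Comp π e fun i => .ofNat (a i))
    (hb : Comp π e fun i => .ofNat (b i)) (hab : PolyBdd π a) (hbb : PolyBdd π b) :
    Comp π e fun i => bit (a i = b i) :=
  ((ha.lt hb hab).not.and (hb.lt ha hbb).not).iff_congr fun i => by omega

theorem min_const (d : ℕ) {a : ι → ℕ} (ha : Comp π e fun i => .ofNat (a i)) :
    Comp π e fun i => .ofNat (min d (a i)) := by
  classical
  refine Comp.congr (((Comp.nat d).lt ha (.const d)).ite (Comp.nat d) ha) fun i => ?_
  split_ifs
  · rw [min_eq_left (by omega)]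
  · rw [min_eq_right (by omega)]

/-! ### Lists -/

theorem reverse {L : ∀ i, List (Data (π i).W)} (hL : Comp π e fun i => .ofList (L i))
    (hb : PolyBdd π fun i => (L i).length) : Comp π e fun i => .ofList (L i).reverse := by
  refine (loop (s := fun i k => .ofList ((L i).take k).reverse) hL hb nil ?_).congr fun i => by
    rw [List.take_length]
  refine (Comp.pair var₀ var₁).congr fun j => ?_
  rw [List.take_add_one, List.getElem?_eq_getElem j.k.2, List.reverse_append]
  rfl

variable {α : ι → Type w} {σ : ι → Type w'} {β : ι → Type w'}
  {encA : ∀ i, α i → Data (π i).W} {encS : ∀ i, σ i → Data (π i).W}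
  {encB : ∀ i, β i → Data (π i).W} {l : ∀ i, List (α i)}

theorem foldr {s₀ : ∀ i, σ i} {f : ∀ i, α i → σ i → σ i} (Inv : ∀ i, α i → σ i → Prop)
    (hl : Comp π e fun i => encodeList (encA i) (l i)) (hb : PolyBdd π fun i => (l i).length)
    (h0 : Comp π e fun i => encS i (s₀ i))
    (hinv : ∀ i (pre : List (α i)) (x : α i) (post : List (α i)), l i = pre ++ x :: post →
      Inv i x (post.foldr (f i) (s₀ i)))
    (hf : Comp (fun j : FoldStep Inv => π j.i)
      (fun j => .cons (encA j.i j.x) (.cons (encS j.i j.s) (e j.i)))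
      fun j => encS j.i (f j.i j.x j.s)) :
    Comp π e fun i => encS i ((l i).foldr (f i) (s₀ i)) := by
  have hlen : ∀ i, ((l i).map (encA i)).reverse.length = (l i).length := fun i => by simp
  have hr := reverse hl (by simpa using hb)
  have hdrop : ∀ i, ∀ k : ℕ, ∀ hk : k < (l i).length, (l i).drop ((l i).length - (k + 1)) =
      (l i)[(l i).length - 1 - k] :: (l i).drop ((l i).length - k) := fun i k hk => by
    rw [List.drop_eq_getElem_cons (by omega)]
    congr 2 <;> omega
  refine (loop (s := fun i k => encS i (((l i).drop ((l i).length - k)).foldr (f i) (s₀ i))) hr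
    (by simpa using hb) (h0.congr fun i => by simp) ?_).congr fun i => by simp
  have hk : ∀ j : Step fun i => ((l i).map (encA i)).reverse.length, j.k < (l j.i).length :=
    fun j => by have := j.k.2; simpa using this
  have hr : ∀ j : Step fun i => ((l i).map (encA i)).reverse.length,
      Inv j.i ((l j.i)[(l j.i).length - 1 - j.k]'(by have := hk j; omega))
        (((l j.i).drop ((l j.i).length - j.k)).foldr (f j.i) (s₀ j.i)) := fun j => by
    refine hinv j.i ((l j.i).take ((l j.i).length - (j.k + 1))) _ _ ?_
    rw [← hdrop j.i j.k (hk j), List.take_append_drop]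
  refine Comp.seq (Comp.congr Comp.ident fun j => ?_)
    ((hf.reindex fun j => (⟨j.i, _, _, hr j⟩ : FoldStep Inv)).congr fun j => ?_)
  · simp
  · simp only [hdrop j.i j.k (hk j), List.foldr_cons]

/-- Computations for the elements of a list are steps of a loop which ignore the state. -/
theorem elem_step (encS : ∀ i, σ i → Data (π i).W) {Inv : ∀ i, α i → σ i → Prop}
    {g : ∀ i, α i → Data (π i).W}
    (hg : Comp (fun j : Elem l => π j.i) (fun j => .cons (encA j.i j.x) (e j.i))
      fun j => g j.i j.x) (hInv : ∀ i x s, Inv i x s → x ∈ l i) :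
    Comp (fun j : FoldStep Inv => π j.i)
      (fun j => .cons (encA j.i j.x) (.cons (encS j.i j.s) (e j.i))) fun j => g j.i j.x :=
  Comp.seq (var₀.pair Comp.ident.snd.snd)
    (hg.reindex fun j : FoldStep Inv => (⟨j.i, j.x, hInv _ _ _ j.inv⟩ : Elem l))

theorem exists_mem {p : ∀ i, α i → Prop} (hl : Comp π e fun i => encodeList (encA i) (l i))
    (hb : PolyBdd π fun i => (l i).length)
    (hp : Comp (fun j : Elem l => π j.i) (fun j => .cons (encA j.i j.x) (e j.i))
      fun j => bit (p j.i j.x)) : Comp π e fun i => bit (∃ x ∈ l i, p i x) := by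
  refine (foldr (σ := fun _ => Prop) (encS := fun i s => bit s)
    (s₀ := fun _ => False) (f := fun i x s => p i x ∨ s) (fun i x _ => x ∈ l i) hl hb
    (nil.congr fun _ => (bit_neg not_false).symm) (fun i pre x post h => by simp [h])
    ((elem_step (fun i s => bit s) (g := fun i x => bit (p i x)) hp fun _ _ _ h => h).or
      var₁)).congr fun i => ?_
  congr 1
  induction l i with
  | nil => simp
  | cons x l ih => simp [ih]

theorem forall_mem {p : ∀ i, α i → Prop} (hl : Comp π e fun i => encodeList (encA i) (l i))
    (hb : PolyBdd π fun i => (l i).length)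
    (hp : Comp (fun j : Elem l => π j.i) (fun j => .cons (encA j.i j.x) (e j.i))
      fun j => bit (p j.i j.x)) : Comp π e fun i => bit (∀ x ∈ l i, p i x) :=
  (exists_mem (p := fun i x => ¬ p i x) hl hb hp.not).not.iff_congr fun i => by push Not; rfl

theorem map {f : ∀ i, α i → β i} (hl : Comp π e fun i => encodeList (encA i) (l i))
    (hb : PolyBdd π fun i => (l i).length)
    (hf : Comp (fun j : Elem l => π j.i) (fun j => .cons (encA j.i j.x) (e j.i))
      fun j => encB j.i (f j.i j.x)) :
    Comp π e fun i => encodeList (encB i) ((l i).map (f i)) := by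
  refine (foldr (σ := fun i => List (β i)) (encS := fun i s => encodeList (encB i) s)
    (s₀ := fun _ => []) (f := fun i x s => f i x :: s) (fun i x _ => x ∈ l i) hl hb nil
    (fun i pre x post h => by simp [h])
    (Comp.pair (elem_step (fun i s => encodeList (encB i) s) (g := fun i x => encB i (f i x)) hf
      fun _ _ _ h => h) var₁)).congr fun i => ?_
  rw [List.map_eq_foldr]

theorem filter {p : ∀ i, α i → Prop} [∀ i x, Decidable (p i x)]
    (hl : Comp π e fun i => encodeList (encA i) (l i)) (hb : PolyBdd π fun i => (l i).length)
    (hp : Comp (fun j : Elem l => π j.i) (fun j => .cons (encA j.i j.x) (e j.i))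
      fun j => bit (p j.i j.x)) :
    Comp π e fun i => encodeList (encA i) ((l i).filter fun x => p i x) := by
  refine (foldr (σ := fun i => List (α i)) (encS := fun i s => encodeList (encA i) s)
    (s₀ := fun _ => []) (f := fun i x s => if p i x then x :: s else s) (fun i x _ => x ∈ l i) hl hb
    nil (fun i pre x post h => by simp [h])
    (((elem_step (fun i s => encodeList (encA i) s) (g := fun i x => bit (p i x)) hp
      fun _ _ _ h => h).ite (var₀.pair var₁) var₁).congr
      fun j => ?_)).congr fun i => ?_
  · split_ifs <;> rfl
  · congr 1
    induction l i with
    | nil => rfl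
    | cons x l ih => by_cases h : p i x <;> simp [ih, h]

theorem append {l' : ∀ i, List (α i)} (hl : Comp π e fun i => encodeList (encA i) (l i))
    (hb : PolyBdd π fun i => (l i).length) (hl' : Comp π e fun i => encodeList (encA i) (l' i)) :
    Comp π e fun i => encodeList (encA i) (l i ++ l' i) := by
  refine (foldr (σ := fun i => List (α i)) (encS := fun i s => encodeList (encA i) s)
    (s₀ := l') (f := fun i x s => x :: s) (fun i x _ => x ∈ l i) hl hb hl'
    (fun i pre x post h => by simp [h]) (var₀.pair var₁)).congr fun i => ?_
  congr 1
  induction l i with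
  | nil => rfl
  | cons x l ih => simp [ih]

theorem flatMap {f : ∀ i, α i → List (β i)} (hl : Comp π e fun i => encodeList (encA i) (l i))
    (hb : PolyBdd π fun i => (l i).length) (hb' : PolyBdd π fun i => ((l i).flatMap (f i)).length)
    (hf : Comp (fun j : Elem l => π j.i) (fun j => .cons (encA j.i j.x) (e j.i))
      fun j => encodeList (encB j.i) (f j.i j.x)) :
    Comp π e fun i => encodeList (encB i) ((l i).flatMap (f i)) := by
  refine (foldr (σ := fun i => List (β i)) (encS := fun i s => encodeList (encB i) s)
    (s₀ := fun _ => []) (f := fun i x s => f i x ++ s) (fun i x _ => x ∈ l i) hl hb nil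
    (fun i pre x post h => by simp [h])
    ((elem_step (fun i s => encodeList (encB i) s) (g := fun i x => encodeList (encB i) (f i x)) hf
      fun _ _ _ h => h).append ?_ var₁)).congr fun i => ?_
  · refine (hb'.reindex fun j : FoldStep fun i (x : α i) (_ : List (β i)) => x ∈ l i => j.i).mono
      fun j => ?_
    rw [List.length_flatMap]
    exact List.le_sum_of_mem (List.mem_map_of_mem j.inv)
  · congr 1
    induction l i with
    | nil => rfl
    | cons x l ih => simp [ih]

/-! ### Finite sequences -/

variable {N : ι → ℕ}

theorem finRange (hN : Comp π e fun i => .ofNat (N i)) (hb : PolyBdd π N) :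
    Comp π e fun i => encodeList (fun k : Fin (N i) => .ofNat k) (List.finRange (N i)) := by
  have h : Comp π e fun i => .ofList ((List.range (N i)).map .ofNat).reverse := by
    refine iterate (s := fun i k => .ofList ((List.range k).map .ofNat).reverse) hN hb nil ?_
    refine (var₀.pair var₁).congr fun j => ?_
    rw [List.range_succ, List.map_append, List.reverse_append]
    rfl
  refine (reverse h (by simpa using hb)).congr fun i => ?_
  rw [List.reverse_reverse, encodeList, ← List.map_coe_finRange_eq_range, List.map_map]
  rfl

/-- Computations for all numbers below `N` are computations for the elements of a list. -/
theorem step_elem {g : ∀ i, Fin (N i) → Data (π i).W}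
    (hg : Comp (fun j : Step N => π j.i) (fun j => .cons (.ofNat j.k) (e j.i)) fun j => g j.i j.k) :
    Comp (fun j : Elem fun i => List.finRange (N i) => π j.i)
      (fun j => .cons (.ofNat j.x) (e j.i)) fun j => g j.i j.x :=
  hg.reindex fun j : Elem fun i => List.finRange (N i) => (⟨j.i, j.x⟩ : Step N)

theorem step_fold (encS : ∀ i, σ i → Data (π i).W) {Inv : ∀ i, Fin (N i) → σ i → Prop}
    {g : ∀ i, Fin (N i) → Data (π i).W}
    (hg : Comp (fun j : Step N => π j.i) (fun j => .cons (.ofNat j.k) (e j.i)) fun j => g j.i j.k) :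
    Comp (fun j : FoldStep Inv => π j.i)
      (fun j => .cons (.ofNat j.x) (.cons (encS j.i j.s) (e j.i))) fun j => g j.i j.x :=
  Comp.seq (var₀.pair Comp.ident.snd.snd)
    (hg.reindex fun j : FoldStep Inv => (⟨j.i, j.x⟩ : Step N))

theorem length_finRange_polyBdd (hb : PolyBdd π N) :
    PolyBdd π fun i => (List.finRange (N i)).length := by simpa using hb

theorem ofFn {f : ∀ i, Fin (N i) → Data (π i).W} (hN : Comp π e fun i => .ofNat (N i))
    (hb : PolyBdd π N)
    (hf : Comp (fun j : Step N => π j.i) (fun j => .cons (.ofNat j.k) (e j.i)) fun j => f j.i j.k) :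
    Comp π e fun i => .ofFn (f i) := by
  refine (foldr (α := fun i => Fin (N i)) (encA := fun i k => .ofNat k)
    (σ := fun i => List (Data (π i).W))
    (encS := fun i s => .ofList s)
    (s₀ := fun _ => []) (f := fun i x s => f i x :: s) (fun i _ _ => True)
    (finRange hN hb) (length_finRange_polyBdd hb) nil
    (fun i pre x post h => trivial)
    (Comp.pair (step_fold (fun i s => .ofList s) hf) var₁)).congr fun i => ?_
  rw [← List.map_eq_foldr, Data.ofFn, List.ofFn_eq_map]

theorem exists_fin {p : ∀ i, Fin (N i) → Prop} (hN : Comp π e fun i => .ofNat (N i))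
    (hb : PolyBdd π N)
    (hp : Comp (fun j : Step N => π j.i) (fun j => .cons (.ofNat j.k) (e j.i))
      fun j => bit (p j.i j.k)) : Comp π e fun i => bit (∃ k, p i k) :=
  (exists_mem (p := p) (finRange hN hb) (length_finRange_polyBdd hb)
    (step_elem (g := fun i k => bit (p i k)) hp)).iff_congr fun i => by
    simp

theorem forall_fin {p : ∀ i, Fin (N i) → Prop} (hN : Comp π e fun i => .ofNat (N i))
    (hb : PolyBdd π N)
    (hp : Comp (fun j : Step N => π j.i) (fun j => .cons (.ofNat j.k) (e j.i))
      fun j => bit (p j.i j.k)) : Comp π e fun i => bit (∀ k, p i k) :=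
  (exists_fin (p := fun i k => ¬ p i k) hN hb hp.not).not.iff_congr fun i => by push Not; rfl

theorem card_fin {p : ∀ i, Fin (N i) → Prop} [∀ i, DecidablePred (p i)]
    (hN : Comp π e fun i => .ofNat (N i)) (hb : PolyBdd π N)
    (hp : Comp (fun j : Step N => π j.i) (fun j => .cons (.ofNat j.k) (e j.i))
      fun j => bit (p j.i j.k)) :
    Comp π e fun i => .ofNat (Finset.univ.filter fun k => p i k).card := by
  refine (foldr (α := fun i => Fin (N i)) (encA := fun i k => .ofNat k) (σ := fun i => ℕ)
    (encS := fun i s => .ofNat s)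
    (s₀ := fun _ => 0) (f := fun i x s => if p i x then s + 1 else s) (fun i _ _ => True)
    (finRange hN hb) (length_finRange_polyBdd hb) nil (fun i pre x post h => trivial)
    (((step_fold (fun i s => .ofNat s) (g := fun i k => bit (p i k)) hp).ite
      var₁.succ var₁).congr fun j => ?_)).congr fun i => ?_
  · split_ifs <;> rfl
  · congr 1
    trans ((List.finRange (N i)).filter fun k => p i k).length
    · induction List.finRange (N i) with
      | nil => rfl
      | cons x l ih => by_cases h : p i x <;> simp [ih, h]
    · rw [← List.toFinset_card_of_nodup ((List.nodup_finRange _).filter _)]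
      congr 1
      ext k
      simp

theorem sum_fin {f : ∀ i, Fin (N i) → (π i).W} (hN : Comp π e fun i => .ofNat (N i))
    (hb : PolyBdd π N)
    (hf : Comp (fun j : Step N => π j.i) (fun j => .cons (.ofNat j.k) (e j.i))
      fun j => .wt (f j.i j.k)) : Comp π e fun i => .wt (∑ k, f i k) := by
  refine (foldr (α := fun i => Fin (N i)) (encA := fun i k => .ofNat k)
    (σ := fun i => (π i).W) (encS := fun i s => .wt s)
    (s₀ := fun _ => 0) (f := fun i x s => f i x + s) (fun i _ _ => True)
    (finRange hN hb) (length_finRange_polyBdd hb) zero (fun i pre x post h => trivial)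
    ((step_fold (fun i s => .wt s) (g := fun i k => .wt (f i k)) hf).wt_add
      var₁)).congr fun i => ?_
  congr 1
  trans ((List.finRange (N i)).map (f i)).sum
  · induction List.finRange (N i) with
    | nil => rfl
    | cons x l ih => simp [ih]
  · rw [← List.ofFn_eq_map, List.sum_ofFn]

/-- An entry of a sequence. -/
theorem lookup {f : ∀ i, Fin (N i) → Data (π i).W} {k : ∀ i, Fin (N i)}
    (hf : Comp π e fun i => .ofFn (f i)) (hk : Comp π e fun i => .ofNat (k i))
    (hb : PolyBdd π N) : Comp π e fun i => f i (k i) := by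
  have h := iterate (s := fun i k => .ofList ((List.ofFn (f i)).drop k)) hk
    (hb.mono fun i => (k i).2.le) hf (var₁.snd.congr fun j => ?_)
  · refine h.fst.congr fun i => ?_
    rw [List.drop_eq_getElem_cons (by simp)]
    simp [Data.ofList, Data.fst]
  · rw [← List.tail_drop]
    cases (List.ofFn (f j.i)).drop j.k <;> rfl

/-- An entry of a table of the values of a function on `{0, …, d}^q`. -/
theorem lookup_table (d : ℕ) : ∀ (q : ℕ) {f : ∀ i, (Fin q → ℕ) → Data (π i).W} {k : ι → Fin q → ℕ}
    (_ : Comp π e fun i => .table d q (f i)) (_ : ∀ j, Comp π e fun i => .ofNat (k i j))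
    (_ : ∀ i j, k i j ≤ d), Comp π e fun i => f i (k i)
  | 0, f, k, hf, _, _ => hf.congr fun i => congrArg (f i) (funext fun j => j.elim0)
  | q + 1, f, k, hf, hk, hd => by
    have h := lookup (k := fun i => (⟨k i 0, Nat.lt_succ_of_le (hd i 0)⟩ : Fin (d + 1))) hf (hk 0)
      (.const _)
    exact (lookup_table d q h (fun j => hk j.succ) fun i j => hd i j.succ).congr fun i =>
      congrArg (f i) (Fin.cons_self_tail (k i))

end Comp

section Graph

variable {V : Type v} {G : SimpleGraph V}

/-! ### Connectivity across a cut -/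

/-- The graph whose edges are the edges of `G` with both ends in `S`. -/
def within (G : SimpleGraph V) (S : Set V) : SimpleGraph V where
  Adj a b := G.Adj a b ∧ a ∈ S ∧ b ∈ S
  symm := ⟨fun _ _ h => ⟨h.1.symm, h.2.2, h.2.1⟩⟩
  loopless := ⟨fun _ h => G.irrefl h.1⟩

theorem within_mono {S T : Set V} (h : S ⊆ T) : within G S ≤ within G T :=
  fun _ _ hab => ⟨hab.1, h hab.2.1, h hab.2.2⟩

/-- The vertices of `S` lie in one component of the subgraph which `S` induces. -/
def ConnectedOn (G : SimpleGraph V) (S : Set V) : Prop :=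
  ∀ a ∈ S, ∀ b ∈ S, (within G S).Reachable a b

theorem preconnected_induce_iff {S : Set V} : (G.induce S).Preconnected ↔ ConnectedOn G S := by
  constructor
  · intro h a ha b hb
    exact (h ⟨a, ha⟩ ⟨b, hb⟩).map
      (⟨Subtype.val, fun {x y} hxy => ⟨hxy, x.2, y.2⟩⟩ : G.induce S →g within G S)
  · rintro h ⟨a, ha⟩ ⟨b, hb⟩
    obtain ⟨p⟩ := h a ha b hb
    induction p with
    | nil => rfl
    | @cons a c b hac p ih =>
      exact (SimpleGraph.Adj.reachable
        (show (G.induce S).Adj ⟨a, ha⟩ ⟨c, hac.2.2⟩ from hac.1)).trans (ih hac.2.2 hb)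

/-- Each vertex of `S` is joined to a vertex of `R` inside `S ∪ R`. -/
def Anchored (G : SimpleGraph V) (S R : Set V) : Prop :=
  ∀ s ∈ S, ∃ r ∈ R, (within G (S ∪ R)).Reachable r s

/-- The vertex `u` has a neighbour in `S` which is joined to `r` inside `S ∪ R`. -/
def Attached (G : SimpleGraph V) (S R : Set V) (r u : V) : Prop :=
  ∃ s ∈ S, (within G (S ∪ R)).Reachable r s ∧ G.Adj u s

/-- If all vertices of `S` which have a neighbour in `S'` have one in `R ⊆ S'`, then a path that
leaves `S` can be rerouted so as to leave it for `R`. -/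
theorem exists_reachable_of_walk {S S' R : Set V}
    (hR : ∀ u ∈ S, ∀ v ∈ S', G.Adj u v → ∃ r ∈ R, G.Adj u r) {a b : V}
    (p : (within G (S ∪ S')).Walk a b) (ha : a ∈ S) (hb : b ∈ S') (hdisj : Disjoint S S') :
    ∃ r ∈ R, (within G (S ∪ R)).Reachable r a := by
  induction p with
  | nil => exact absurd hb (Set.disjoint_left.1 hdisj ha)
  | @cons a c b hac p ih =>
    rcases hac.2.2 with hc | hc
    · obtain ⟨r, hr, hrc⟩ := ih hc hb
      exact ⟨r, hr, hrc.trans (SimpleGraph.Adj.reachable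
        ⟨hac.1.symm, Or.inl hc, Or.inl ha⟩)⟩
    · obtain ⟨r, hr, har⟩ := hR a ha c hc hac.1
      exact ⟨r, hr, SimpleGraph.Adj.reachable ⟨har.symm, Or.inr hr, Or.inl ha⟩⟩

/-- Connectivity of `S₁ ∪ S'` carries over to `S₂ ∪ S'` if `S₁` and `S₂`, on one side of a cut,
look the same from a subset `R` of `S'` which dominates as much of the other side as `S'` does. The
components of the graph induced by `S₁ ∪ R` are the only information about `S₁` that matters,
because each of them contains an element of `R`. -/
theorem ConnectedOn.exchange {A S₁ S₂ S' R : Set V} (h₁ : S₁ ⊆ A) (hS' : S' ⊆ Aᶜ)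
    (hRS : R ⊆ S') (hR : ∀ u ∈ A, ∀ v ∈ S', G.Adj u v → ∃ r ∈ R, G.Adj u r)
    (hempty : S₁ = ∅ → S₂ = ∅) (hconn : ConnectedOn G S₁ → ConnectedOn G S₂)
    (hanch : Anchored G S₁ R → Anchored G S₂ R)
    (hatt : ∀ r ∈ R, ∀ u ∉ A, Attached G S₁ R r u → Attached G S₂ R r u)
    (h : ConnectedOn G (S₁ ∪ S')) : ConnectedOn G (S₂ ∪ S') := by
  have hdisj : Disjoint S₁ S' := Set.disjoint_left.2 fun x hx hx' => hS' hx' (h₁ hx)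
  rcases S'.eq_empty_or_nonempty with rfl | ⟨z, hz⟩
  · rw [Set.union_empty] at *
    exact hconn h
  rcases S₁.eq_empty_or_nonempty with h0 | -
  · rw [hempty h0]
    rwa [h0] at h
  have hanch₁ : Anchored G S₁ R := fun s hs => by
    obtain ⟨p⟩ := h s (Or.inl hs) z (Or.inr hz)
    exact exists_reachable_of_walk (fun u hu => hR u (h₁ hu)) p hs hz hdisj
  have hanch₂ := hanch hanch₁
  have hle : within G (S₂ ∪ R) ≤ within G (S₂ ∪ S') :=
    within_mono (Set.union_subset_union_right _ hRS)
  have hatt' : ∀ r ∈ R, ∀ u ∈ S', Attached G S₁ R r u →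
      (within G (S₂ ∪ S')).Reachable u r := fun r hr u hu hru => by
    obtain ⟨s, hs, hrs, hus⟩ := hatt r hr u (hS' hu) hru
    exact (SimpleGraph.Adj.reachable
      (show (within G (S₂ ∪ S')).Adj u s from ⟨hus, Or.inr hu, Or.inl hs⟩)).trans
      (hrs.symm.mono hle)
  have key : ∀ {a b : V} (_ : (within G (S₁ ∪ S')).Walk a b), b ∈ S' →
      (a ∈ S' → (within G (S₂ ∪ S')).Reachable a b) ∧
      (a ∈ S₁ → ∀ r ∈ R, (within G (S₁ ∪ R)).Reachable r a →
        (within G (S₂ ∪ S')).Reachable r b) := by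
    intro a b p hb
    induction p with
    | nil => exact ⟨fun _ => .rfl, fun ha => absurd hb (Set.disjoint_left.1 hdisj ha)⟩
    | @cons a c b hac p ih =>
      obtain ⟨ih₁, ih₂⟩ := ih hb
      refine ⟨fun ha => ?_, fun ha r hr hra => ?_⟩
      · rcases hac.2.2 with hc | hc
        · obtain ⟨r, hr, hrc⟩ := hanch₁ c hc
          exact (hatt' r hr a ha ⟨c, hc, hrc, hac.1⟩).trans (ih₂ hc r hr hrc)
        · exact (SimpleGraph.Adj.reachable
            (show (within G (S₂ ∪ S')).Adj a c from ⟨hac.1, Or.inr ha, Or.inr hc⟩)).trans (ih₁ hc)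
      · rcases hac.2.2 with hc | hc
        · exact ih₂ hc r hr (hra.trans (SimpleGraph.Adj.reachable
            ⟨hac.1, Or.inl ha, Or.inl hc⟩))
        · exact (hatt' r hr c hc ⟨a, ha, hra, hac.1.symm⟩).symm.trans (ih₁ hc)
  have hS : ∀ a ∈ S', ∀ b ∈ S', (within G (S₂ ∪ S')).Reachable a b := fun a ha b hb => by
    obtain ⟨p⟩ := h a (Or.inr ha) b (Or.inr hb)
    exact (key p hb).1 ha
  have hex : ∀ a ∈ S₂ ∪ S', ∃ b ∈ S', (within G (S₂ ∪ S')).Reachable a b := by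
    rintro a (ha | ha)
    · obtain ⟨r, hr, hra⟩ := hanch₂ a ha
      exact ⟨r, hRS hr, hra.symm.mono hle⟩
    · exact ⟨a, ha, .rfl⟩
  intro a ha b hb
  obtain ⟨a', ha', haa'⟩ := hex a ha
  obtain ⟨b', hb', hbb'⟩ := hex b hb
  exact haa'.trans ((hS a' ha' b' hb').trans hbb'.symm)

/-! ### Irredundant sets and mim-width -/

/-- The size of an induced matching across a cut, given by the partners `f v` of its vertices `v`
on one side, is at most the value of `mim`. -/
theorem card_le_mim [Fintype V] {A : Set V} {M : Finset V} {f : V → V}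
    (hM : (∀ v ∈ M, v ∈ A ∧ f v ∈ Aᶜ) ∨ ∀ v ∈ M, v ∈ Aᶜ ∧ f v ∈ A)
    (h : ∀ v ∈ M, ∀ v' ∈ M, G.Adj (f v) v' ↔ v' = v) : M.card ≤ mim G A := by
  classical
  let H := G.between A Aᶜ
  have hside : ∀ v ∈ M, ∀ v' ∈ M, ¬ H.Adj v v' ∧ ¬ H.Adj (f v) (f v') ∧ f v ≠ v' := by
    intro v hv v' hv'
    rcases hM with hM | hM <;> obtain ⟨h1, h2⟩ := hM v hv <;> obtain ⟨h3, h4⟩ := hM v' hv' <;>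
      refine ⟨fun hh => ?_, fun hh => ?_, fun hh => ?_⟩ <;>
      simp_all [H, SimpleGraph.between_adj]
  have hadj : ∀ v ∈ M, H.Adj v (f v) := by
    intro v hv
    have hv' := ((h v hv v hv).2 rfl).symm
    rcases hM with hM | hM <;> obtain ⟨h1, h2⟩ := hM v hv
    · exact ⟨hv', Or.inl ⟨h1, h2⟩⟩
    · exact ⟨hv', Or.inr ⟨h1, h2⟩⟩
  let P : H.Subgraph :=
    { verts := {x | x ∈ M ∨ ∃ v ∈ M, f v = x}
      Adj := fun a b => (a ∈ M ∧ f a = b) ∨ (b ∈ M ∧ f b = a)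
      adj_sub := by
        rintro a b (⟨ha, rfl⟩ | ⟨hb, rfl⟩)
        · exact hadj a ha
        · exact (hadj b hb).symm
      edge_vert := by
        rintro a b (⟨ha, rfl⟩ | ⟨hb, rfl⟩)
        · exact Or.inl ha
        · exact Or.inr ⟨b, hb, rfl⟩
      symm := ⟨fun a b hab => Or.symm hab⟩ }
  have hinj : ∀ v ∈ M, ∀ v' ∈ M, f v = f v' → v = v' := fun v hv v' hv' hff =>
    (h v' hv' v hv).1 (hff ▸ (h v hv v hv).2 rfl)
  refine le_csSup ⟨Nat.card (Sym2 V), ?_⟩ ⟨P, ?_, ?_, ?_⟩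
  · rintro k ⟨M, -, -, rfl⟩
    exact Set.ncard_le_card _
  · rintro a (ha | ⟨a, ha, rfl⟩) b (hb | ⟨b, hb, rfl⟩) hab
    · exact absurd hab (hside a ha b hb).1
    · exact Or.inl ⟨ha, by rw [(h b hb a ha).1 hab.1.symm]⟩
    · exact Or.inr ⟨hb, by rw [(h a ha b hb).1 hab.1]⟩
    · exact absurd hab (hside a ha b hb).2.1
  · rintro a (ha | ⟨a, ha, rfl⟩)
    · refine ⟨f a, Or.inl ⟨ha, rfl⟩, ?_⟩
      rintro b (⟨-, rfl⟩ | ⟨hb, rfl⟩)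
      · rfl
      · exact absurd rfl (hside b hb _ ha).2.2
    · refine ⟨a, Or.inr ⟨ha, rfl⟩, ?_⟩
      rintro b (⟨hb, -⟩ | ⟨hb, hb'⟩)
      · exact absurd rfl (hside a ha _ hb).2.2
      · exact hinj b hb a ha hb'
  · rw [← Set.ncard_coe_finset M]
    symm
    refine Set.ncard_congr (fun v _ => s(v, f v)) (fun v hv => Or.inl ⟨hv, rfl⟩) ?_ ?_
    · intro v v' hv hv' hvv
      rcases Sym2.eq_iff.1 hvv with h1 | h1
      · exact h1.1
      · exact absurd h1.2 (hside v hv v' hv').2.2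
    · intro b
      induction b with | _ a b => ?_
      rintro (⟨ha, hab⟩ | ⟨hb, hba⟩)
      · exact ⟨a, ha, congrArg (fun x => s(a, x)) hab⟩
      · exact ⟨b, hb, (congrArg (fun x => s(b, x)) hba).trans Sym2.eq_swap⟩

variable [DecidableRel G.Adj]

/-- A set `R` is `d`-irredundant for `B` if the removal of any of its elements changes the number
of neighbours in `R` of some vertex of `B`, where numbers above `d` are not distinguished. -/
def Irredundant (G : SimpleGraph V) [DecidableRel G.Adj] (d : ℕ) (B : Set V) (R : Finset V) :
    Prop :=
  ∀ v ∈ R, ∃ u ∈ B, G.Adj u v ∧ (R.filter (G.Adj u)).card ≤ d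

theorem exists_irredundant (d : ℕ) (B : Set V) (S : Finset V) :
    ∃ R ⊆ S, (∀ u ∈ B, min d (R.filter (G.Adj u)).card = min d (S.filter (G.Adj u)).card) ∧
      Irredundant G d B R := by
  classical
  induction S using Finset.strongInduction with
  | H S ih =>
    by_cases hS : Irredundant G d B S
    · exact ⟨S, subset_rfl, fun _ _ => rfl, hS⟩
    · simp only [Irredundant] at hS
      push Not at hS
      obtain ⟨v, hv, hvB⟩ := hS
      obtain ⟨R, hR, hRS, hirr⟩ := ih (S.erase v) (Finset.erase_ssubset hv)
      refine ⟨R, hR.trans (Finset.erase_subset _ _), fun u hu => (hRS u hu).trans ?_, hirr⟩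
      by_cases huv : G.Adj u v
      · have h1 := hvB u hu huv
        rw [Finset.filter_erase, Finset.card_erase_of_mem (by simp [hv, huv])]
        omega
      · rw [Finset.filter_erase, Finset.erase_eq_of_notMem (by simp [huv])]

/-- The set is a union of `d` sets that are 1-irredundant, each of which has a private neighbour
for each of its elements. -/
theorem Irredundant.card_le {B : Set V} {m : ℕ} : ∀ {d : ℕ} {R : Finset V},
    Irredundant G d B R →
    (∀ M ⊆ R, ∀ f : V → V, (∀ v ∈ M, f v ∈ B) →
      (∀ v ∈ M, ∀ v' ∈ M, G.Adj (f v) v' ↔ v' = v) → M.card ≤ m) → R.card ≤ d * m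
  | 0, R, hR, _ => by
    suffices R = ∅ by simp [this]
    refine Finset.eq_empty_of_forall_notMem fun v hv => ?_
    obtain ⟨u, -, huv, hu⟩ := hR v hv
    exact absurd (Finset.card_pos.2 ⟨v, Finset.mem_filter.2 ⟨hv, huv⟩⟩) (by omega)
  | d + 1, R, hR, hm => by
    classical
    obtain ⟨Q, hQR, hQ, hirr⟩ := exists_irredundant (G := G) 1 B R
    have h1 : Q.card ≤ m := by
      choose! f hf using hirr
      refine hm Q hQR f (fun v hv => (hf v hv).1) fun v hv v' hv' => ⟨fun hadj => ?_, ?_⟩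
      · exact Finset.card_le_one.1 (hf v hv).2.2 v' (by simp [hv', hadj]) v
          (by simp [hv, (hf v hv).2.1])
      · rintro rfl
        exact (hf v' hv).2.1
    have h2 : (R \ Q).card ≤ d * m := by
      refine Irredundant.card_le (fun v hv => ?_) fun M hM => hm M (hM.trans Finset.sdiff_subset)
      rw [Finset.mem_sdiff] at hv
      obtain ⟨u, hu, huv, hc⟩ := hR v hv.1
      refine ⟨u, hu, huv, ?_⟩
      have h3 := hQ u hu
      have h4 : 0 < (R.filter (G.Adj u)).card := Finset.card_pos.2 ⟨v, by simp [hv.1, huv]⟩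
      have h5 : ((R \ Q).filter (G.Adj u)).card + (Q.filter (G.Adj u)).card =
          (R.filter (G.Adj u)).card := by
        rw [← Finset.card_union_of_disjoint, ← Finset.filter_union,
          Finset.sdiff_union_of_subset hQR]
        exact Finset.disjoint_filter_filter Finset.sdiff_disjoint
      omega
    have h3 := Finset.card_sdiff_add_card_eq_card hQR
    rw [add_mul, one_mul]
    omega

/-- The sets on one side of a cut which are `d`-irredundant for the other side are small. -/
theorem Irredundant.card_le_mim [Fintype V] {A : Set V} {d : ℕ} {R : Finset V}
    (hR : ((R : Set V) ⊆ A ∧ Irredundant G d Aᶜ R) ∨ ((R : Set V) ⊆ Aᶜ ∧ Irredundant G d A R)) :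
    R.card ≤ d * mim G A := by
  rcases hR with ⟨hA, hR⟩ | ⟨hA, hR⟩
  · exact hR.card_le fun M hM f hf h =>
      LocallyCheckable.card_le_mim (Or.inl fun v hv => ⟨hA (hM hv), hf v hv⟩) h
  · exact hR.card_le fun M hM f hf h =>
      LocallyCheckable.card_le_mim (Or.inr fun v hv => ⟨hA (hM hv), hf v hv⟩) h

end Graph

section Partial

variable {V : Type v} {q : ℕ}

/-! ### Partial colourings -/

/-- The set of the coloured vertices. -/
def dom (ρ : V → Option (Fin q)) : Set V := {v | ρ v ≠ none}

/-- The vertices with a colour in `C`. -/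
def coloured (ρ : V → Option (Fin q)) (C : Finset (Fin q)) : Set V := {v | ∃ j ∈ C, ρ v = some j}

/-- The union of two partial colourings, the first one having priority. -/
def merge (ρ ρ' : V → Option (Fin q)) : V → Option (Fin q) := fun v => (ρ v).or (ρ' v)

/-- The colouring `c`, changed to `ρ` where `ρ` is defined. -/
def glue (ρ : V → Option (Fin q)) (c : V → Fin q) : V → Fin q := fun v => (ρ v).getD (c v)

open Classical in
/-- The restriction of a colouring to the complement of `A`. -/
noncomputable def outside (A : Set V) (c : V → Fin q) : V → Option (Fin q) :=
  fun v => if v ∈ A then none else some (c v)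

theorem glue_merge (ρ ρ' : V → Option (Fin q)) (c : V → Fin q) :
    glue (merge ρ ρ') c = glue ρ (glue ρ' c) := by
  funext v
  cases h : ρ v <;> simp [glue, merge, h]

theorem coloured_subset_dom (ρ : V → Option (Fin q)) (C : Finset (Fin q)) :
    coloured ρ C ⊆ dom ρ := by
  rintro v ⟨j, -, hj⟩
  simp [dom, hj]

theorem exists_of_mem_dom {ρ : V → Option (Fin q)} {v : V} (h : v ∈ dom ρ) : ∃ a, ρ v = some a :=
  Option.ne_none_iff_exists'.1 h

theorem eq_none_of_notMem_dom {ρ : V → Option (Fin q)} {v : V} (h : v ∉ dom ρ) : ρ v = none :=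
  not_not.1 h

theorem outside_eq_some {A : Set V} {c : V → Fin q} {v : V} {j : Fin q} :
    outside A c v = some j ↔ v ∉ A ∧ c v = j := by
  by_cases h : v ∈ A <;> simp [outside, h]

theorem merge_outside (ρ : V → Option (Fin q)) (c : V → Fin q) (v : V) :
    merge ρ (outside (dom ρ) c) v = some (glue ρ c v) := by
  by_cases h : v ∈ dom ρ
  · obtain ⟨a, ha⟩ := exists_of_mem_dom h
    simp [merge, glue, ha]
  · simp [merge, glue, eq_none_of_notMem_dom h, outside, h]

theorem setOf_glue_mem (ρ : V → Option (Fin q)) (c : V → Fin q) (C : Finset (Fin q)) :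
    {x | glue ρ c x ∈ C} = coloured ρ C ∪ coloured (outside (dom ρ) c) C := by
  ext v
  by_cases h : v ∈ dom ρ
  · obtain ⟨a, ha⟩ := exists_of_mem_dom h
    simp [coloured, glue, ha, outside, h]
  · simp [coloured, glue, eq_none_of_notMem_dom h, outside, h]

theorem disjoint_dom_outside (ρ : V → Option (Fin q)) (c : V → Fin q) :
    Disjoint (dom ρ) (dom (outside (dom ρ) c)) :=
  Set.disjoint_left.2 fun v hv hv' => hv' (by simp [outside, hv])

variable [Fintype V] (G : SimpleGraph V) [DecidableRel G.Adj]

/-- The vertices of colour `j`. -/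
def colourClass (ρ : V → Option (Fin q)) (j : Fin q) : Finset V :=
  Finset.univ.filter fun v => ρ v = some j

/-- The number of neighbours of `x` which have colour `j` in a partial colouring. -/
def count (ρ : V → Option (Fin q)) (x : V) (j : Fin q) : ℕ :=
  ((colourClass ρ j).filter (G.Adj x)).card

variable {G}

theorem mem_colourClass {ρ : V → Option (Fin q)} {j : Fin q} {v : V} :
    v ∈ colourClass ρ j ↔ ρ v = some j := by simp [colourClass]

theorem colourClass_merge [DecidableEq V] {ρ ρ' : V → Option (Fin q)}
    (h : Disjoint (dom ρ) (dom ρ')) (j : Fin q) :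
    colourClass (merge ρ ρ') j = colourClass ρ j ∪ colourClass ρ' j := by
  ext v
  rw [Finset.mem_union, mem_colourClass, mem_colourClass, mem_colourClass]
  by_cases hv : v ∈ dom ρ
  · have h' := eq_none_of_notMem_dom (Set.disjoint_left.1 h hv)
    simp [merge, h']
  · simp [merge, eq_none_of_notMem_dom hv]

theorem disjoint_colourClass {ρ ρ' : V → Option (Fin q)} (h : Disjoint (dom ρ) (dom ρ'))
    (j : Fin q) : Disjoint (colourClass ρ j) (colourClass ρ' j) :=
  Finset.disjoint_left.2 fun v hv hv' => Set.disjoint_left.1 h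
    (show ρ v ≠ none by simp [mem_colourClass.1 hv])
    (show ρ' v ≠ none by simp [mem_colourClass.1 hv'])

theorem count_merge {ρ ρ' : V → Option (Fin q)} (h : Disjoint (dom ρ) (dom ρ')) (x : V)
    (j : Fin q) : count G (merge ρ ρ') x j = count G ρ x j + count G ρ' x j := by
  classical
  rw [count, colourClass_merge h, Finset.filter_union, Finset.card_union_of_disjoint
    (Finset.disjoint_filter_filter (disjoint_colourClass h j))]
  rfl

theorem nbrCount_glue (ρ : V → Option (Fin q)) (c : V → Fin q) (x : V) (j : Fin q) :
    nbrCount G (glue ρ c) x j = count G ρ x j + count G (outside (dom ρ) c) x j := by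
  rw [← count_merge (disjoint_dom_outside ρ c), nbrCount, count]
  congr 1
  ext v
  simp [mem_colourClass, merge_outside, and_comm]

theorem card_glue (ρ : V → Option (Fin q)) (c : V → Fin q) (j : Fin q) :
    (Finset.univ.filter fun x => glue ρ c x = j).card =
      (colourClass ρ j).card + (colourClass (outside (dom ρ) c) j).card := by
  classical
  rw [← Finset.card_union_of_disjoint (disjoint_colourClass (disjoint_dom_outside ρ c) j),
    ← colourClass_merge (disjoint_dom_outside ρ c)]
  congr 1
  ext v
  simp [mem_colourClass, merge_outside]

/-! ### Contexts and the exchange of partial colourings -/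

/-- The truncated neighbour counts of the vertices coloured by `ρ`, in the presence of `ρ'`. -/
def localCounts (d : ℕ) (G : SimpleGraph V) [DecidableRel G.Adj] (ρ ρ' : V → Option (Fin q))
    (x : V) : Fin q → ℕ :=
  fun j => min d (count G (merge ρ ρ') x j)

/-- The vertices coloured by `ρ` pass the check in the presence of `ρ'`. -/
def LocallyProper (d : ℕ) (G : SimpleGraph V) [DecidableRel G.Adj]
    (check : V → Fin q → (Fin q → ℕ) → Bool) (ρ ρ' : V → Option (Fin q)) : Prop :=
  ∀ x a, ρ x = some a → check x a (localCounts d G ρ ρ' x) = true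

/-- The total weight of the vertices coloured by `ρ`, in the presence of `ρ'`. -/
def localWeight {W : Type u} [WeightSet W] (d : ℕ) (G : SimpleGraph V) [DecidableRel G.Adj]
    (w : V → Fin q → (Fin q → ℕ) → W) (ρ ρ' : V → Option (Fin q)) : W :=
  ∑ x, ∑ a, if ρ x = some a then w x a (localCounts d G ρ ρ' x) else 0

/-- The partial colouring `ρ'` is a part of the colouring `c` outside of `A`, and the vertices of
`A` cannot distinguish it from all of `c` outside of `A`. -/
structure IsContext (d : ℕ) (G : SimpleGraph V) [DecidableRel G.Adj] (A : Set V) (c : V → Fin q)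
    (ρ' : V → Option (Fin q)) : Prop where
  le : ∀ v j, ρ' v = some j → outside A c v = some j
  count_eq : ∀ x ∈ A, ∀ j, min d (count G ρ' x j) = min d (count G (outside A c) x j)

/-- Two partial colourings of `A` are similar if they can be exchanged in every colouring with the
context `ρ'`: they show the same neighbour counts to the outside, have the same sizes of colour
classes, and for each connectivity constraint their components are attached to the same outer
vertices, where components are represented by the elements of the context that they contain. -/
structure Similar (d : ℕ) (G : SimpleGraph V) [DecidableRel G.Adj] (𝒞 : Set (Finset (Fin q)))
    (A : Set V) (ρ' ρ₁ ρ₂ : V → Option (Fin q)) : Prop where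
  count_eq : ∀ x, x ∉ A → ∀ j, min d (count G ρ₁ x j) = min d (count G ρ₂ x j)
  card_eq : ∀ j, (colourClass ρ₁ j).card = (colourClass ρ₂ j).card
  connected_iff : ∀ C ∈ 𝒞, (ConnectedOn G (coloured ρ₁ C) ↔ ConnectedOn G (coloured ρ₂ C))
  anchored_iff : ∀ C ∈ 𝒞, (Anchored G (coloured ρ₁ C) (coloured ρ' C) ↔
    Anchored G (coloured ρ₂ C) (coloured ρ' C))
  attached_iff : ∀ C ∈ 𝒞, ∀ r ∈ coloured ρ' C, ∀ x, x ∉ A →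
    (Attached G (coloured ρ₁ C) (coloured ρ' C) r x ↔
      Attached G (coloured ρ₂ C) (coloured ρ' C) r x)

section Similar

variable {d : ℕ} {𝒞 : Set (Finset (Fin q))} {A : Set V} {ρ' ρ₁ ρ₂ ρ₃ : V → Option (Fin q)}

theorem Similar.refl : Similar d G 𝒞 A ρ' ρ₁ ρ₁ :=
  ⟨fun _ _ _ => rfl, fun _ => rfl, fun _ _ => .rfl, fun _ _ => .rfl, fun _ _ _ _ _ _ => .rfl⟩

theorem Similar.symm (h : Similar d G 𝒞 A ρ' ρ₁ ρ₂) : Similar d G 𝒞 A ρ' ρ₂ ρ₁ :=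
  ⟨fun x hx j => (h.count_eq x hx j).symm, fun j => (h.card_eq j).symm,
    fun C hC => (h.connected_iff C hC).symm, fun C hC => (h.anchored_iff C hC).symm,
    fun C hC r hr x hx => (h.attached_iff C hC r hr x hx).symm⟩

theorem Similar.trans (h : Similar d G 𝒞 A ρ' ρ₁ ρ₂) (h' : Similar d G 𝒞 A ρ' ρ₂ ρ₃) :
    Similar d G 𝒞 A ρ' ρ₁ ρ₃ :=
  ⟨fun x hx j => (h.count_eq x hx j).trans (h'.count_eq x hx j),
    fun j => (h.card_eq j).trans (h'.card_eq j),
    fun C hC => (h.connected_iff C hC).trans (h'.connected_iff C hC),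
    fun C hC => (h.anchored_iff C hC).trans (h'.anchored_iff C hC),
    fun C hC r hr x hx => (h.attached_iff C hC r hr x hx).trans (h'.attached_iff C hC r hr x hx)⟩

end Similar

variable {d : ℕ} {W : Type u} [WeightSet W] {check : V → Fin q → (Fin q → ℕ) → Bool}
  {w : V → Fin q → (Fin q → ℕ) → W} {c : V → Fin q} {ρ ρ' : V → Option (Fin q)}

theorem IsContext.disjoint {A : Set V} (h : IsContext d G A c ρ') : Disjoint A (dom ρ') :=
  Set.disjoint_left.2 fun v hv hv' => by
    obtain ⟨j, hj⟩ := exists_of_mem_dom hv'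
    exact (outside_eq_some.1 (h.le v j hj)).1 hv

/-- A context determines what the vertices inside see of the outside. -/
theorem IsContext.min_nbrCount (h : IsContext d G (dom ρ) c ρ') {x : V} (hx : x ∈ dom ρ) :
    (fun j => min d (nbrCount G (glue ρ c) x j)) = localCounts d G ρ ρ' x := by
  funext j
  have := h.count_eq x hx j
  rw [nbrCount_glue, localCounts, count_merge h.disjoint]
  omega

theorem IsContext.isProper_iff (h : IsContext d G (dom ρ) c ρ') (hs : IsStable d G check) :
    IsProper G check (glue ρ c) ↔ LocallyProper d G check ρ ρ' ∧
      ∀ x, x ∉ dom ρ → check x (c x) (fun j => min d (nbrCount G (glue ρ c) x j)) = true := by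
  constructor
  · refine fun hp => ⟨fun x a ha => ?_, fun x hx => ?_⟩
    · have hx : x ∈ dom ρ := by simp [dom, ha]
      have := hp x
      rwa [hs, h.min_nbrCount hx, glue, ha] at this
    · have := hp x
      rwa [hs, glue, eq_none_of_notMem_dom hx] at this
  · rintro ⟨h1, h2⟩ x
    rw [hs]
    by_cases hx : x ∈ dom ρ
    · obtain ⟨a, ha⟩ := exists_of_mem_dom hx
      rw [h.min_nbrCount hx, glue, ha]
      exact h1 x a ha
    · have := h2 x hx
      rwa [glue, eq_none_of_notMem_dom hx]

open Classical in
theorem IsContext.weight_eq (h : IsContext d G (dom ρ) c ρ') (hs : IsStable d G w) :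
    weight G w (glue ρ c) = localWeight d G w ρ ρ' +
      ∑ x, if x ∈ dom ρ then 0 else w x (c x) (fun j => min d (nbrCount G (glue ρ c) x j)) := by
  rw [weight, localWeight, ← Finset.sum_add_distrib]
  refine Finset.sum_congr rfl fun x _ => ?_
  rw [hs]
  by_cases hx : x ∈ dom ρ
  · obtain ⟨a, ha⟩ := exists_of_mem_dom hx
    simp [h.min_nbrCount hx, glue, ha, hx]
  · simp [hx, glue, eq_none_of_notMem_dom hx]

/-- Similar partial colourings of `A` can be exchanged in a feasible colouring with the given
context, where the order of the weights is preserved. -/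
theorem IsContext.exchange {𝒦 : Finset (Fin q → ℕ)} {𝒞 : Finset (Finset (Fin q))} {A : Set V}
    {ρ₁ ρ₂ : V → Option (Fin q)} (hd : 0 < d) (hcheck : IsStable d G check) (hw : IsStable d G w)
    (h₁ : dom ρ₁ = A) (h₂ : dom ρ₂ = A) (hctx : IsContext d G A c ρ')
    (hsim : Similar d G 𝒞 A ρ' ρ₁ ρ₂) (hproper : LocallyProper d G check ρ₂ ρ')
    (hle : localWeight d G w ρ₂ ρ' ≤ localWeight d G w ρ₁ ρ')
    (hfeas : IsFeasible G check 𝒦 𝒞 (glue ρ₁ c)) :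
    IsFeasible G check 𝒦 𝒞 (glue ρ₂ c) ∧ weight G w (glue ρ₂ c) ≤ weight G w (glue ρ₁ c) := by
  have hctx₁ : IsContext d G (dom ρ₁) c ρ' := h₁ ▸ hctx
  have hctx₂ : IsContext d G (dom ρ₂) c ρ' := h₂ ▸ hctx
  have hout : ∀ x, x ∉ A → (fun j => min d (nbrCount G (glue ρ₂ c) x j)) =
      fun j => min d (nbrCount G (glue ρ₁ c) x j) := fun x hx => by
    funext j
    have := hsim.count_eq x hx j
    rw [nbrCount_glue, nbrCount_glue, h₁, h₂]
    omega
  obtain ⟨hp, hK, hC⟩ := hfeas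
  refine ⟨⟨?_, ?_, fun C hCC => ?_⟩, ?_⟩
  · refine (hctx₂.isProper_iff hcheck).2 ⟨hproper, fun x hx => ?_⟩
    rw [h₂] at hx
    rw [hout x hx]
    exact ((hctx₁.isProper_iff hcheck).1 hp).2 x (h₁ ▸ hx)
  · convert hK using 2 with j
    rw [card_glue, card_glue, h₁, h₂, hsim.card_eq]
  · have := hC C hCC
    rw [preconnected_induce_iff, setOf_glue_mem, h₁] at this
    rw [preconnected_induce_iff, setOf_glue_mem, h₂]
    refine this.exchange (A := A) (R := coloured ρ' C) (h₁ ▸ coloured_subset_dom ρ₁ C) ?_ ?_ ?_ ?_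
      (hsim.connected_iff C hCC).1 (hsim.anchored_iff C hCC).1
      fun r hr x hx => (hsim.attached_iff C hCC r hr x hx).1
    · rintro v ⟨j, -, hj⟩
      exact (outside_eq_some.1 hj).1
    · rintro v ⟨j, hj, hv⟩
      exact ⟨j, hj, hctx.le v j hv⟩
    · rintro x hx v ⟨j, hj, hv⟩ hadj
      have h1 := hctx.count_eq x hx j
      have h2 : 0 < count G (outside A c) x j :=
        Finset.card_pos.2 ⟨v, Finset.mem_filter.2 ⟨mem_colourClass.2 hv, hadj⟩⟩
      have h3 : 0 < count G ρ' x j := by omega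
      obtain ⟨r, hr⟩ := Finset.card_pos.1 h3
      rw [Finset.mem_filter, mem_colourClass] at hr
      exact ⟨r, ⟨j, hj, hr.1⟩, hr.2⟩
    · intro h0
      refine Set.eq_empty_of_forall_notMem ?_
      rintro v ⟨j, hj, hv⟩
      have h1 : 0 < (colourClass ρ₁ j).card := by
        rw [hsim.card_eq]
        exact Finset.card_pos.2 ⟨v, mem_colourClass.2 hv⟩
      obtain ⟨x, hx⟩ := Finset.card_pos.1 h1
      exact (h0 ▸ Set.notMem_empty x) ⟨j, hj, mem_colourClass.1 hx⟩
  · rw [hctx₁.weight_eq hw, hctx₂.weight_eq hw]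
    refine (add_le_add_left hle _).trans (le_of_eq ?_)
    congr 1
    refine Finset.sum_congr rfl fun x _ => ?_
    rw [h₁, h₂]
    split_ifs with hx
    · rfl
    · rw [hout x hx]

/-- Context colourings whose colour classes are irredundant. -/
def Admissible (d : ℕ) (G : SimpleGraph V) [DecidableRel G.Adj] (A : Set V)
    (ρ' : V → Option (Fin q)) : Prop :=
  dom ρ' ⊆ Aᶜ ∧ ∀ j, Irredundant G d A (colourClass ρ' j)

theorem exists_isContext (d : ℕ) (A : Set V) (c : V → Fin q) :
    ∃ ρ', Admissible d G A ρ' ∧ IsContext d G A c ρ' := by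
  classical
  choose R hR hcount hirr using fun j =>
    exists_irredundant (G := G) d A (colourClass (outside A c) j)
  have hmem : ∀ v j, (if v ∈ R (c v) then some (c v) else none) = some j ↔ v ∈ R j := by
    intro v j
    constructor
    · intro h
      split_ifs at h with hv
      · cases h
        exact hv
    · intro h
      have := (outside_eq_some.1 (mem_colourClass.1 (hR j h))).2
      subst this
      simp [h]
  have hclass : ∀ j, colourClass (fun v => if v ∈ R (c v) then some (c v) else none) j = R j :=
    fun j => by ext v; rw [mem_colourClass, hmem]
  refine ⟨fun v => if v ∈ R (c v) then some (c v) else none, ⟨?_, fun j => ?_⟩, ?_, ?_⟩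
  · intro v hv
    obtain ⟨j, hj⟩ := exists_of_mem_dom hv
    exact (outside_eq_some.1 (mem_colourClass.1 (hR j ((hmem v j).1 hj)))).1
  · rw [hclass]
    exact hirr j
  · intro v j hj
    exact mem_colourClass.1 (hR j ((hmem v j).1 hj))
  · intro x hx j
    rw [count, hclass]
    exact hcount j x hx

/-! ### The number of contexts and of similarity classes -/

/-- Sets of at most `k` vertices can be told apart by sequences of `k` optional vertices. -/
theorem exists_code (V : Type v) (k : ℕ) : ∃ f : Finset V → Fin k → Option V,
    ∀ S T, S.card ≤ k → T.card ≤ k → f S = f T → S = T := by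
  let f : Finset V → Fin k → Option V := fun S i =>
    if h : (i : ℕ) < S.card then some (S.equivFin.symm ⟨i, h⟩ : V) else none
  have hf : ∀ S : Finset V, S.card ≤ k → ∀ v, v ∈ S ↔ ∃ i, f S i = some v := by
    intro S hS v
    constructor
    · intro hv
      refine ⟨⟨S.equivFin ⟨v, hv⟩, (S.equivFin ⟨v, hv⟩).2.trans_le hS⟩, ?_⟩
      simp [f]
    · rintro ⟨i, hi⟩
      simp only [f] at hi
      split_ifs at hi with h
      cases hi
      exact Subtype.coe_prop _
  exact ⟨f, fun S T hS hT hST => by ext v; rw [hf S hS, hf T hT, hST]⟩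

theorem Admissible.card_colourClass_le {A : Set V} (h : Admissible d G A ρ') (j : Fin q) :
    (colourClass ρ' j).card ≤ d * mim G A :=
  Irredundant.card_le_mim (Or.inr ⟨fun v hv => h.1 (by
    simp [dom, mem_colourClass.1 (Finset.mem_coe.1 hv)]), h.2 j⟩)

/-- A bound for the number of admissible contexts. -/
def contextBound (d q N m : ℕ) : ℕ := (N ^ (d * m)) ^ q

theorem exists_code_of_admissible (d q : ℕ) (G : SimpleGraph V) [DecidableRel G.Adj] (A : Set V) :
    ∃ f : (V → Option (Fin q)) → Fin q → Fin (d * mim G A) → Option V, ∀ ρ₁ ρ₂,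
      Admissible d G A ρ₁ → Admissible d G A ρ₂ → f ρ₁ = f ρ₂ → ρ₁ = ρ₂ := by
  obtain ⟨f, hf⟩ := exists_code V (d * mim G A)
  refine ⟨fun ρ j => f (colourClass ρ j), fun ρ₁ ρ₂ h₁ h₂ h => ?_⟩
  have hj : ∀ j, colourClass ρ₁ j = colourClass ρ₂ j := fun j =>
    hf _ _ (h₁.card_colourClass_le j) (h₂.card_colourClass_le j) (congrFun h j)
  funext v
  refine Option.ext fun j => ?_
  rw [← mem_colourClass, hj, mem_colourClass]

theorem length_le_contextBound {A : Set V} {L : List (V → Option (Fin q))} (hL : L.Nodup)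
    (h : ∀ ρ ∈ L, Admissible d G A ρ) :
    L.length ≤ contextBound d q (Fintype.card V + 1) (mim G A) := by
  obtain ⟨f, hf⟩ := exists_code_of_admissible d q G A
  have := (hL.map_on (f := f) fun ρ₁ h₁ ρ₂ h₂ => hf ρ₁ ρ₂ (h ρ₁ h₁) (h ρ₂ h₂)).length_le_card
  simpa [contextBound] using this

/-- A bound for the number of similarity classes. -/
def classBound (d q N m : ℕ) : ℕ :=
  (N ^ (d * m)) ^ q * (N ^ q * (2 * (2 * (N ^ (d * m)) ^ (q * (d * m)))) ^ 2 ^ q)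

/-- The neighbourhoods of sets on one side of a cut have short codes. -/
theorem exists_code_nbrs (d : ℕ) (G : SimpleGraph V) [DecidableRel G.Adj] (A : Set V) :
    ∃ f : Finset V → Fin (d * mim G A) → Option V, ∀ S T : Finset V, (S : Set V) ⊆ A →
      (T : Set V) ⊆ A → f S = f T →
      ∀ x, x ∉ A → min d (S.filter (G.Adj x)).card = min d (T.filter (G.Adj x)).card := by
  obtain ⟨f, hf⟩ := exists_code V (d * mim G A)
  choose R hR hcount hirr using fun S => exists_irredundant (G := G) d Aᶜ S
  refine ⟨fun S => f (R S), fun S T hS hT h x hx => ?_⟩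
  have hcard : ∀ S : Finset V, (S : Set V) ⊆ A → (R S).card ≤ d * mim G A := fun S hS =>
    Irredundant.card_le_mim (Or.inl ⟨fun v hv => hS (hR S hv), hirr S⟩)
  rw [← hcount S x hx, ← hcount T x hx, hf _ _ (hcard S hS) (hcard T hT) h]

theorem Admissible.card_dom_le {A : Set V} (h : Admissible d G A ρ') :
    Nat.card (dom ρ') ≤ q * (d * mim G A) := by
  classical
  have : (dom ρ') = ((Finset.univ.biUnion (colourClass ρ') : Finset V) : Set V) := by
    ext v
    simp [dom, mem_colourClass, Option.ne_none_iff_exists']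
  rw [Nat.card_coe_set_eq, this, Set.ncard_coe_finset]
  refine (Finset.card_biUnion_le_card_mul _ _ _ fun j _ => h.card_colourClass_le j).trans ?_
  simp

open Classical in
/-- The data that determine the similarity class of a partial colouring can be encoded in a small
set. -/
theorem Admissible.length_le_classBound (hd : 0 < d) {A : Set V} (h : Admissible d G A ρ')
    {𝒞 : Set (Finset (Fin q))} {L : List (V → Option (Fin q))} (hdom : ∀ ρ ∈ L, dom ρ = A)
    (hL : L.Pairwise fun ρ₁ ρ₂ => ¬ Similar d G 𝒞 A ρ' ρ₁ ρ₂) :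
    L.length ≤ classBound d q (Fintype.card V + 1) (mim G A) := by
  obtain ⟨f, hf⟩ := exists_code_nbrs d G A
  -- the part of a colour set which is joined to a given vertex of the context
  let Y : (V → Option (Fin q)) → Finset (Fin q) → V → Finset V := fun ρ C r =>
    Finset.univ.filter fun s => s ∈ coloured ρ C ∧
      (within G (coloured ρ C ∪ coloured ρ' C)).Reachable r s
  let code : (V → Option (Fin q)) → (Fin q → Fin (d * mim G A) → Option V) ×
      (Fin q → Fin (Fintype.card V + 1)) ×
      (Finset (Fin q) → Bool × Bool × (dom ρ' → Fin (d * mim G A) → Option V)) := fun ρ =>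
    (fun j => f (colourClass ρ j),
      fun j => ⟨(colourClass ρ j).card, Nat.lt_succ_of_le (Finset.card_le_univ _)⟩,
      fun C => (decide (ConnectedOn G (coloured ρ C)),
        decide (Anchored G (coloured ρ C) (coloured ρ' C)), fun r => f (Y ρ C r)))
  have hclass : ∀ ρ : V → Option (Fin q), dom ρ = A → ∀ j, (colourClass ρ j : Set V) ⊆ A := by
    rintro ρ rfl j v hv
    simp [dom, mem_colourClass.1 (Finset.mem_coe.1 hv)]
  have hY : ∀ ρ, dom ρ = A → ∀ C r, (Y ρ C r : Set V) ⊆ A := by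
    rintro ρ rfl C r v hv
    exact coloured_subset_dom ρ C (Finset.mem_filter.1 (Finset.mem_coe.1 hv)).2.1
  have hatt : ∀ ρ C r x, Attached G (coloured ρ C) (coloured ρ' C) r x ↔
      0 < min d ((Y ρ C r).filter (G.Adj x)).card := by
    intro ρ C r x
    rw [lt_min_iff, Finset.card_pos]
    constructor
    · rintro ⟨s, hs, hrs, hxs⟩
      exact ⟨hd, s, by simp [Y, hs, hrs, hxs]⟩
    · rintro ⟨-, s, hs⟩
      simp only [Y, Finset.mem_filter, Finset.mem_univ, true_and] at hs
      exact ⟨s, hs.1.1, hs.1.2, hs.2⟩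
  have hcode : ∀ ρ₁ ∈ L, ∀ ρ₂ ∈ L, code ρ₁ = code ρ₂ → Similar d G 𝒞 A ρ' ρ₁ ρ₂ := by
    intro ρ₁ h₁ ρ₂ h₂ h12
    have h₁' := hdom ρ₁ h₁
    have h₂' := hdom ρ₂ h₂
    simp only [code, Prod.mk.injEq, funext_iff, Fin.mk.injEq] at h12
    obtain ⟨hn, hs, hC⟩ := h12
    refine ⟨fun x hx j => hf _ _ (hclass _ h₁' j) (hclass _ h₂' j) (funext (hn j)) x hx, hs,
      fun C _ => decide_eq_decide.1 (hC C).1, fun C _ => decide_eq_decide.1 (hC C).2.1,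
      fun C _ r hr x hx => ?_⟩
    rw [hatt, hatt, hf _ _ (hY _ h₁' C r) (hY _ h₂' C r)
      (funext ((hC C).2.2 ⟨r, coloured_subset_dom ρ' C hr⟩)) x hx]
  have hnodup : (L.map code).Nodup := by
    rw [List.Nodup, List.pairwise_map]
    exact hL.imp_of_mem fun h₁ h₂ h hc => h (hcode _ h₁ _ h₂ hc)
  have := hnodup.length_le_card
  rw [List.length_map] at this
  refine this.trans ?_
  have hdom := h.card_dom_le
  rw [Nat.card_eq_fintype_card] at hdom
  simp only [Fintype.card_prod, Fintype.card_fun, Fintype.card_fin, Fintype.card_option,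
    Fintype.card_bool, Fintype.card_finset, classBound]
  gcongr
  exact Nat.one_le_pow _ _ (by omega)

end Partial

/-! ### Selection of best representatives -/

section Best

variable {α : Type v} {W : Type u} [WeightSet W] {wt : α → W} {sim : α → α → Prop}

open Classical in
/-- Insertion of a candidate into a list of best representatives of the classes of `sim`. -/
noncomputable def insertBest (wt : α → W) (sim : α → α → Prop) (x : α) (acc : List α) : List α :=
  if ∃ y ∈ acc, sim y x ∧ wt y ≤ wt x then acc else x :: acc.filter fun y => ¬ sim y x

/-- For each class of `sim` in a list, an element of minimum weight. -/
noncomputable def best (wt : α → W) (sim : α → α → Prop) (l : List α) : List α :=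
  l.foldr (insertBest wt sim) []

theorem best_cons (x : α) (l : List α) :
    best wt sim (x :: l) = insertBest wt sim x (best wt sim l) := rfl

theorem best_subset (l : List α) : best wt sim l ⊆ l := by
  induction l with
  | nil => exact List.Subset.refl _
  | cons x l ih =>
    rw [best_cons, insertBest]
    split_ifs
    · exact List.subset_cons_of_subset _ ih
    · exact List.cons_subset_cons _ (List.Subset.trans List.filter_sublist.subset ih)

theorem exists_mem_best (hrefl : ∀ x, sim x x) (htrans : ∀ x y z, sim x y → sim y z → sim x z)
    (hsymm : ∀ x y, sim x y → sim y x) {l : List α} : ∀ {x : α}, x ∈ l →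
    ∃ y ∈ best wt sim l, sim y x ∧ wt y ≤ wt x := by
  induction l with
  | nil => simp
  | cons z l ih =>
    intro x hx
    rw [best_cons, insertBest]
    split_ifs with h
    · rcases List.mem_cons.1 hx with rfl | hx
      · exact h
      · exact ih hx
    · rcases List.mem_cons.1 hx with rfl | hx
      · exact ⟨x, by simp, hrefl x, le_rfl⟩
      · obtain ⟨y, hy, hyx, hle⟩ := ih hx
        by_cases hyz : sim y z
        · push Not at h
          exact ⟨z, by simp, htrans _ _ _ (hsymm _ _ hyz) hyx, (h y hy hyz).le.trans hle⟩
        · exact ⟨y, by simp [hy, hyz], hyx, hle⟩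

theorem pairwise_best (hsymm : ∀ x y, sim x y → sim y x) (l : List α) :
    (best wt sim l).Pairwise fun x y => ¬ sim x y := by
  induction l with
  | nil => exact List.Pairwise.nil
  | cons z l ih =>
    rw [best_cons, insertBest]
    split_ifs with h
    · exact ih
    · refine List.Pairwise.cons (fun y hy hzy => ?_) (ih.filter _)
      simp only [List.mem_filter, decide_eq_true_eq] at hy
      exact hy.2 (hsymm _ _ hzy)

end Best

/-! ### The enumeration of contexts -/

section Contexts

variable {n q d : ℕ} {G : SimpleGraph (Fin n)} [DecidableRel G.Adj] {A : Set (Fin n)}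

/-- The partial colourings that give a colour to one more vertex. -/
def extensions (v : Fin n) (L : List (Fin n → Option (Fin q))) : List (Fin n → Option (Fin q)) :=
  L.flatMap fun ρ => (List.finRange q).map fun j => Function.update ρ v (some j)

open Classical in
/-- The admissible contexts whose coloured vertices belong to a list. -/
noncomputable def contextsIn (d q : ℕ) (G : SimpleGraph (Fin n)) [DecidableRel G.Adj]
    (A : Set (Fin n)) (l : List (Fin n)) : List (Fin n → Option (Fin q)) :=
  l.foldr (fun v L => (extensions v L).filter (fun ρ => Admissible d G A ρ) ++ L) [fun _ => none]

/-- All admissible contexts. -/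
noncomputable def contexts (d q : ℕ) (G : SimpleGraph (Fin n)) [DecidableRel G.Adj]
    (A : Set (Fin n)) : List (Fin n → Option (Fin q)) :=
  contextsIn d q G A (List.finRange n)

open Classical in
theorem contextsIn_cons (v : Fin n) (l : List (Fin n)) : contextsIn d q G A (v :: l) =
    (extensions v (contextsIn d q G A l)).filter (fun ρ => Admissible d G A ρ) ++
      contextsIn d q G A l := rfl

theorem admissible_of_mem_contextsIn {ρ : Fin n → Option (Fin q)} {l : List (Fin n)}
    (h : ρ ∈ contextsIn d q G A l) : Admissible d G A ρ := by
  induction l with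
  | nil =>
    obtain rfl : ρ = fun _ => none := by simpa [contextsIn] using h
    refine ⟨fun v hv => absurd rfl hv, fun j v hv => ?_⟩
    simp [mem_colourClass] at hv
  | cons v l ih =>
    rw [contextsIn_cons, List.mem_append, List.mem_filter] at h
    rcases h with h | h
    · simpa using h.2
    · exact ih h

theorem mem_extensions {v : Fin n} {L : List (Fin n → Option (Fin q))}
    {ρ : Fin n → Option (Fin q)} :
    ρ ∈ extensions v L ↔ ∃ ρ' ∈ L, ∃ j, Function.update ρ' v (some j) = ρ := by
  simp [extensions]

theorem dom_subset_of_mem_contextsIn {l : List (Fin n)} : ∀ {ρ : Fin n → Option (Fin q)},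
    ρ ∈ contextsIn d q G A l → ∀ v ∈ dom ρ, v ∈ l := by
  induction l with
  | nil =>
    intro ρ h v hv
    obtain rfl : ρ = fun _ => none := by simpa [contextsIn] using h
    exact absurd rfl hv
  | cons x l ih =>
    intro ρ h v hv
    rw [contextsIn_cons, List.mem_append, List.mem_filter, mem_extensions] at h
    rw [List.mem_cons]
    rcases h with ⟨⟨ρ', h, j, rfl⟩, -⟩ | h
    · by_cases hvx : v = x
      · exact Or.inl hvx
      · exact Or.inr (ih h v (by simpa [dom, hvx] using hv))
    · exact Or.inr (ih h v hv)

/-- The list of contexts has no repetition, so that a bound for the number of admissible contexts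
is one for its length. -/
theorem nodup_contextsIn {l : List (Fin n)} (hl : l.Nodup) :
    (contextsIn d q G A l).Nodup := by
  induction l with
  | nil => simp [contextsIn]
  | cons x l ih =>
    obtain ⟨hx, hl⟩ := List.nodup_cons.1 hl
    have hnone : ∀ ρ ∈ contextsIn d q G A l, ρ x = none := fun ρ hρ =>
      eq_none_of_notMem_dom fun h => hx (dom_subset_of_mem_contextsIn hρ x h)
    rw [contextsIn_cons]
    refine List.Nodup.append (List.Nodup.filter _ ?_) (ih hl) ?_
    · rw [extensions, List.nodup_flatMap]
      refine ⟨fun ρ _ => (List.nodup_finRange q).map fun j j' h => ?_,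
        (ih hl).imp_of_mem fun {ρ ρ'} h h' hne => ?_⟩
      · simpa using congrFun h x
      · simp only [Function.onFun, List.disjoint_left, List.mem_map]
        rintro _ ⟨j, -, rfl⟩ ⟨j', -, hj⟩
        refine hne (funext fun v => ?_)
        by_cases hv : v = x
        · rw [hv, hnone ρ h, hnone ρ' h']
        · simpa [hv] using (congrFun hj v).symm
    · rw [List.disjoint_left]
      intro ρ h h'
      rw [List.mem_filter, mem_extensions] at h
      obtain ⟨⟨ρ', -, j, rfl⟩, -⟩ := h
      simpa using hnone _ h'

theorem Admissible.of_le {ρ ρ' : Fin n → Option (Fin q)} (h : Admissible d G A ρ)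
    (hle : ∀ v j, ρ' v = some j → ρ v = some j) : Admissible d G A ρ' := by
  have hsub : ∀ j, colourClass ρ' j ⊆ colourClass ρ j := fun j v hv =>
    mem_colourClass.2 (hle v j (mem_colourClass.1 hv))
  refine ⟨fun v hv => ?_, fun j v hv => ?_⟩
  · obtain ⟨j, hj⟩ := exists_of_mem_dom hv
    exact h.1 (show ρ v ≠ none by simp [hle v j hj])
  · obtain ⟨u, hu, huv, hcard⟩ := h.2 j v (hsub j hv)
    exact ⟨u, hu, huv, (Finset.card_le_card (Finset.filter_subset_filter _ (hsub j))).trans hcard⟩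

/-- Irredundance is hereditary, so that admissible contexts can be built up vertex by vertex. -/
theorem Admissible.mem_contextsIn {l : List (Fin n)} : ∀ {ρ : Fin n → Option (Fin q)},
    Admissible d G A ρ → (∀ v ∈ dom ρ, v ∈ l) → ρ ∈ contextsIn d q G A l := by
  induction l with
  | nil =>
    intro ρ _ h
    rw [contextsIn, List.foldr_nil, List.mem_singleton]
    exact funext fun v => eq_none_of_notMem_dom fun hv => List.not_mem_nil (h v hv)
  | cons x l ih =>
    intro ρ hρ h
    rw [contextsIn_cons, List.mem_append, List.mem_filter, mem_extensions]
    by_cases hx : x ∈ dom ρ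
    · obtain ⟨j, hj⟩ := exists_of_mem_dom hx
      refine Or.inl ⟨⟨Function.update ρ x none, ih (hρ.of_le fun v j' hj' => ?_) fun v hv => ?_, j,
        ?_⟩, by simpa using hρ⟩
      · by_cases hv : v = x
        · simp [hv] at hj'
        · simpa [hv] using hj'
      · by_cases hvx : v = x
        · simp [dom, hvx] at hv
        · exact (List.mem_cons.1 (h v (by simpa [dom, hvx] using hv))).resolve_left hvx
      · rw [Function.update_idem, ← hj, Function.update_eq_self]
    · exact Or.inr (ih hρ fun v hv =>
        (List.mem_cons.1 (h v hv)).resolve_left fun hvx => hx (hvx ▸ hv))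

theorem mem_contexts {ρ : Fin n → Option (Fin q)} :
    ρ ∈ contexts d q G A ↔ Admissible d G A ρ :=
  ⟨admissible_of_mem_contextsIn, fun h => h.mem_contextsIn fun v _ => List.mem_finRange v⟩

theorem length_contextsIn_le {l : List (Fin n)} (hl : l.Nodup) :
    (contextsIn d q G A l).length ≤ contextBound d q (n + 1) (mim G A) := by
  simpa using length_le_contextBound (nodup_contextsIn hl)
    fun _ h => admissible_of_mem_contextsIn h

end Contexts

/-! ### Representative sets -/

section DynamicProgramming

variable {n q : ℕ} {W : Type u} [WeightSet W]

open Classical in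
/-- A list of representatives for a list `L` of partial colourings of `A`. -/
noncomputable def reduce (d : ℕ) (G : SimpleGraph (Fin n)) [DecidableRel G.Adj]
    (check : Fin n → Fin q → (Fin q → ℕ) → Bool) (w : Fin n → Fin q → (Fin q → ℕ) → W)
    (𝒞 : Set (Finset (Fin q))) (A : Set (Fin n)) (L : List (Fin n → Option (Fin q))) :
    List (Fin n → Option (Fin q)) :=
  (contexts d q G A).flatMap fun ρ' =>
    best (fun ρ => localWeight d G w ρ ρ') (Similar d G 𝒞 A ρ')
      (L.filter fun ρ => LocallyProper d G check ρ ρ')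

/-- The unions of the members of two lists. -/
def products (L L' : List (Fin n → Option (Fin q))) : List (Fin n → Option (Fin q)) :=
  L.flatMap fun ρ => L'.map fun ρ' => merge ρ ρ'

/-- A list of representatives for the partial colourings of the vertices in a subtree. -/
noncomputable def representatives (d : ℕ) (G : SimpleGraph (Fin n)) [DecidableRel G.Adj]
    (check : Fin n → Fin q → (Fin q → ℕ) → Bool) (w : Fin n → Fin q → (Fin q → ℕ) → W)
    (𝒞 : Set (Finset (Fin q))) : BinTree (Fin n) → List (Fin n → Option (Fin q))
  | .leaf x => (List.finRange q).map fun j v => if v = x then some j else none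
  | .node l r => reduce d G check w 𝒞 {x | x ∈ (BinTree.node l r).leaves}
      (products (representatives d G check w 𝒞 l) (representatives d G check w 𝒞 r))

/-- Each feasible colouring can be changed to a member of `L`, without becoming infeasible or
heavier. -/
def Represents (G : SimpleGraph (Fin n)) [DecidableRel G.Adj]
    (check : Fin n → Fin q → (Fin q → ℕ) → Bool) (w : Fin n → Fin q → (Fin q → ℕ) → W)
    (𝒦 : Finset (Fin q → ℕ)) (𝒞 : Finset (Finset (Fin q)))
    (L : List (Fin n → Option (Fin q))) : Prop :=
  ∀ c, IsFeasible G check 𝒦 𝒞 c →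
    ∃ ρ ∈ L, IsFeasible G check 𝒦 𝒞 (glue ρ c) ∧ weight G w (glue ρ c) ≤ weight G w c

variable {d : ℕ} {G : SimpleGraph (Fin n)} [DecidableRel G.Adj]
  {check : Fin n → Fin q → (Fin q → ℕ) → Bool} {w : Fin n → Fin q → (Fin q → ℕ) → W}
  {𝒦 : Finset (Fin q → ℕ)} {𝒞 : Finset (Finset (Fin q))} {A : Set (Fin n)}
  {L L' : List (Fin n → Option (Fin q))}

theorem Represents.products (hL : Represents G check w 𝒦 𝒞 L) (hL' : Represents G check w 𝒦 𝒞 L') :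
    Represents G check w 𝒦 𝒞 (products L L') := by
  intro c hc
  obtain ⟨ρ', hρ', hc', hle'⟩ := hL' c hc
  obtain ⟨ρ, hρ, hc'', hle⟩ := hL _ hc'
  refine ⟨merge ρ ρ', ?_, ?_⟩
  · simp only [LocallyCheckable.products, List.mem_flatMap, List.mem_map]
    exact ⟨ρ, hρ, ρ', hρ', rfl⟩
  · rw [glue_merge]
    exact ⟨hc'', hle.trans hle'⟩

theorem reduce_subset {𝒞 : Set (Finset (Fin q))} : reduce d G check w 𝒞 A L ⊆ L := by
  intro ρ hρ
  simp only [reduce, List.mem_flatMap] at hρ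
  obtain ⟨ρ', -, h⟩ := hρ
  exact List.filter_sublist.subset (best_subset _ h)

theorem Represents.reduce (hd : 0 < d) (hcheck : IsStable d G check) (hw : IsStable d G w)
    (hdom : ∀ ρ ∈ L, dom ρ = A) (hL : Represents G check w 𝒦 𝒞 L) :
    Represents G check w 𝒦 𝒞 (reduce d G check w 𝒞 A L) := by
  classical
  intro c hc
  obtain ⟨ρ₁, hρ₁, hfeas, hle⟩ := hL c hc
  have h₁ := hdom ρ₁ hρ₁
  obtain ⟨ρ', hadm, hctx⟩ := exists_isContext (G := G) d A c
  have hproper := (IsContext.isProper_iff (h₁ ▸ hctx) hcheck).1 hfeas.1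
  obtain ⟨ρ₂, hρ₂, hsim, hle₂⟩ := exists_mem_best (wt := fun ρ => localWeight d G w ρ ρ')
    (sim := Similar d G 𝒞 A ρ') (l := L.filter fun ρ => LocallyProper d G check ρ ρ')
    (fun _ => .refl) (fun _ _ _ => .trans) (fun _ _ => .symm)
    (List.mem_filter.2 ⟨hρ₁, decide_eq_true hproper.1⟩)
  have hρ₂' := List.mem_filter.1 (best_subset _ hρ₂)
  obtain ⟨hf, hw'⟩ := hctx.exchange hd hcheck hw h₁ (hdom ρ₂ hρ₂'.1) hsim.symm
    (of_decide_eq_true hρ₂'.2) hle₂ hfeas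
  exact ⟨ρ₂, List.mem_flatMap.2 ⟨ρ', mem_contexts.2 hadm, hρ₂⟩, hf, hw'.trans hle⟩

theorem dom_merge (ρ ρ' : Fin n → Option (Fin q)) : dom (merge ρ ρ') = dom ρ ∪ dom ρ' := by
  ext v
  cases h : ρ v <;> simp [dom, merge, h]

theorem dom_of_mem_products {B : Set (Fin n)} (hL : ∀ ρ ∈ L, dom ρ = A) (hL' : ∀ ρ ∈ L', dom ρ = B)
    {ρ : Fin n → Option (Fin q)} (hρ : ρ ∈ products L L') : dom ρ = A ∪ B := by
  simp only [products, List.mem_flatMap, List.mem_map] at hρ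
  obtain ⟨ρ₁, h₁, ρ₂, h₂, rfl⟩ := hρ
  rw [dom_merge, hL ρ₁ h₁, hL' ρ₂ h₂]

theorem leaves_node (l r : BinTree (Fin n)) :
    {x | x ∈ (BinTree.node l r).leaves} = {x | x ∈ l.leaves} ∪ {x | x ∈ r.leaves} := by
  ext x
  simp [BinTree.leaves]

theorem dom_of_mem_representatives {𝒞 : Set (Finset (Fin q))} {T : BinTree (Fin n)} :
    ∀ {ρ : Fin n → Option (Fin q)}, ρ ∈ representatives d G check w 𝒞 T →
      dom ρ = {x | x ∈ T.leaves} := by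
  induction T with
  | leaf x =>
    intro ρ hρ
    simp only [representatives, List.mem_map] at hρ
    obtain ⟨j, -, rfl⟩ := hρ
    ext v
    by_cases h : v = x <;> simp [dom, BinTree.leaves, h]
  | node l r ihl ihr =>
    intro ρ hρ
    rw [leaves_node]
    exact dom_of_mem_products (fun _ => ihl) (fun _ => ihr) (reduce_subset hρ)

theorem represents_representatives (hd : 0 < d) (hcheck : IsStable d G check)
    (hw : IsStable d G w) (T : BinTree (Fin n)) :
    Represents G check w 𝒦 𝒞 (representatives d G check w 𝒞 T) := by
  induction T with
  | leaf x =>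
    intro c hc
    refine ⟨fun v => if v = x then some (c x) else none, ?_, ?_⟩
    · simp [representatives]
    · have : glue (fun v => if v = x then some (c x) else none) c = c := by
        funext v
        by_cases h : v = x <;> simp [glue, h]
      rw [this]
      exact ⟨hc, le_rfl⟩
  | node l r ihl ihr =>
    refine (ihl.products ihr).reduce hd hcheck hw fun ρ hρ => ?_
    rw [leaves_node]
    exact dom_of_mem_products (fun _ => dom_of_mem_representatives)
      (fun _ => dom_of_mem_representatives) hρ

theorem length_best_le {𝒞 : Set (Finset (Fin q))} (hd : 0 < d) (hdom : ∀ ρ ∈ L, dom ρ = A)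
    {ρ' : Fin n → Option (Fin q)} (hρ' : Admissible d G A ρ') (wt : (Fin n → Option (Fin q)) → W) :
    (best wt (Similar d G 𝒞 A ρ') L).length ≤ classBound d q (n + 1) (mim G A) := by
  simpa using hρ'.length_le_classBound hd (fun ρ hρ => hdom ρ (best_subset _ hρ))
    (pairwise_best (fun _ _ => .symm) L)

/-- A bound for the number of representatives, on which the running time depends. -/
def representativesBound (d q N m : ℕ) : ℕ := q + contextBound d q N m * classBound d q N m

theorem length_reduce_le {𝒞 : Set (Finset (Fin q))} (hd : 0 < d) (hdom : ∀ ρ ∈ L, dom ρ = A) :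
    (reduce d G check w 𝒞 A L).length ≤
      contextBound d q (n + 1) (mim G A) * classBound d q (n + 1) (mim G A) := by
  rw [reduce, List.length_flatMap]
  refine (List.sum_le_card_nsmul _ (classBound d q (n + 1) (mim G A)) ?_).trans ?_
  · intro k hk
    obtain ⟨ρ', hρ', rfl⟩ := List.mem_map.1 hk
    exact length_best_le hd (fun ρ hρ => hdom ρ (List.mem_filter.1 hρ).1) (mem_contexts.1 hρ') _
  · rw [List.length_map, smul_eq_mul]
    exact Nat.mul_le_mul_right _ (length_contextsIn_le (List.nodup_finRange n))

theorem length_representatives_le {𝒞 : Set (Finset (Fin q))} (hd : 0 < d) (T : BinTree (Fin n)) :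
    (representatives d G check w 𝒞 T).length ≤
      representativesBound d q (n + 1) (mim G {x | x ∈ T.leaves}) := by
  cases T with
  | leaf x => simp [representatives, representativesBound]
  | node l r =>
    refine le_trans (length_reduce_le hd fun ρ hρ => ?_) (Nat.le_add_left _ _)
    rw [leaves_node]
    exact dom_of_mem_products (fun _ => dom_of_mem_representatives)
      (fun _ => dom_of_mem_representatives) hρ

theorem length_products (L L' : List (Fin n → Option (Fin q))) :
    (products L L').length = L.length * L'.length := by
  simp [products, List.length_flatMap]

/-! ### The final choice -/

/-- The feasibility of a total colouring, in terms of a partial colouring which is defined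
everywhere. -/
def Passes (d : ℕ) (G : SimpleGraph (Fin n)) [DecidableRel G.Adj]
    (check : Fin n → Fin q → (Fin q → ℕ) → Bool) (𝒦 : Set (Fin q → ℕ))
    (𝒞 : Set (Finset (Fin q))) (ρ : Fin n → Option (Fin q)) : Prop :=
  LocallyProper d G check ρ (fun _ => none) ∧
    (∃ K ∈ 𝒦, ∀ j, K j = (colourClass ρ j).card) ∧ ∀ C ∈ 𝒞, ConnectedOn G (coloured ρ C)

theorem isContext_none (c : Fin n → Fin q) :
    IsContext d G Set.univ c fun _ => none := by
  have : outside Set.univ c = fun _ => none := by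
    funext v
    simp [outside]
  exact ⟨fun v j h => by simp at h, fun x _ j => by rw [this]⟩

theorem isFeasible_glue_iff (hcheck : IsStable d G check) {ρ : Fin n → Option (Fin q)}
    (hρ : dom ρ = Set.univ) (c : Fin n → Fin q) :
    IsFeasible G check 𝒦 𝒞 (glue ρ c) ↔ Passes d G check 𝒦 𝒞 ρ := by
  have hctx : IsContext d G (dom ρ) c fun _ => none := hρ ▸ isContext_none c
  have hout : outside (dom ρ) c = fun _ => none := by
    funext v
    simp [outside, hρ]
  have hcard : ∀ j, (Finset.univ.filter fun x => glue ρ c x = j).card = (colourClass ρ j).card :=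
    fun j => by simp [card_glue, hout, colourClass]
  have hcol : ∀ C, {x | glue ρ c x ∈ C} = coloured ρ C := fun C => by
    rw [setOf_glue_mem, hout]
    simp [coloured]
  simp only [IsFeasible, Passes, hctx.isProper_iff hcheck, preconnected_induce_iff, hcol, hcard]
  refine and_congr (and_iff_left fun x hx => absurd (hρ ▸ Set.mem_univ x) hx)
    (and_congr ⟨fun h => ⟨_, h, fun _ => rfl⟩, ?_⟩ .rfl)
  rintro ⟨K, hK, h⟩
  rwa [← funext h]

theorem weight_glue (hw : IsStable d G w) {ρ : Fin n → Option (Fin q)} (hρ : dom ρ = Set.univ)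
    (c : Fin n → Fin q) : weight G w (glue ρ c) = localWeight d G w ρ fun _ => none := by
  have hctx : IsContext d G (dom ρ) c fun _ => none := hρ ▸ isContext_none c
  rw [hctx.weight_eq hw]
  simp [hρ]

open Classical in
/-- The feasible colourings of least weight among the representatives for the root; there is at
most one in the list. -/
noncomputable def finalists (d : ℕ) (G : SimpleGraph (Fin n)) [DecidableRel G.Adj]
    (check : Fin n → Fin q → (Fin q → ℕ) → Bool) (w : Fin n → Fin q → (Fin q → ℕ) → W)
    (𝒦 : Set (Fin q → ℕ)) (𝒞 : Set (Finset (Fin q))) (L : List (Fin n → Option (Fin q))) :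
    List (Fin n → Option (Fin q)) :=
  best (fun ρ => localWeight d G w ρ fun _ => none) (fun _ _ => True)
    (L.filter fun ρ => Passes d G check 𝒦 𝒞 ρ)

/-- The output, computed from the list of the finalists. -/
def answer (d : ℕ) (G : SimpleGraph (Fin n)) [DecidableRel G.Adj]
    (w : Fin n → Fin q → (Fin q → ℕ) → W) : List (Fin n → Option (Fin q)) → Data W
  | [] => .cons (.wt ⊤) .nil
  | ρ :: _ => .cons (.wt (localWeight d G w ρ fun _ => none))
      (.ofFn fun x => .ofNat ((ρ x).elim 0 fun a => a))

theorem isSolution_answer (hcheck : IsStable d G check) (hw : IsStable d G w)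
    (hL : Represents G check w 𝒦 𝒞 L) (hdom : ∀ ρ ∈ L, dom ρ = Set.univ) (hq : 0 < q) :
    IsSolution G check w 𝒦 𝒞 (answer d G w (finalists d G check w 𝒦 𝒞 L)) := by
  classical
  have hmem : ∀ ρ ∈ finalists d G check w 𝒦 𝒞 L, ρ ∈ L ∧ Passes d G check 𝒦 𝒞 ρ := fun ρ hρ => by
    have := List.mem_filter.1 (best_subset _ hρ)
    exact ⟨this.1, of_decide_eq_true this.2⟩
  have hbest : ∀ c, IsFeasible G check 𝒦 𝒞 c → ∃ ρ ∈ finalists d G check w 𝒦 𝒞 L,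
      localWeight d G w ρ (fun _ => none) ≤ weight G w c := fun c hc => by
    obtain ⟨ρ, hρ, hf, hle⟩ := hL c hc
    rw [isFeasible_glue_iff hcheck (hdom ρ hρ)] at hf
    rw [weight_glue hw (hdom ρ hρ)] at hle
    obtain ⟨ρ', hρ', -, hle'⟩ := exists_mem_best (l := L.filter fun ρ => Passes d G check 𝒦 𝒞 ρ)
      (wt := fun ρ => localWeight d G w ρ fun _ => none) (sim := fun _ _ => True)
      (fun _ => trivial) (fun _ _ _ _ _ => trivial) (fun _ _ _ => trivial)
      (List.mem_filter.2 ⟨hρ, decide_eq_true hf⟩)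
    exact ⟨ρ', hρ', hle'.trans hle⟩
  have hpair : (finalists d G check w 𝒦 𝒞 L).Pairwise fun _ _ => ¬ True :=
    pairwise_best (fun _ _ _ => trivial) _
  cases hfin : finalists d G check w 𝒦 𝒞 L with
  | nil =>
    refine Or.inr ⟨fun c hc => ?_, rfl⟩
    obtain ⟨ρ, hρ, -⟩ := hbest c hc
    rw [hfin] at hρ
    exact List.not_mem_nil hρ
  | cons ρ l =>
    obtain rfl : l = [] := by
      rw [hfin, List.pairwise_cons] at hpair
      exact List.eq_nil_iff_forall_not_mem.2 fun y hy => hpair.1 y hy trivial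
    obtain ⟨hρ, hpass⟩ := hmem ρ (by simp [hfin])
    have hc := (isFeasible_glue_iff hcheck (hdom ρ hρ) fun _ => ⟨0, hq⟩).2 hpass
    have hwt := weight_glue hw (hdom ρ hρ) fun _ => ⟨0, hq⟩
    have hopt : optimum G check w 𝒦 𝒞 = localWeight d G w ρ fun _ => none := by
      refine le_antisymm ?_ (Finset.le_inf fun c hc => ?_)
      · rw [← hwt]
        exact Finset.inf_le (by simpa using hc)
      · obtain ⟨ρ', hρ', hle⟩ := hbest c (by simpa using hc)
        rw [hfin, List.mem_singleton] at hρ'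
        exact hρ' ▸ hle
    refine Or.inl ⟨_, hc, by rw [hwt, hopt], ?_⟩
    rw [hopt, answer, Data.ofColoring]
    congr 2
    funext x
    obtain ⟨a, ha⟩ := exists_of_mem_dom (show x ∈ dom ρ from hdom ρ hρ ▸ Set.mem_univ x)
    simp [glue, ha]

end DynamicProgramming

/-! ### Computations with instances -/

/-- An instance of the problem with a decomposition tree, the parameter being a bound for its
mim-width. -/
structure Instance (q : ℕ) : Type (u + 1) extends Setting.{u} where
  /-- the graph -/
  G : SimpleGraph (Fin size)
  [decidable : DecidableRel G.Adj]
  /-- the decomposition tree -/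
  T : BinTree (Fin size)
  /-- the check function -/
  check : Fin size → Fin q → (Fin q → ℕ) → Bool
  /-- the weight function -/
  w : Fin size → Fin q → (Fin q → ℕ) → W
  /-- the size constraints -/
  Ks : List (Fin q → ℕ)
  /-- the connectivity constraints -/
  Cs : List (Finset (Fin q))
  isDecomposition : T.IsDecomposition
  mimw_le : mimw G T ≤ param
  nodup_Ks : Ks.Nodup
  sum_eq : ∀ K ∈ Ks, ∑ j, K j = size
  nodup_Cs : Cs.Nodup

attribute [instance] Instance.decidable

section Encoding

variable {W : Type u} {n q : ℕ}

/-- A partial colouring is given by numbers, which are `0` for uncoloured vertices. -/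
def encodePartial (ρ : Fin n → Option (Fin q)) : Data W :=
  .ofFn fun x => .ofNat ((ρ x).elim 0 fun a => a + 1)

/-- A set of vertices is given by its characteristic vector. -/
noncomputable def encodeSet (S : Set (Fin n)) : Data W := .ofFn fun x => bit (x ∈ S)

end Encoding

/-- The number of vertices and the input. -/
def Instance.encode {q : ℕ} (d : ℕ) (I : Instance.{u} q) : Data I.W :=
  .cons (.ofNat I.size) (.input d I.G I.T I.check I.w I.Ks I.Cs)

namespace Comp

variable {ι : Type v} {q d : ℕ} {I : ι → Instance.{u} q} {e : ∀ i, Data (I i).W}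

/-! ### Local conditions -/

section Local

variable {ρ ρ' : ∀ i, Fin (I i).size → Option (Fin q)} {x y : ∀ i, Fin (I i).size}
  {j : ι → Fin q} {C : ι → Finset (Fin q)} {S : ∀ i, Set (Fin (I i).size)}

theorem size_polyBdd : PolyBdd (fun i => (I i).toSetting) fun i => (I i).size := .size

theorem fin_polyBdd (x : ∀ i, Fin (I i).size) :
    PolyBdd (fun i => (I i).toSetting) fun i => (x i : ℕ) :=
  size_polyBdd.mono fun i => (x i).2.le

theorem size (hI : Comp (fun i => (I i).toSetting) e fun i => (I i).encode d) :
    Comp (fun i => (I i).toSetting) e fun i => .ofNat (I i).size := hI.fst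

theorem adj (hI : Comp (fun i => (I i).toSetting) e fun i => (I i).encode d)
    (hx : Comp (fun i => (I i).toSetting) e fun i => .ofNat (x i))
    (hy : Comp (fun i => (I i).toSetting) e fun i => .ofNat (y i)) :
    Comp (fun i => (I i).toSetting) e fun i => bit ((I i).G.Adj (x i) (y i)) :=
  (lookup (lookup hI.snd.fst hx size_polyBdd) hy size_polyBdd).congr fun _ => ofBool_decide _

theorem value (hρ : Comp (fun i => (I i).toSetting) e fun i => encodePartial (ρ i))
    (hx : Comp (fun i => (I i).toSetting) e fun i => .ofNat (x i)) :
    Comp (fun i => (I i).toSetting) e fun i => .ofNat ((ρ i (x i)).elim 0 fun a => a + 1) :=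
  lookup hρ hx size_polyBdd

theorem value_le (o : Option (Fin q)) : (o.elim 0 fun a => (a : ℕ) + 1) ≤ q := by
  cases o <;> simp

theorem eq_some (hρ : Comp (fun i => (I i).toSetting) e fun i => encodePartial (ρ i))
    (hx : Comp (fun i => (I i).toSetting) e fun i => .ofNat (x i))
    (hj : Comp (fun i => (I i).toSetting) e fun i => .ofNat (j i)) :
    Comp (fun i => (I i).toSetting) e fun i => bit (ρ i (x i) = some (j i)) := by
  refine ((value hρ hx).natEq hj.succ ((PolyBdd.const q).mono fun _ => value_le _)
    ((PolyBdd.const q).mono fun i => (j i).2)).iff_congr fun i => ?_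
  cases ρ i (x i) <;> simp [Fin.ext_iff]

theorem mem_dom (hρ : Comp (fun i => (I i).toSetting) e fun i => encodePartial (ρ i))
    (hx : Comp (fun i => (I i).toSetting) e fun i => .ofNat (x i)) :
    Comp (fun i => (I i).toSetting) e fun i => bit (x i ∈ dom (ρ i)) := by
  refine (value hρ hx).of_ne_nil fun i => ?_
  rw [ofNat_ne_nil]
  cases h : ρ i (x i) <;> simp [dom, h]

theorem mem_set (hS : Comp (fun i => (I i).toSetting) e fun i => encodeSet (S i))
    (hx : Comp (fun i => (I i).toSetting) e fun i => .ofNat (x i)) :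
    Comp (fun i => (I i).toSetting) e fun i => bit (x i ∈ S i) :=
  lookup hS hx size_polyBdd

theorem set (hI : Comp (fun i => (I i).toSetting) e fun i => (I i).encode d)
    (hS : Comp (fun j : Step fun i => (I i).size => (I j.i).toSetting)
      (fun j => .cons (.ofNat j.k) (e j.i)) fun j => bit (j.k ∈ S j.i)) :
    Comp (fun i => (I i).toSetting) e fun i => encodeSet (S i) :=
  ofFn (f := fun i k => bit (k ∈ S i)) (size hI) size_polyBdd hS

theorem mem_colours (hC : Comp (fun i => (I i).toSetting) e fun i => .ofColors (C i))
    (hj : Comp (fun i => (I i).toSetting) e fun i => .ofNat (j i)) :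
    Comp (fun i => (I i).toSetting) e fun i => bit (j i ∈ C i) :=
  (lookup hC hj (.const q)).congr fun _ => ofBool_decide _

theorem forall_colour {p : ι → Fin q → Prop}
    (hp : Comp (fun j : Step fun _ : ι => q => (I j.i).toSetting)
      (fun j => .cons (.ofNat j.k) (e j.i)) fun j => bit (p j.i j.k)) :
    Comp (fun i => (I i).toSetting) e fun i => bit (∀ j, p i j) :=
  forall_fin (nat q) (.const q) hp

theorem exists_colour {p : ι → Fin q → Prop}
    (hp : Comp (fun j : Step fun _ : ι => q => (I j.i).toSetting)
      (fun j => .cons (.ofNat j.k) (e j.i)) fun j => bit (p j.i j.k)) :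
    Comp (fun i => (I i).toSetting) e fun i => bit (∃ j, p i j) :=
  exists_fin (nat q) (.const q) hp

theorem coloured (hI : Comp (fun i => (I i).toSetting) e fun i => (I i).encode d)
    (hρ : Comp (fun i => (I i).toSetting) e fun i => encodePartial (ρ i))
    (hC : Comp (fun i => (I i).toSetting) e fun i => .ofColors (C i)) :
    Comp (fun i => (I i).toSetting) e fun i => encodeSet (coloured (ρ i) (C i)) :=
  set hI (exists_colour (I := fun j : Step fun i => (I i).size => I j.i)
    ((mem_colours hC.up₂ var₀).and (eq_some hρ.up₂ var₁ var₀)))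

theorem card_colourClass (hI : Comp (fun i => (I i).toSetting) e fun i => (I i).encode d)
    (hρ : Comp (fun i => (I i).toSetting) e fun i => encodePartial (ρ i))
    (hj : Comp (fun i => (I i).toSetting) e fun i => .ofNat (j i)) :
    Comp (fun i => (I i).toSetting) e fun i => .ofNat (colourClass (ρ i) (j i)).card :=
  card_fin (p := fun i k => ρ i k = some (j i)) (size hI) size_polyBdd (eq_some hρ.up var₀ hj.up)

theorem count (hI : Comp (fun i => (I i).toSetting) e fun i => (I i).encode d)
    (hρ : Comp (fun i => (I i).toSetting) e fun i => encodePartial (ρ i))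
    (hx : Comp (fun i => (I i).toSetting) e fun i => .ofNat (x i))
    (hj : Comp (fun i => (I i).toSetting) e fun i => .ofNat (j i)) :
    Comp (fun i => (I i).toSetting) e fun i => .ofNat (count (I i).G (ρ i) (x i) (j i)) := by
  refine (card_fin (p := fun i k => ρ i k = some (j i) ∧ (I i).G.Adj (x i) k) (size hI)
    size_polyBdd ((eq_some hρ.up var₀ hj.up).and (adj hI.up hx.up var₀))).congr fun i => ?_
  rw [LocallyCheckable.count, colourClass, Finset.filter_filter]

theorem merge (hI : Comp (fun i => (I i).toSetting) e fun i => (I i).encode d)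
    (hρ : Comp (fun i => (I i).toSetting) e fun i => encodePartial (ρ i))
    (hρ' : Comp (fun i => (I i).toSetting) e fun i => encodePartial (ρ' i)) :
    Comp (fun i => (I i).toSetting) e fun i => encodePartial (merge (ρ i) (ρ' i)) := by
  classical
  refine ofFn (size hI) size_polyBdd (((mem_dom hρ.up var₀).ite (value hρ.up var₀)
    (value hρ'.up var₀)).congr fun j => ?_)
  cases h : ρ j.i j.k <;> simp [dom, LocallyCheckable.merge, h]

theorem localCounts (hI : Comp (fun i => (I i).toSetting) e fun i => (I i).encode d)
    (hρ : Comp (fun i => (I i).toSetting) e fun i => encodePartial (ρ i))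
    (hρ' : Comp (fun i => (I i).toSetting) e fun i => encodePartial (ρ' i))
    (hx : Comp (fun i => (I i).toSetting) e fun i => .ofNat (x i)) (j : Fin q) :
    Comp (fun i => (I i).toSetting) e fun i =>
      .ofNat (localCounts d (I i).G (ρ i) (ρ' i) (x i) j) :=
  (count hI (merge hI hρ hρ') hx (nat (j : ℕ))).min_const d

theorem locallyProper (hI : Comp (fun i => (I i).toSetting) e fun i => (I i).encode d)
    (hρ : Comp (fun i => (I i).toSetting) e fun i => encodePartial (ρ i))
    (hρ' : Comp (fun i => (I i).toSetting) e fun i => encodePartial (ρ' i)) :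
    Comp (fun i => (I i).toSetting) e fun i =>
      bit (LocallyProper d (I i).G (I i).check (ρ i) (ρ' i)) := by
  refine forall_fin (size hI) size_polyBdd (forall_colour
    (I := fun j : Step fun i => (I i).size => I j.i)
    ((eq_some hρ.up₂ var₁ var₀).imp (Comp.congr (lookup_table d q (lookup (lookup
      hI.up₂.snd.snd.snd.fst var₁ size_polyBdd) var₀ (.const q))
      (localCounts hI.up₂ hρ.up₂ hρ'.up₂ var₁) fun _ _ => min_le_left _ _) fun j => ?_)))
  exact ofBool_eq_bit _

theorem localWeight (hI : Comp (fun i => (I i).toSetting) e fun i => (I i).encode d)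
    (hρ : Comp (fun i => (I i).toSetting) e fun i => encodePartial (ρ i))
    (hρ' : Comp (fun i => (I i).toSetting) e fun i => encodePartial (ρ' i)) :
    Comp (fun i => (I i).toSetting) e fun i =>
      .wt (localWeight d (I i).G (I i).w (ρ i) (ρ' i)) := by
  refine sum_fin (size hI) size_polyBdd (sum_fin (nat q) (.const q) (Comp.congr
    ((eq_some (I := fun j : Step fun _ : Step fun i => (I i).size => q => I j.i.i)
      hρ.up₂ var₁ var₀).ite (lookup_table d q (lookup (lookup
      hI.up₂.snd.snd.snd.snd.fst var₁ size_polyBdd) var₀ (.const q))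
      (localCounts hI.up₂ hρ.up₂ hρ'.up₂ var₁) fun _ _ => min_le_left _ _) zero)
        fun j => ?_))
  split_ifs <;> rfl

theorem admissible (hI : Comp (fun i => (I i).toSetting) e fun i => (I i).encode d)
    (hS : Comp (fun i => (I i).toSetting) e fun i => encodeSet (S i))
    (hρ : Comp (fun i => (I i).toSetting) e fun i => encodePartial (ρ i)) :
    Comp (fun i => (I i).toSetting) e fun i => bit (Admissible d (I i).G (S i) (ρ i)) := by
  have h₁ : Comp (fun i => (I i).toSetting) e fun i => bit (∀ x, x ∈ dom (ρ i) → ¬ x ∈ S i) :=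
    forall_fin (size hI) size_polyBdd ((mem_dom hρ.up var₀).imp (mem_set hS.up var₀).not)
  have h₂ : Comp (fun i => (I i).toSetting) e fun i => bit (∀ j, ∀ v, ρ i v = some j →
      ∃ u, u ∈ S i ∧ (I i).G.Adj u v ∧ ¬ d < LocallyCheckable.count (I i).G (ρ i) u j) :=
    forall_colour (forall_fin (size hI.up) size_polyBdd ((eq_some hρ.up₂ var₀ var₁).imp
      (exists_fin (size hI.up₂) size_polyBdd ((mem_set hS.up₃ var₀).and
        ((adj hI.up₃ var₀ var₁).and ((nat d).lt
          (count hI.up₃ hρ.up₃ var₀ var₂) (.const d)).not)))))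
  refine (h₁.and h₂).iff_congr fun i => and_congr .rfl ?_
  simp only [Irredundant, mem_colourClass, not_lt]
  rfl

end Local

end Comp

/-! ### Computation of connectivity conditions -/

section Ball

variable {V : Type v}

/-- The vertices at distance at most `k` from `r`. -/
def ball (H : SimpleGraph V) (r : V) (k : ℕ) : Set V := {x | ∃ p : H.Walk r x, p.length ≤ k}

theorem mem_ball_zero {H : SimpleGraph V} {r x : V} : x ∈ ball H r 0 ↔ x = r := by
  constructor
  · rintro ⟨p, hp⟩
    exact (SimpleGraph.Walk.eq_of_length_eq_zero (Nat.le_zero.1 hp)).symm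
  · rintro rfl
    exact ⟨.nil, le_rfl⟩

theorem mem_ball_succ {H : SimpleGraph V} {r x : V} {k : ℕ} :
    x ∈ ball H r (k + 1) ↔ x ∈ ball H r k ∨ ∃ y, y ∈ ball H r k ∧ H.Adj y x := by
  constructor
  · rintro ⟨p, hp⟩
    by_cases hk : p.length ≤ k
    · exact Or.inl ⟨p, hk⟩
    · have hnil : ¬ p.Nil := fun h => hk (by
        rw [SimpleGraph.Walk.length_eq_zero_iff.2 h]
        exact Nat.zero_le k)
      refine Or.inr ⟨p.penultimate, ⟨p.dropLast, ?_⟩, p.adj_penultimate hnil⟩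
      have := p.length_dropLast_add_one hnil
      omega
  · rintro (⟨p, hp⟩ | ⟨y, ⟨p, hp⟩, hyx⟩)
    · exact ⟨p, by omega⟩
    · exact ⟨p.concat hyx, by rw [SimpleGraph.Walk.length_concat]; omega⟩

theorem mem_ball_card [Fintype V] {H : SimpleGraph V} {r x : V} :
    x ∈ ball H r (Fintype.card V) ↔ H.Reachable r x := by
  classical
  constructor
  · rintro ⟨p, -⟩
    exact ⟨p⟩
  · rintro ⟨p⟩
    exact ⟨p.toPath, p.toPath.2.length_lt.le⟩

end Ball

namespace Comp

variable {ι : Type v} {q d : ℕ} {I : ι → Instance.{u} q} {e : ∀ i, Data (I i).W}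
  {S R : ∀ i, Set (Fin (I i).size)} {x y : ∀ i, Fin (I i).size}

/-- Reachability is decided by computing balls of growing radius, until the radius is the number
of vertices. -/
theorem reachable (hI : Comp (fun i => (I i).toSetting) e fun i => (I i).encode d)
    (hS : Comp (fun i => (I i).toSetting) e fun i => encodeSet (S i))
    (hx : Comp (fun i => (I i).toSetting) e fun i => .ofNat (x i))
    (hy : Comp (fun i => (I i).toSetting) e fun i => .ofNat (y i)) :
    Comp (fun i => (I i).toSetting) e fun i =>
      bit ((within (I i).G (S i)).Reachable (x i) (y i)) := by
  have h : Comp (fun i => (I i).toSetting) e fun i =>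
      encodeSet (ball (within (I i).G (S i)) (x i) (I i).size) := by
    refine iterate (s := fun i k => encodeSet (ball (within (I i).G (S i)) (x i) k)) (size hI)
      size_polyBdd (set hI ?_) (set (I := fun j : Step fun i => (I i).size => I j.i) hI.up₂ ?_)
    · refine (natEq var₀ hx.up (fin_polyBdd (I := fun j : Step fun i => (I i).size => I j.i) _)
        (fin_polyBdd (I := fun j : Step fun i => (I i).size => I j.i) _)).iff_congr fun j => ?_
      rw [mem_ball_zero, Fin.ext_iff]
    · refine iff_congr (p := fun j : Step fun j : Step fun i => (I i).size => (I j.i).size =>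
        j.k ∈ ball (within (I j.i.i).G (S j.i.i)) (x j.i.i) j.i.k ∨
          ∃ y, y ∈ ball (within (I j.i.i).G (S j.i.i)) (x j.i.i) j.i.k ∧
            (I j.i.i).G.Adj y j.k ∧ y ∈ S j.i.i ∧ j.k ∈ S j.i.i) ?_ fun j => mem_ball_succ.symm
      refine .or (mem_set var₂ var₀) (exists_fin (size hI.up₃) size_polyBdd ?_)
      refine .and (mem_set var₃ var₀) (.and (adj hI.up₄ var₀ var₁)
        (.and (mem_set hS.up₄ var₀) (mem_set hS.up₄ var₁)))
  refine (mem_set h hy).iff_congr fun i => ?_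
  have := mem_ball_card (H := within (I i).G (S i)) (r := x i) (x := y i)
  rwa [Fintype.card_fin] at this

theorem connectedOn (hI : Comp (fun i => (I i).toSetting) e fun i => (I i).encode d)
    (hS : Comp (fun i => (I i).toSetting) e fun i => encodeSet (S i)) :
    Comp (fun i => (I i).toSetting) e fun i => bit (ConnectedOn (I i).G (S i)) :=
  forall_fin (size hI) size_polyBdd (.imp (mem_set hS.up var₀)
    (forall_fin (size hI.up) size_polyBdd (.imp (mem_set hS.up₂ var₀)
      (reachable hI.up₂ hS.up₂ var₁ var₀))))

theorem union (hI : Comp (fun i => (I i).toSetting) e fun i => (I i).encode d)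
    (hS : Comp (fun i => (I i).toSetting) e fun i => encodeSet (S i))
    (hR : Comp (fun i => (I i).toSetting) e fun i => encodeSet (R i)) :
    Comp (fun i => (I i).toSetting) e fun i => encodeSet (S i ∪ R i) :=
  set hI (.or (mem_set hS.up var₀) (mem_set hR.up var₀))

theorem anchored (hI : Comp (fun i => (I i).toSetting) e fun i => (I i).encode d)
    (hS : Comp (fun i => (I i).toSetting) e fun i => encodeSet (S i))
    (hR : Comp (fun i => (I i).toSetting) e fun i => encodeSet (R i)) :
    Comp (fun i => (I i).toSetting) e fun i => bit (Anchored (I i).G (S i) (R i)) :=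
  forall_fin (size hI) size_polyBdd (.imp (mem_set hS.up var₀)
    (exists_fin (size hI.up) size_polyBdd (.and (mem_set hR.up₂ var₀)
      (reachable hI.up₂ (union hI hS hR).up₂ var₀ var₁))))

theorem attached (hI : Comp (fun i => (I i).toSetting) e fun i => (I i).encode d)
    (hS : Comp (fun i => (I i).toSetting) e fun i => encodeSet (S i))
    (hR : Comp (fun i => (I i).toSetting) e fun i => encodeSet (R i))
    (hx : Comp (fun i => (I i).toSetting) e fun i => .ofNat (x i))
    (hy : Comp (fun i => (I i).toSetting) e fun i => .ofNat (y i)) :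
    Comp (fun i => (I i).toSetting) e fun i =>
      bit (Attached (I i).G (S i) (R i) (x i) (y i)) :=
  exists_fin (size hI) size_polyBdd (.and (mem_set hS.up var₀)
    (.and (reachable hI.up (union hI hS hR).up hx.up var₀) (adj hI.up hy.up var₀)))

theorem length_Cs_polyBdd :
    PolyBdd (fun i => (I i).toSetting) fun i => (I i).Cs.length :=
  (PolyBdd.const (2 ^ q)).mono fun i => by simpa using (I i).nodup_Cs.length_le_card

theorem forall_constraint {p : ι → Finset (Fin q) → Prop}
    (hI : Comp (fun i => (I i).toSetting) e fun i => (I i).encode d)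
    (hp : Comp (fun j : Elem fun i => (I i).Cs => (I j.i).toSetting)
      (fun j => .cons (.ofColors j.x) (e j.i)) fun j => bit (p j.i j.x)) :
    Comp (fun i => (I i).toSetting) e fun i => bit (∀ C ∈ {C | C ∈ (I i).Cs}, p i C) :=
  forall_mem (encA := fun _ C => .ofColors C) hI.snd.snd.snd.snd.snd.snd.fst length_Cs_polyBdd hp

variable {A : ∀ i, Set (Fin (I i).size)} {ρ ρ₁ ρ₂ ρ' : ∀ i, Fin (I i).size → Option (Fin q)}

theorem similar (hI : Comp (fun i => (I i).toSetting) e fun i => (I i).encode d)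
    (hA : Comp (fun i => (I i).toSetting) e fun i => encodeSet (A i))
    (hρ' : Comp (fun i => (I i).toSetting) e fun i => encodePartial (ρ' i))
    (hρ₁ : Comp (fun i => (I i).toSetting) e fun i => encodePartial (ρ₁ i))
    (hρ₂ : Comp (fun i => (I i).toSetting) e fun i => encodePartial (ρ₂ i)) :
    Comp (fun i => (I i).toSetting) e fun i =>
      bit (Similar d (I i).G {C | C ∈ (I i).Cs} (A i) (ρ' i) (ρ₁ i) (ρ₂ i)) := by
  have h₁ : Comp (fun i => (I i).toSetting) e fun i => bit (∀ x, x ∉ A i → ∀ j,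
      min d (LocallyCheckable.count (I i).G (ρ₁ i) x j) =
        min d (LocallyCheckable.count (I i).G (ρ₂ i) x j)) :=
    forall_fin (size hI) size_polyBdd (.imp (.not (mem_set hA.up var₀))
      (forall_colour (I := fun j : Step fun i => (I i).size => I j.i)
        (natEq (min_const d (count hI.up₂ hρ₁.up₂ var₁ var₀))
          (min_const d (count hI.up₂ hρ₂.up₂ var₁ var₀))
          ((PolyBdd.const d).mono fun _ => min_le_left _ _)
          ((PolyBdd.const d).mono fun _ => min_le_left _ _))))
  have h₂ : Comp (fun i => (I i).toSetting) e fun i => bit (∀ j,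
      (colourClass (ρ₁ i) j).card = (colourClass (ρ₂ i) j).card) := by
    refine forall_colour (natEq (card_colourClass hI.up hρ₁.up var₀)
      (card_colourClass hI.up hρ₂.up var₀) ?_ ?_) <;>
    · refine (size_polyBdd (I := fun j : Step fun _ : ι => q => I j.i)).mono fun j => ?_
      exact (Finset.card_le_univ _).trans (by simp)
  have h₃ : Comp (fun i => (I i).toSetting) e fun i => bit (∀ C ∈ {C | C ∈ (I i).Cs},
      (ConnectedOn (I i).G (LocallyCheckable.coloured (ρ₁ i) C) ↔
        ConnectedOn (I i).G (LocallyCheckable.coloured (ρ₂ i) C))) :=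
    forall_constraint hI (.iff (connectedOn hI.up (coloured hI.up hρ₁.up var₀))
      (connectedOn hI.up (coloured hI.up hρ₂.up var₀)))
  have h₄ : Comp (fun i => (I i).toSetting) e fun i => bit (∀ C ∈ {C | C ∈ (I i).Cs},
      (Anchored (I i).G (LocallyCheckable.coloured (ρ₁ i) C)
          (LocallyCheckable.coloured (ρ' i) C) ↔
        Anchored (I i).G (LocallyCheckable.coloured (ρ₂ i) C)
          (LocallyCheckable.coloured (ρ' i) C))) :=
    forall_constraint hI (.iff
      (anchored hI.up (coloured hI.up hρ₁.up var₀) (coloured hI.up hρ'.up var₀))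
      (anchored hI.up (coloured hI.up hρ₂.up var₀) (coloured hI.up hρ'.up var₀)))
  have h₅ : Comp (fun i => (I i).toSetting) e fun i => bit (∀ C ∈ {C | C ∈ (I i).Cs},
      ∀ r, r ∈ LocallyCheckable.coloured (ρ' i) C → ∀ x, x ∉ A i →
      (Attached (I i).G (LocallyCheckable.coloured (ρ₁ i) C)
          (LocallyCheckable.coloured (ρ' i) C) r x ↔
        Attached (I i).G (LocallyCheckable.coloured (ρ₂ i) C)
          (LocallyCheckable.coloured (ρ' i) C) r x)) :=
    forall_constraint hI (forall_fin (size hI.up) size_polyBdd (.imp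
      (mem_set (coloured hI.up₂ hρ'.up₂ var₁) var₀)
      (forall_fin (size hI.up₂) size_polyBdd (.imp (.not (mem_set hA.up₃ var₀)) (.iff
        (attached hI.up₃ (coloured hI.up₃ hρ₁.up₃ var₂) (coloured hI.up₃ hρ'.up₃ var₂) var₁ var₀)
        (attached hI.up₃ (coloured hI.up₃ hρ₂.up₃ var₂) (coloured hI.up₃ hρ'.up₃ var₂)
          var₁ var₀))))))
  exact (h₁.and (h₂.and (h₃.and (h₄.and h₅)))).iff_congr fun i =>
    ⟨fun h => ⟨h.1, h.2.1, h.2.2.1, h.2.2.2.1, h.2.2.2.2⟩, fun h => ⟨h.1, h.2, h.3, h.4, h.5⟩⟩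

theorem emptyPartial (hI : Comp (fun i => (I i).toSetting) e fun i => (I i).encode d) :
    Comp (fun i => (I i).toSetting) e fun i =>
      encodePartial (n := (I i).size) (q := q) fun _ => none :=
  ofFn (size hI) size_polyBdd nil

/-- The number of size constraints is polynomial, because their entries are at most `size`. -/
theorem length_Ks_polyBdd :
    PolyBdd (fun i => (I i).toSetting) fun i => (I i).Ks.length := by
  refine (((size_polyBdd (I := I)).add (.const 1)).pow (b := fun _ => q) monotone_const).mono
    fun i => ?_
  have hle : ∀ K ∈ (I i).Ks, ∀ j, K j < (I i).size + 1 := fun K hK j =>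
    Nat.lt_succ_of_le (((I i).sum_eq K hK) ▸ Finset.single_le_sum (fun _ _ => Nat.zero_le _)
      (Finset.mem_univ j))
  have := ((I i).nodup_Ks.map_on (f := fun K j => Fin.ofNat ((I i).size + 1) (K j))
    fun K hK K' hK' h => funext fun j => ?_).length_le_card
  · simpa using this
  · have := congrArg Fin.val (congrFun h j)
    simpa [Fin.ofNat, Nat.mod_eq_of_lt (hle K hK j), Nat.mod_eq_of_lt (hle K' hK' j)] using this

theorem passes (hI : Comp (fun i => (I i).toSetting) e fun i => (I i).encode d)
    (hρ : Comp (fun i => (I i).toSetting) e fun i => encodePartial (ρ i)) :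
    Comp (fun i => (I i).toSetting) e fun i =>
      bit (Passes d (I i).G (I i).check {K | K ∈ (I i).Ks} {C | C ∈ (I i).Cs} (ρ i)) := by
  refine .and (locallyProper hI hρ (emptyPartial hI)) (.and ?_
    (forall_constraint hI (connectedOn hI.up (coloured hI.up hρ.up var₀))))
  refine exists_mem (α := fun _ => Fin q → ℕ) (encA := fun _ K => .ofTuple K)
    (p := fun i K => ∀ j, K j = (colourClass (ρ i) j).card)
    hI.snd.snd.snd.snd.snd.fst length_Ks_polyBdd
    (forall_colour (I := fun j : Elem fun i => (I i).Ks => I j.i)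
      (natEq (lookup (f := fun (j : Step fun _ : Elem fun i => (I i).Ks => q) k =>
        .ofNat (j.i.x k)) var₁ var₀ (.const q))
        (card_colourClass hI.up₂ hρ.up₂ var₀) ?_ ?_))
  · refine (size_polyBdd (I := fun j : Step fun _ : Elem fun i => (I i).Ks => q => I j.i.i)).mono
      fun j => ?_
    rw [← (I j.i.i).sum_eq j.i.x j.i.mem]
    exact Finset.single_le_sum (fun _ _ => Nat.zero_le _) (Finset.mem_univ j.k)
  · refine (size_polyBdd (I := fun j : Step fun _ : Elem fun i => (I i).Ks => q => I j.i.i)).mono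
      fun j => ?_
    exact (Finset.card_le_univ _).trans (by simp)

end Comp

/-! ### Computation of the representatives -/

/-- Two elements of a list. -/
structure ElemPair {ι : Type v} {α : ι → Type w} (l : ∀ i, List (α i)) : Type max v w where
  /-- the index of the input -/
  i : ι
  /-- the first element -/
  x : α i
  /-- the second element -/
  y : α i
  mem_x : x ∈ l i
  mem_y : y ∈ l i

theorem PolyBdd.contextBound {ι : Type v} {π : ι → Setting.{u}} (d q : ℕ) :
    PolyBdd π fun i => contextBound d q ((π i).size + 1) (π i).param :=
  ((PolyBdd.size.add (.const 1)).pow (b := fun m => d * m)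
    fun _ _ h => Nat.mul_le_mul_left d h).pow (b := fun _ => q) monotone_const

theorem PolyBdd.classBound {ι : Type v} {π : ι → Setting.{u}} (d q : ℕ) :
    PolyBdd π fun i => classBound d q ((π i).size + 1) (π i).param := by
  have hd : Monotone fun m => d * m := fun _ _ h => Nat.mul_le_mul_left d h
  have hN : PolyBdd π fun i => (π i).size + 1 := PolyBdd.size.add (.const 1)
  exact ((hN.pow hd).pow (b := fun _ => q) monotone_const).mul
    ((hN.pow (b := fun _ => q) monotone_const).mul
      ((PolyBdd.mul (.const 2) (.mul (.const 2) ((hN.pow hd).pow (b := fun m => q * (d * m))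
        fun _ _ h => Nat.mul_le_mul_left q (hd h)))).pow (b := fun _ => 2 ^ q) monotone_const))

theorem PolyBdd.representativesBound {ι : Type v} {π : ι → Setting.{u}} (d q : ℕ) :
    PolyBdd π fun i => representativesBound d q ((π i).size + 1) (π i).param :=
  .add (.const q) ((PolyBdd.contextBound d q).mul (.classBound d q))

theorem contextBound_mono (d q N : ℕ) : Monotone (contextBound d q (N + 1)) := fun _ _ h =>
  Nat.pow_le_pow_left (Nat.pow_le_pow_right (by omega) (Nat.mul_le_mul_left d h)) q

theorem classBound_mono (d q N : ℕ) : Monotone (classBound d q (N + 1)) := fun m m' h => by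
  have h1 : (N + 1) ^ (d * m) ≤ (N + 1) ^ (d * m') :=
    Nat.pow_le_pow_right (by omega) (Nat.mul_le_mul_left d h)
  have h2 : ((N + 1) ^ (d * m)) ^ (q * (d * m)) ≤ ((N + 1) ^ (d * m')) ^ (q * (d * m')) :=
    (Nat.pow_le_pow_left h1 _).trans (Nat.pow_le_pow_right (by positivity)
      (Nat.mul_le_mul_left q (Nat.mul_le_mul_left d h)))
  unfold classBound
  gcongr

theorem representativesBound_mono (d q N : ℕ) : Monotone (representativesBound d q (N + 1)) :=
  fun _ _ h => Nat.add_le_add_left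
    (Nat.mul_le_mul (contextBound_mono d q N h) (classBound_mono d q N h)) q

namespace Comp

variable {ι : Type v} {q d : ℕ} {I : ι → Instance.{u} q} {e : ∀ i, Data (I i).W}

/-- The list of the best representatives so far is the state of a loop. Its length stays below
`B`, since the state is always the result for a sublist. -/
theorem best {π : ι → Setting.{u}} {e : ∀ i, Data (π i).W} {α : ι → Type w}
    {encA : ∀ i, α i → Data (π i).W} {l : ∀ i, List (α i)} {wt : ∀ i, α i → (π i).W}
    {sim : ∀ i, α i → α i → Prop} {B : ι → ℕ} (hl : Comp π e fun i => encodeList (encA i) (l i))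
    (hb : PolyBdd π fun i => (l i).length) (hB : PolyBdd π B)
    (hlen : ∀ i, ∀ l' ⊆ l i, (best (wt i) (sim i) l').length ≤ B i)
    (hsim : Comp (fun j : ElemPair l => π j.i)
      (fun j => .cons (encA j.i j.y) (.cons (encA j.i j.x) (e j.i))) fun j => bit (sim j.i j.y j.x))
    (hwt : Comp (fun j : Elem l => π j.i) (fun j => .cons (encA j.i j.x) (e j.i))
      fun j => .wt (wt j.i j.x)) :
    Comp π e fun i => encodeList (encA i) (best (wt i) (sim i) (l i)) := by
  classical
  let Inv : ∀ i, α i → List (α i) → Prop := fun i x s => x ∈ l i ∧ s ⊆ l i ∧ s.length ≤ B i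
  refine foldr (encS := fun i s => encodeList (encA i) s) (s₀ := fun _ => []) Inv hl hb nil
    (fun i pre x post h => ?_) ?_
  · have hpost : post ⊆ l i := fun y hy => by simp [h, hy]
    exact ⟨by simp [h], List.Subset.trans (best_subset post) hpost, hlen i post hpost⟩
  · have hlen' : PolyBdd (fun j : FoldStep Inv => π j.i) fun j => j.s.length :=
      (hB.reindex fun j : FoldStep Inv => j.i).mono fun j => j.inv.2.2
    have hs : Comp (fun j : Elem fun j : FoldStep Inv => j.s => π j.i.i)
        (fun j => .cons (encA j.i.i j.x) (.cons (encA j.i.i j.i.x)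
          (.cons (encodeList (encA j.i.i) j.i.s) (e j.i.i))))
        fun j => bit (sim j.i.i j.x j.i.x) :=
      Comp.seq (var₀.pair (var₁.pair Comp.ident.snd.snd.snd)) (hsim.reindex
        fun j : Elem fun j : FoldStep Inv => j.s =>
          (⟨j.i.i, j.i.x, j.x, j.i.inv.1, j.i.inv.2.1 j.mem⟩ : ElemPair l))
    have hy : Comp (fun j : Elem fun j : FoldStep Inv => j.s => π j.i.i)
        (fun j => .cons (encA j.i.i j.x) (.cons (encA j.i.i j.i.x)
          (.cons (encodeList (encA j.i.i) j.i.s) (e j.i.i)))) fun j => .wt (wt j.i.i j.x) :=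
      Comp.seq (var₀.pair Comp.ident.snd.snd.snd) (hwt.reindex
        fun j : Elem fun j : FoldStep Inv => j.s => (⟨j.i.i, j.x, j.i.inv.2.1 j.mem⟩ : Elem l))
    have hx : Comp (fun j : Elem fun j : FoldStep Inv => j.s => π j.i.i)
        (fun j => .cons (encA j.i.i j.x) (.cons (encA j.i.i j.i.x)
          (.cons (encodeList (encA j.i.i) j.i.s) (e j.i.i)))) fun j => .wt (wt j.i.i j.i.x) :=
      Comp.seq (var₁.pair Comp.ident.snd.snd.snd) (hwt.reindex
        fun j : Elem fun j : FoldStep Inv => j.s => (⟨j.i.i, j.i.x, j.i.inv.1⟩ : Elem l))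
    refine (ite (exists_mem (p := fun j y => sim j.i y j.x ∧ wt j.i y ≤ wt j.i j.x) var₁ hlen'
      (.and hs (.wt_le hy hx))) var₁
      (.pair var₀ (filter (p := fun j y => ¬ sim j.i y j.x) var₁ hlen' hs.not))).congr fun j => ?_
    rw [insertBest]
    split_ifs <;> rfl

variable {A : ∀ i, Set (Fin (I i).size)} {L L' : ∀ i, List (Fin (I i).size → Option (Fin q))}

theorem extensions {x : ∀ i, Fin (I i).size}
    (hI : Comp (fun i => (I i).toSetting) e fun i => (I i).encode d)
    (hx : Comp (fun i => (I i).toSetting) e fun i => .ofNat (x i))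
    (hL : Comp (fun i => (I i).toSetting) e fun i => encodeList encodePartial (L i))
    (hb : PolyBdd (fun i => (I i).toSetting) fun i => (L i).length) :
    Comp (fun i => (I i).toSetting) e fun i =>
      encodeList encodePartial (extensions (x i) (L i)) := by
  classical
  refine flatMap hL hb ((hb.mul (.const q)).mono fun i => ?_)
    (map (finRange (N := fun _ => q) (nat q) (.const q))
      (length_finRange_polyBdd (.const q)) (ofFn (size hI.up₂) size_polyBdd ?_))
  · simp [List.length_flatMap]
  · refine (ite (natEq var₀ hx.up₃ ?_ ?_) var₁.succ (value var₂ var₀)).congr fun j => ?_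
    · exact fin_polyBdd (I := fun j : Step fun j : Elem fun j : Elem L => List.finRange q =>
        (I j.i.i).size => I j.i.i.i) _
    · exact fin_polyBdd (I := fun j : Step fun j : Elem fun j : Elem L => List.finRange q =>
        (I j.i.i).size => I j.i.i.i) _
    · by_cases h : j.k = x j.i.i.i
      · simp [h]
      · rw [if_neg (fun h' => h (Fin.ext h')), Function.update_of_ne h]

theorem length_extensions {n : ℕ} (x : Fin n) (L : List (Fin n → Option (Fin q))) :
    (LocallyCheckable.extensions x L).length = L.length * q := by
  simp [LocallyCheckable.extensions, List.length_flatMap]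

theorem contexts (hI : Comp (fun i => (I i).toSetting) e fun i => (I i).encode d)
    (hA : Comp (fun i => (I i).toSetting) e fun i => encodeSet (A i))
    (hm : ∀ i, mim (I i).G (A i) ≤ (I i).param) :
    Comp (fun i => (I i).toSetting) e fun i =>
      encodeList encodePartial (contexts d q (I i).G (A i)) := by
  classical
  let Inv : ∀ i, Fin (I i).size → List (Fin (I i).size → Option (Fin q)) → Prop := fun i _ s =>
    s.length ≤ contextBound d q ((I i).size + 1) (I i).param
  refine foldr (encS := fun i s => encodeList encodePartial s)
    (s₀ := fun i => [fun _ => none]) Inv (finRange (size hI) size_polyBdd)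
    (length_finRange_polyBdd size_polyBdd) (.pair (emptyPartial hI) nil)
    (fun i pre x post h => ?_) ?_
  · have hpost : post.Nodup := (h ▸ List.nodup_finRange _ :
      (pre ++ x :: post).Nodup).of_append_right.of_cons
    exact (length_contextsIn_le hpost).trans (contextBound_mono d q _ (hm i))
  · have hlen : PolyBdd (fun j : FoldStep Inv => (I j.i).toSetting) fun j => j.s.length :=
      (PolyBdd.contextBound d q).mono fun j => j.inv
    have hlen' : PolyBdd (fun j : FoldStep Inv => (I j.i).toSetting) fun j =>
        (LocallyCheckable.extensions j.x j.s).length :=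
      (hlen.mul (.const q)).mono fun j => (length_extensions _ _).le
    refine append (filter (extensions (I := fun j : FoldStep Inv => I j.i) hI.up₂ var₀ var₁ hlen)
      hlen' (admissible hI.up₃ hA.up₃ var₀)) (hlen'.mono fun j => List.length_filter_le _ _) var₁

theorem reduce (hd : 0 < d) (hI : Comp (fun i => (I i).toSetting) e fun i => (I i).encode d)
    (hA : Comp (fun i => (I i).toSetting) e fun i => encodeSet (A i))
    (hL : Comp (fun i => (I i).toSetting) e fun i => encodeList encodePartial (L i))
    (hb : PolyBdd (fun i => (I i).toSetting) fun i => (L i).length)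
    (hm : ∀ i, mim (I i).G (A i) ≤ (I i).param) (hdom : ∀ i, ∀ ρ ∈ L i, dom ρ = A i) :
    Comp (fun i => (I i).toSetting) e fun i => encodeList encodePartial
      (reduce d (I i).G (I i).check (I i).w {C | C ∈ (I i).Cs} (A i) (L i)) := by
  classical
  refine flatMap (contexts hI hA hm)
    ((PolyBdd.contextBound d q).mono fun i => (length_contextsIn_le (List.nodup_finRange _)).trans
      (contextBound_mono d q _ (hm i)))
    (((PolyBdd.contextBound d q).mul (.classBound d q)).mono fun i =>
      (length_reduce_le hd (hdom i)).trans
        (Nat.mul_le_mul (contextBound_mono d q _ (hm i)) (classBound_mono d q _ (hm i)))) ?_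
  have hb' : PolyBdd (fun j : Elem fun i => LocallyCheckable.contexts d q (I i).G (A i) =>
      (I j.i).toSetting) fun j => (L j.i).length := hb.reindex _
  refine best (B := fun j => classBound d q ((I j.i).size + 1) (I j.i).param)
    (filter hL.up hb' (locallyProper hI.up₂ var₀ var₁))
    (hb'.mono fun j => List.length_filter_le _ _) (.classBound d q) (fun j l hl => ?_)
    (similar hI.up₃ hA.up₃ var₂ var₀ var₁) (localWeight hI.up₂ var₀ var₁)
  exact (length_best_le hd (fun ρ hρ => hdom j.i ρ (List.mem_filter.1 (hl hρ)).1)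
    (mem_contexts.1 j.mem) _).trans (classBound_mono d q _ (hm j.i))

theorem products (hI : Comp (fun i => (I i).toSetting) e fun i => (I i).encode d)
    (hL : Comp (fun i => (I i).toSetting) e fun i => encodeList encodePartial (L i))
    (hL' : Comp (fun i => (I i).toSetting) e fun i => encodeList encodePartial (L' i))
    (hb : PolyBdd (fun i => (I i).toSetting) fun i => (L i).length)
    (hb' : PolyBdd (fun i => (I i).toSetting) fun i => (L' i).length) :
    Comp (fun i => (I i).toSetting) e fun i =>
      encodeList encodePartial (products (L i) (L' i)) :=
  flatMap hL hb ((hb.mul hb').mono fun i => (length_products (L i) (L' i)).le)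
    (map hL'.up (hb'.reindex fun j : Elem L => j.i) (merge hI.up₂ var₁ var₀))

theorem length_representatives_polyBdd (hd : 0 < d) {T : ∀ i, BinTree (Fin (I i).size)}
    (hT : ∀ i, mim (I i).G {x | x ∈ (T i).leaves} ≤ (I i).param) :
    PolyBdd (fun i => (I i).toSetting) fun i =>
      (representatives d (I i).G (I i).check (I i).w {C | C ∈ (I i).Cs} (T i)).length :=
  (PolyBdd.representativesBound d q).mono fun i =>
    (length_representatives_le hd (T i)).trans (representativesBound_mono d q _ (hT i))

theorem mim_le_mimw {V : Type v} (G : SimpleGraph V) (T : BinTree V) :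
    mim G {x | x ∈ T.leaves} ≤ mimw G T := by
  cases T with
  | leaf x => simp [BinTree.leaves, mimw]
  | node l r => exact le_max_left _ _

/-- The representatives are computed along the decomposition tree, together with the sets of
vertices which they colour. -/
theorem representatives (hd : 0 < d)
    (hI : Comp (fun i => (I i).toSetting) e fun i => (I i).encode d) :
    Comp (fun i => (I i).toSetting) e fun i => encodeList encodePartial
      (representatives d (I i).G (I i).check (I i).w {C | C ∈ (I i).Cs} (I i).T) := by
  classical
  let Inv : ∀ i, BinTree (Fin (I i).size) → Prop := fun i T => mimw (I i).G T ≤ (I i).param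
  refine (treeRec (F := fun i T => .cons (encodeSet {x | x ∈ T.leaves}) (encodeList encodePartial
    (LocallyCheckable.representatives d (I i).G (I i).check (I i).w {C | C ∈ (I i).Cs} T)))
    (Inv := Inv) hI.snd.snd.fst (size_polyBdd.mono fun i => ?_) (fun i => (I i).mimw_le)
    (fun i l r h => ?_) ?_ ?_).snd
  · simpa using (I i).isDecomposition.1.length_le_card
  · exact ⟨((le_max_left _ _).trans (le_max_right _ _)).trans h,
      ((le_max_right _ _).trans (le_max_right _ _)).trans h⟩
  · refine .pair (set (I := fun j : LeafStep _ Inv => I j.i) hI.up (iff_congr (natEq var₀ var₁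
        (fin_polyBdd (I := fun j : Step fun j : LeafStep _ Inv => (I j.i).size => I j.i.i) _)
        (fin_polyBdd (I := fun j : Step fun j : LeafStep _ Inv => (I j.i).size => I j.i.i) _))
        fun j => ?_))
      (map (finRange (N := fun _ => q) (nat q) (.const q)) (length_finRange_polyBdd (.const q))
        (ofFn (size hI.up₂) size_polyBdd ((ite (natEq var₀ var₂
          (fin_polyBdd (I := fun j : Step fun j : Elem fun j : LeafStep _ Inv =>
            List.finRange q => (I j.i.i).size => I j.i.i.i) _)
          (fin_polyBdd (I := fun j : Step fun j : Elem fun j : LeafStep _ Inv =>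
            List.finRange q => (I j.i.i).size => I j.i.i.i) _)) var₁.succ nil).congr
          fun j => ?_)))
    · simp [BinTree.leaves, Fin.ext_iff]
    · simp only [← Fin.ext_iff]
      split_ifs <;> rfl
  · have hl : ∀ j : NodeStep _ Inv, mim (I j.i).G {x | x ∈ j.l.leaves} ≤ (I j.i).param :=
      fun j => (mim_le_mimw _ _).trans
        (((le_max_left _ _).trans (le_max_right _ _)).trans j.inv)
    have hr : ∀ j : NodeStep _ Inv, mim (I j.i).G {x | x ∈ j.r.leaves} ≤ (I j.i).param :=
      fun j => (mim_le_mimw _ _).trans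
        (((le_max_right _ _).trans (le_max_right _ _)).trans j.inv)
    have hbl := length_representatives_polyBdd (I := fun j : NodeStep _ Inv => I j.i) hd hl
    have hbr := length_representatives_polyBdd (I := fun j : NodeStep _ Inv => I j.i) hd hr
    let env : ∀ j : NodeStep (fun i => (I i).size) Inv, Data (I j.i).W := fun j =>
      .cons (.cons (encodeSet {x | x ∈ j.l.leaves}) (encodeList encodePartial
        (LocallyCheckable.representatives d (I j.i).G (I j.i).check (I j.i).w
          {C | C ∈ (I j.i).Cs} j.l)))
        (.cons (.cons (encodeSet {x | x ∈ j.r.leaves}) (encodeList encodePartial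
          (LocallyCheckable.representatives d (I j.i).G (I j.i).check (I j.i).w
            {C | C ∈ (I j.i).Cs} j.r))) (e j.i))
    have hAl : Comp (fun j : NodeStep _ Inv => (I j.i).toSetting) env fun j =>
        encodeSet {x | x ∈ j.l.leaves} := Comp.ident.fst.fst
    have hAr : Comp (fun j : NodeStep _ Inv => (I j.i).toSetting) env fun j =>
        encodeSet {x | x ∈ j.r.leaves} := Comp.ident.snd.fst.fst
    have hA : Comp (fun j : NodeStep _ Inv => (I j.i).toSetting) env fun j =>
        encodeSet {x | x ∈ (BinTree.node j.l j.r).leaves} :=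
      Comp.congr (union (I := fun j : NodeStep _ Inv => I j.i) hI.up₂ hAl hAr)
        fun j => by rw [leaves_node]
    refine .pair hA (reduce (I := fun j : NodeStep _ Inv => I j.i) hd hI.up₂ hA
      (products (I := fun j : NodeStep _ Inv => I j.i) hI.up₂ (e := env)
        Comp.ident.fst.snd Comp.ident.snd.fst.snd hbl hbr)
      ((hbl.mul hbr).mono fun j => (length_products _ _).le)
      (fun j => (mim_le_mimw _ _).trans j.inv) fun j ρ hρ => ?_)
    rw [leaves_node]
    exact dom_of_mem_products (fun _ => dom_of_mem_representatives)
      (fun _ => dom_of_mem_representatives) hρ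

theorem finalists (hI : Comp (fun i => (I i).toSetting) e fun i => (I i).encode d)
    (hL : Comp (fun i => (I i).toSetting) e fun i => encodeList encodePartial (L i))
    (hb : PolyBdd (fun i => (I i).toSetting) fun i => (L i).length) :
    Comp (fun i => (I i).toSetting) e fun i => encodeList encodePartial
      (finalists d (I i).G (I i).check (I i).w {K | K ∈ (I i).Ks} {C | C ∈ (I i).Cs} (L i)) := by
  classical
  refine best (B := fun _ => 1) (filter hL hb (passes hI.up var₀))
    (hb.mono fun j => List.length_filter_le _ _) (.const 1) (fun i l hl => ?_)
    (Comp.true) (localWeight hI.up var₀ (emptyPartial hI.up))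
  have hpair := pairwise_best (wt := fun ρ => LocallyCheckable.localWeight d (I i).G (I i).w ρ
    fun _ => none) (sim := fun _ _ => True) (fun _ _ _ => trivial) l
  generalize LocallyCheckable.best (W := (I i).W) _ _ l = l' at hpair ⊢
  match l' with
  | [] => simp
  | [_] => simp
  | x :: y :: _ => exact absurd trivial ((List.pairwise_cons.1 hpair).1 y (by simp))

theorem answer (hI : Comp (fun i => (I i).toSetting) e fun i => (I i).encode d)
    (hL : Comp (fun i => (I i).toSetting) e fun i => encodeList encodePartial (L i)) :
    Comp (fun i => (I i).toSetting) e fun i => answer d (I i).G (I i).w (L i) := by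
  classical
  have hne : ∀ i, encodeList (W := (I i).W) encodePartial (L i) ≠ .nil ↔ L i ≠ [] := fun i => by
    cases L i <;> simp [encodeList, Data.ofList]
  have hρ : Comp (fun i => (I i).toSetting) e fun i =>
      encodePartial ((L i).headD fun _ => none) := by
    refine (ite_data hL hne hL.fst (emptyPartial hI)).congr fun i => ?_
    cases L i <;> rfl
  refine (ite_data hL hne (.pair (localWeight hI hρ (emptyPartial hI))
    (ofFn (f := fun i x => .snd (.ofNat ((((L i).headD fun _ => none) x).elim 0 fun a => a + 1)))
      (size hI) size_polyBdd (value hρ.up var₀).snd)) (.pair top nil)).congr fun i => ?_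
  cases h : L i with
  | nil => rfl
  | cons ρ l =>
    simp only [ne_eq, reduceCtorEq, not_false_eq_true, if_true, LocallyCheckable.answer,
      List.headD_cons]
    congr 2
    funext x
    cases ρ x <;> rfl

/-- The number of vertices is the number of rows of the adjacency matrix. -/
theorem encode : Comp (fun i => (I i).toSetting)
    (fun i => .input d (I i).G (I i).T (I i).check (I i).w (I i).Ks (I i).Cs)
    fun i => (I i).encode d := by
  have h : Comp (fun i => (I i).toSetting)
      (fun i => .input d (I i).G (I i).T (I i).check (I i).w (I i).Ks (I i).Cs) fun i =>
      encodeList (fun x => x) (List.ofFn fun x : Fin (I i).size =>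
        Data.ofFn (W := (I i).W) fun y => .ofBool (decide ((I i).G.Adj x y))) :=
    Comp.ident.fst.congr fun i => by rw [encodeList, List.map_id']; rfl
  refine .pair ((map (encB := fun _ x => x) (f := fun _ _ => .nil) h
    (by simpa using size_polyBdd) nil).congr fun i => ?_) .ident
  rw [encodeList, List.map_id', List.map_const', List.length_ofFn]
  rfl

theorem solve (hd : 0 < d) : Comp (fun i => (I i).toSetting)
    (fun i => .input d (I i).G (I i).T (I i).check (I i).w (I i).Ks (I i).Cs)
    fun i => LocallyCheckable.answer d (I i).G (I i).w (LocallyCheckable.finalists d (I i).G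
      (I i).check (I i).w {K | K ∈ (I i).Ks} {C | C ∈ (I i).Cs}
      (LocallyCheckable.representatives d (I i).G (I i).check (I i).w {C | C ∈ (I i).Cs}
        (I i).T)) :=
  encode.seq (answer .ident (finalists .ident (representatives hd .ident)
    (length_representatives_polyBdd hd fun i => (mim_le_mimw _ _).trans (I i).mimw_le)))

end Comp

end LocallyCheckable

theorem mainTheorem3 :
    ∀ d q : ℕ, 0 < d → 0 < q →
      -- one algorithm for the given number of colours and the given `d`
      ∃ p : LocallyCheckable.Prog,
        -- its running time is polynomial when the mim-width of the trees is bounded by `m`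
        ∀ m : ℕ, ∃ P : Polynomial ℕ,
          ∀ (W : Type*) [LocallyCheckable.WeightSet W] (n : ℕ)
            (G : SimpleGraph (Fin n)) [DecidableRel G.Adj]
            (T : LocallyCheckable.BinTree (Fin n))
            (check : Fin n → Fin q → (Fin q → ℕ) → Bool)
            (w : Fin n → Fin q → (Fin q → ℕ) → W)
            (𝒦 : Finset (Fin q → ℕ)) (𝒞 : Finset (Finset (Fin q)))
            (Ks : List (Fin q → ℕ)) (Cs : List (Finset (Fin q))),
            T.IsDecomposition → LocallyCheckable.mimw G T ≤ m →
            LocallyCheckable.IsStable d G check → LocallyCheckable.IsStable d G w →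
            (∀ K ∈ 𝒦, ∑ j, K j = n) →
            -- the lists of constraints in the input enumerate `𝒦` and `𝒞` without repetition
            Ks.Nodup → Ks.toFinset = 𝒦 → Cs.Nodup → Cs.toFinset = 𝒞 →
            ∃ (out : LocallyCheckable.Data W) (t : ℕ),
              LocallyCheckable.Runs p
                (LocallyCheckable.Data.input d G T check w Ks Cs) out t ∧
              t ≤ P.eval n ∧
              LocallyCheckable.IsSolution G check w 𝒦 𝒞 out := by
  intro d q hd hq
  obtain ⟨p, hp⟩ := LocallyCheckable.Comp.solve (I := fun I : LocallyCheckable.Instance q => I) hd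
  refine ⟨p, fun m => ?_⟩
  obtain ⟨k, hk⟩ := hp m
  refine ⟨(Polynomial.X + 2) ^ k, ?_⟩
  intro W _ n G _ T check w 𝒦 𝒞 Ks Cs hT hm hcheck hw hsum hKs hK hCs hC
  obtain ⟨t, ht, hr⟩ := hk
    { W := W, size := n, param := m, G := G, T := T, check := check, w := w, Ks := Ks, Cs := Cs,
      isDecomposition := hT, mimw_le := hm, nodup_Ks := hKs,
      sum_eq := fun K h => hsum K (hK ▸ List.mem_toFinset.2 h), nodup_Cs := hCs } le_rfl
  refine ⟨_, t, hr, by simpa using ht, ?_⟩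
  have hK' : {K | K ∈ Ks} = (𝒦 : Set (Fin q → ℕ)) := by simp [← hK]
  have hC' : {C | C ∈ Cs} = (𝒞 : Set (Finset (Fin q))) := by simp [← hC]
  dsimp only
  rw [hK', hC']
  refine LocallyCheckable.isSolution_answer hcheck hw
    (LocallyCheckable.represents_representatives hd hcheck hw T) (fun ρ hρ => ?_) hq
  rw [LocallyCheckable.dom_of_mem_representatives hρ]
  exact Set.eq_univ_of_forall hT.2
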